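/- **Setting.** Let $\mathbf Q$ be a smooth finite-dimensional manifold (Hausdorff, second countable) and $\pi:\mathbf Q\to\mathbb R$ a smooth fibre bundle (more generally, a smooth submersion), $t=\pi$. Identify the first jet bundle with $J^1\pi=\{v\in T\mathbf Q:\ d\pi(v)=1\}$. Let $S=(dq^i-\dot q^i\,dt)\otimes\partial_{\dot q^i}$ be the vertical endomorphism of $J^1\pi$, and for a smooth $L:J^1\pi\to\mathbb R$ put $\theta_L=L\,dt+i_S\,dL$ and $\omega_L=-d\theta_L$. A pair $(\omega,\tau)$ of a smooth closed $2$-form and a smooth closed $1$-form on an odd-dimensional manifold is *cosymplectic* if $v\mapsto i_v\omega+\tau(v)\tau$ is an isomorphism $TM\to T^*M$; the orthogonal of a subspace $W$ of $T_pM$ is then $W^{\perp}=\{v\in\ker\tau:\ \omega(v,w)=0\ \forall w\in W\cap\ker\tau\}$, and a submanifold $N$ is *coisotropic* if $(T_pN)^\perp\subseteq T_pN$ for all $p\in N$. $L$ is *singular* if $(\omega_L,dt)$ is not cosymplectic, and *consistent* if there is a smooth vector field $X$ on $J^1\pi$ with $i_X\omega_L=0$, $dt(X)=1$ and $S(X)=0$.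 Let $\mathbf K\subseteq T\mathbf Q$ be a regular, integrable distribution which is vertical, $\mathbf K\subseteq\ker d\pi$. Its complete lift $\mathbf K^C\subseteq TJ^1\pi$ is spanned by the complete lifts $X^C$ and the vertical lifts $X^V$ of the local sections $X$ of $\mathbf K$. Let $\tilde\pi:\mathbf K^*\to\mathbf Q\to\mathbb R$. The *Tulczyjew isomorphism* $\alpha:J^1\tilde\pi\to(\mathbf K^C)^*$ covers the identity of $J^1\pi$ and is given by $$\langle\alpha(j^1_s\mu),X^C\rangle=\tfrac{d}{dt}\big|_{t=s}\langle\mu,X\rangle,\qquad \langle\alpha(j^1_s\mu),X^V\rangle=\langle\mu(s),X\rangle .$$ Let $\nabla$ be an Ehresmann connection on the bundle $\mathbf K^*\to\mathbf Q$, that is, a smooth splitting $T\mathbf K^*=\mathcal V\oplus\mathcal H_\nabla$ with $\mathcal V$ the vertical bundle, such that along the zero section $\mathcal H_\nabla$ is the tangent bundle $T\mathbf Q$ of the zero section; let $p_{\mathcal V}$ be the projection onto $\mathcal V$, whose values are regarded as elements of $\mathbf K^*$. Let $P$ be a smooth projector of $T\mathbf Q$ with image $\mathbf K$. Define $F^{P,\nabla}:J^1\tilde\pi\to\mathbb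 R$ by $F^{P,\nabla}(\xi)=\langle P(v),p_{\mathcal V}(\xi)\rangle$, where $v\in J^1\pi$ is the projection of $\xi$ and jets are regarded as tangent vectors. **Theorem.** Let $L:J^1\pi\to\mathbb R$ be a smooth, singular, consistent Lagrangian with $\ker\omega_L\cap\ker dt=\mathbf K^C$, and let $\nabla$ and $P$ be as above. Then the Tulczyjew isomorphism $\alpha:J^1\tilde\pi\cong(\mathbf K^C)^*$ exists as a bijection, the function $\tilde L=L+F^{P,\nabla}$ (where $L$ is pulled back along $J^1\tilde\pi\to J^1\pi$) is smooth on $J^1\tilde\pi$, and there is an open neighbourhood $U$ in $J^1\tilde\pi$ of the image of $$J^1\pi\hookrightarrow(\mathbf K^C)^*\cong J^1\tilde\pi$$ (the zero section followed by $\alpha^{-1}$) such that $(\omega_{\tilde L},dt)$ is a cosymplectic structure on $U$, and this map is a closed smooth embedding which pulls $(\omega_{\tilde L},dt)$ back to $(\omega_L,dt)$ and whose image is coisotropic in $(U,\omega_{\tilde L},dt)$. -/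

import Mathlib

set_option linter.unusedSectionVars false

open scoped Manifold ContDiff Topology
open Bundle

section LevelSet

variable {E : Type*} [NormedAddCommGroup E] [NormedSpace ℝ E] [FiniteDimensional ℝ E]
  {H : Type*} [TopologicalSpace H] {I : ModelWithCorners ℝ E H}
  {N : Type*} [TopologicalSpace N] [ChartedSpace H N]

/-- The model space of a hypersurface in a manifold modelled on `E`. -/
abbrev HyperModel (E : Type*) [NormedAddCommGroup E] [NormedSpace ℝ E] : Type :=
  EuclideanSpace ℝ (Fin (Module.finrank ℝ E - 1))

lemma exists_complement (l : E →L[ℝ] ℝ) (hl : l ≠ 0) :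
    ∃ e : E ≃L[ℝ] ℝ × HyperModel E, ∀ x, (e x).1 = l x := by
  obtain ⟨x₀, hx₀⟩ : ∃ x, l x ≠ 0 := by
    by_contra h
    push Not at h
    exact hl (ContinuousLinearMap.ext h)
  have hr : Module.finrank ℝ (LinearMap.ker l.toLinearMap) + 1 = Module.finrank ℝ E := by
    have h1 := LinearMap.finrank_range_add_finrank_ker l.toLinearMap
    have h2 : LinearMap.range l.toLinearMap = ⊤ := by
      rw [LinearMap.range_eq_top]
      intro c
      exact ⟨(c / l x₀) • x₀, by simp [hx₀]⟩
    rw [h2, finrank_top, Module.finrank_self] at h1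
    omega
  have hk : Module.finrank ℝ (LinearMap.ker l.toLinearMap)
      = Module.finrank ℝ (HyperModel E) := by
    rw [finrank_euclideanSpace_fin]; omega
  let A := LinearEquiv.ofFinrankEq _ _ hk
  let p : E →ₗ[ℝ] LinearMap.ker l.toLinearMap :=
    (LinearMap.id - (l.toLinearMap).smulRight ((l x₀)⁻¹ • x₀)).codRestrict _ (by
      intro x; simp [hx₀])
  let f : E →ₗ[ℝ] ℝ × HyperModel E := l.toLinearMap.prod (A.toLinearMap ∘ₗ p)
  have hf : Function.Injective f := by
    rw [injective_iff_map_eq_zero]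
    intro x hx
    have h1 : l x = 0 := congrArg Prod.fst hx
    have h2 : A (p x) = 0 := congrArg Prod.snd hx
    have h3 : p x = 0 := by simpa using h2
    have h4 : x - l x • ((l x₀)⁻¹ • x₀) = 0 := congrArg Subtype.val h3
    simpa [h1] using h4
  have hd : Module.finrank ℝ E = Module.finrank ℝ (ℝ × HyperModel E) := by
    rw [Module.finrank_prod, Module.finrank_self, finrank_euclideanSpace_fin]; omega
  exact ⟨(LinearEquiv.ofInjectiveOfFinrankEq f hf hd).toContinuousLinearEquiv, fun x => rfl⟩

/-- Submanifold charts: near a regular point, a smooth function is the first component of a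
smooth chart. -/
lemma exists_sliceChart [I.Boundaryless] [IsManifold I ∞ N] {f : N → ℝ}
    (hf : ContMDiff I 𝓘(ℝ, ℝ) ∞ f) (p : N) (hp : mfderiv I 𝓘(ℝ, ℝ) f p ≠ 0) :
    ∃ Θ : OpenPartialHomeomorph N (ℝ × HyperModel E), p ∈ Θ.source ∧
      (∀ q ∈ Θ.source, (Θ q).1 = f q) ∧
      ContMDiffOn I 𝓘(ℝ, ℝ × HyperModel E) ∞ Θ Θ.source ∧
      ContMDiffOn 𝓘(ℝ, ℝ × HyperModel E) I ∞ Θ.symm Θ.target := by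
  set φ := extChartAt I p with hφ
  let g : E → ℝ := f ∘ φ.symm
  have hg : ContDiffOn ℝ ∞ g φ.target :=
    (hf.comp_contMDiffOn (contMDiffOn_extChartAt_symm p)).contDiffOn
  have htop : IsOpen φ.target := isOpen_extChartAt_target p
  have hpt : φ p ∈ φ.target := mem_extChartAt_target p
  have hgd : ∀ y ∈ φ.target, DifferentiableAt ℝ g y := fun y hy =>
    (hg.contDiffAt (htop.mem_nhds hy)).differentiableAt (by simp)
  have hl : fderiv ℝ g (φ p) ≠ 0 := by
    intro h
    apply hp
    have h1 : MDifferentiableAt I 𝓘(ℝ, ℝ) f p := hf.mdifferentiableAt (by simp)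
    have : mfderiv I 𝓘(ℝ, ℝ) f p = fderivWithin ℝ (writtenInExtChartAt I 𝓘(ℝ, ℝ) p f)
      (Set.range I) (φ p) := by
      unfold mfderiv; exact if_pos h1
    rw [this, I.range_eq_univ, fderivWithin_univ]
    exact h
  obtain ⟨e, he⟩ := exists_complement _ hl
  let G : E → ℝ × HyperModel E := fun y => (g y, (e y).2)
  have hG : ContDiffOn ℝ ∞ G φ.target :=
    hg.prodMk ((contDiff_snd.comp e.contDiff).contDiffOn)
  have hG' : ∀ y ∈ φ.target, HasFDerivAt G
      ((fderiv ℝ g y).prod ((ContinuousLinearMap.snd ℝ ℝ (HyperModel E)).comp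
        (e : E →L[ℝ] ℝ × HyperModel E))) y := fun y hy =>
    ((hgd y hy).hasFDerivAt).prodMk
      (((ContinuousLinearMap.snd ℝ ℝ (HyperModel E)).comp
        (e : E →L[ℝ] ℝ × HyperModel E)).hasFDerivAt)
  have hGp : HasFDerivAt G (e : E →L[ℝ] ℝ × HyperModel E) (φ p) := by
    convert hG' _ hpt using 1
    ext x <;> simp [he]
  have hGc : ContDiffAt ℝ ∞ G (φ p) := hG.contDiffAt (htop.mem_nhds hpt)
  let Ψ₀ := hGc.toOpenPartialHomeomorph G hGp (by simp)
  have hΨ₀ : φ p ∈ Ψ₀.source := hGc.mem_toOpenPartialHomeomorph_source hGp (by simp)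
  have hfc : ContinuousOn (fderiv ℝ G) φ.target :=
    hG.continuousOn_fderiv_of_isOpen htop (by simp)
  let O : Set E := φ.target ∩ fderiv ℝ G ⁻¹' Set.range
    ((↑) : (E ≃L[ℝ] ℝ × HyperModel E) → E →L[ℝ] ℝ × HyperModel E)
  have hO : IsOpen O := hfc.isOpen_inter_preimage htop ContinuousLinearEquiv.isOpen
  have hpO : φ p ∈ O := ⟨hpt, e, hGp.fderiv.symm⟩
  let Ψ := Ψ₀.restrOpen O hO
  have hΨs : Ψ.source = Ψ₀.source ∩ O := Ψ₀.restrOpen_source O hO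
  have hΨG : ∀ y, Ψ y = G y := fun y => rfl
  have hΨ1 : ContDiffOn ℝ ∞ Ψ Ψ.source := hG.mono (by
    rw [hΨs]; exact fun y hy => hy.2.1)
  have hΨ2 : ContDiffOn ℝ ∞ Ψ.symm Ψ.target := by
    intro z hz
    have hz' : Ψ.symm z ∈ Ψ.source := Ψ.map_target hz
    rw [hΨs] at hz'
    obtain ⟨e', he'⟩ := hz'.2.2
    refine (Ψ.contDiffAt_symm (f₀' := e') hz ?_ ?_).contDiffWithinAt
    · rw [he']
      exact (hG' _ hz'.2.1).differentiableAt.hasFDerivAt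
    · exact hG.contDiffAt (htop.mem_nhds hz'.2.1)
  let Φ : OpenPartialHomeomorph N E := (chartAt H p).trans I.toHomeomorph.toOpenPartialHomeomorph
  have hΦ : ∀ q, Φ q = φ q := fun q => rfl
  have hΦs : Φ.source = φ.source := by simp [Φ, hφ]
  have hΦt : Φ.target = φ.target := by
    ext y
    simp only [Φ, hφ, mfld_simps, I.range_eq_univ]
    simp [ModelWithCorners.toHomeomorph]
  have hΦsy : ∀ y, Φ.symm y = φ.symm y := fun y => rfl
  refine ⟨Φ.trans Ψ, ?_, ?_, ?_, ?_⟩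
  · rw [OpenPartialHomeomorph.trans_source, hΦs, hΨs]
    exact ⟨mem_extChartAt_source p, hΨ₀, hpO⟩
  · intro q hq
    rw [OpenPartialHomeomorph.trans_source, hΦs] at hq
    change g (φ q) = f q
    simp [g, φ.left_inv hq.1]
  · have h1 : ContMDiffOn I 𝓘(ℝ, E) ∞ Φ φ.source := by
      rw [hφ, extChartAt_source]; exact contMDiffOn_extChartAt
    refine (hΨ1.contMDiffOn).comp (h1.mono ?_) ?_
    · rw [OpenPartialHomeomorph.trans_source, hΦs]; exact Set.inter_subset_left
    · rw [OpenPartialHomeomorph.trans_source]; exact Set.inter_subset_right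
  · have h1 : ContMDiffOn 𝓘(ℝ, E) I ∞ Φ.symm φ.target := contMDiffOn_extChartAt_symm p
    refine h1.comp ((hΨ2.contMDiffOn).mono ?_) ?_
    · rw [OpenPartialHomeomorph.trans_target]; exact Set.inter_subset_left
    · rw [OpenPartialHomeomorph.trans_target]; exact fun y hy => hΦt ▸ hy.2


open Classical in
/-- The inverse of a chart of the level set `f = c`, with the default value `p` off its domain. -/
noncomputable def levelChartInv {f : N → ℝ} {c : ℝ}
    (Θ : OpenPartialHomeomorph N (ℝ × HyperModel E)) (hΘ : ∀ q ∈ Θ.source, (Θ q).1 = f q)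
    (p : {q : N // f q = c}) (v : HyperModel E) : {q : N // f q = c} :=
  if hv : (c, v) ∈ Θ.target then
    ⟨Θ.symm (c, v), by rw [← hΘ _ (Θ.map_target hv), Θ.right_inv hv]⟩
  else p

lemma levelChartInv_coe {f : N → ℝ} {c : ℝ} (Θ : OpenPartialHomeomorph N (ℝ × HyperModel E))
    (hΘ : ∀ q ∈ Θ.source, (Θ q).1 = f q) (p : {q : N // f q = c}) {v : HyperModel E}
    (hv : (c, v) ∈ Θ.target) : (levelChartInv Θ hΘ p v).1 = Θ.symm (c, v) := by
  rw [levelChartInv, dif_pos hv]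

/-- The chart of the level set `f = c` cut out by a slice chart of the ambient manifold. -/
noncomputable def levelChart {f : N → ℝ} {c : ℝ} (Θ : OpenPartialHomeomorph N (ℝ × HyperModel E))
    (hΘ : ∀ q ∈ Θ.source, (Θ q).1 = f q) (p : {q : N // f q = c}) :
    OpenPartialHomeomorph {q : N // f q = c} (HyperModel E) := by
  have key : ∀ v, (c, v) ∈ Θ.target → f (Θ.symm (c, v)) = c := fun v hv => by
    rw [← hΘ _ (Θ.map_target hv), Θ.right_inv hv]
  have key2 : ∀ q : {q : N // f q = c}, q.1 ∈ Θ.source → (c, (Θ q.1).2) = Θ q.1 := fun q hq =>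
    Prod.ext ((hΘ _ hq).trans q.2).symm rfl
  let g := levelChartInv Θ hΘ p
  have hg : ∀ v, (c, v) ∈ Θ.target → (g v).1 = Θ.symm (c, v) :=
    fun v hv => levelChartInv_coe Θ hΘ p hv
  exact
  { toFun := fun q => (Θ q.1).2
    invFun := g
    source := {q | q.1 ∈ Θ.source}
    target := {v | (c, v) ∈ Θ.target}
    map_source' := fun q hq => by
      change (c, (Θ q.1).2) ∈ Θ.target
      rw [key2 q hq]; exact Θ.map_source hq
    map_target' := fun v hv => by
      change (g v).1 ∈ Θ.source
      rw [hg v hv]; exact Θ.map_target hv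
    left_inv' := fun q hq => by
      apply Subtype.ext
      rw [hg _ (by rw [key2 q hq]; exact Θ.map_source hq), key2 q hq, Θ.left_inv hq]
    right_inv' := fun v hv => by
      rw [hg v hv, Θ.right_inv hv]
    open_source := Θ.open_source.preimage continuous_subtype_val
    open_target := Θ.open_target.preimage (by fun_prop)
    continuousOn_toFun := continuous_snd.comp_continuousOn
      (Θ.continuousOn.comp continuous_subtype_val.continuousOn fun q hq => hq)
    continuousOn_invFun := by
      refine Topology.IsInducing.subtypeVal.continuousOn_iff.2 ?_
      refine (Θ.continuousOn_symm.comp (f := fun v : HyperModel E => (c, v))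
        (by fun_prop) fun v hv => hv).congr fun v hv => ?_
      exact hg v hv }

lemma levelChart_symm_coe {f : N → ℝ} {c : ℝ} (Θ : OpenPartialHomeomorph N (ℝ × HyperModel E))
    (hΘ : ∀ q ∈ Θ.source, (Θ q).1 = f q) (p : {q : N // f q = c}) {v : HyperModel E}
    (hv : (c, v) ∈ Θ.target) : ((levelChart Θ hΘ p).symm v).1 = Θ.symm (c, v) := by
  exact levelChartInv_coe Θ hΘ p hv

lemma levelChart_compat {f : N → ℝ} {c : ℝ} (Θ Θ' : OpenPartialHomeomorph N (ℝ × HyperModel E))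
    (h1 : ∀ q ∈ Θ.source, (Θ q).1 = f q) (h1' : ∀ q ∈ Θ'.source, (Θ' q).1 = f q)
    (h2 : ContMDiffOn 𝓘(ℝ, ℝ × HyperModel E) I ∞ Θ.symm Θ.target)
    (h2' : ContMDiffOn I 𝓘(ℝ, ℝ × HyperModel E) ∞ Θ' Θ'.source) (p p' : {q : N // f q = c}) :
    ContDiffOn ℝ ∞ ((levelChart Θ h1 p).symm ≫ₕ levelChart Θ' h1' p')
      ((levelChart Θ h1 p).symm ≫ₕ levelChart Θ' h1' p').source := by
  have hs : ContMDiffOn 𝓘(ℝ, HyperModel E) 𝓘(ℝ, HyperModel E) ∞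
      (fun v => (Θ' (Θ.symm (c, v))).2)
      {v | (c, v) ∈ Θ.target ∧ Θ.symm (c, v) ∈ Θ'.source} := by
    have ha : ContMDiffOn 𝓘(ℝ, HyperModel E) 𝓘(ℝ, ℝ × HyperModel E) ∞
        (fun v : HyperModel E => (c, v))
        {v | (c, v) ∈ Θ.target ∧ Θ.symm (c, v) ∈ Θ'.source} :=
      (ContDiff.contMDiff (by fun_prop)).contMDiffOn
    have hb := (h2'.comp (h2.comp ha fun v hv => hv.1) fun v hv => hv.2)
    exact (contDiff_snd.contMDiff).comp_contMDiffOn hb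
  refine (hs.contDiffOn.mono ?_).congr ?_
  · intro v hv
    rw [OpenPartialHomeomorph.trans_source] at hv
    refine ⟨hv.1, ?_⟩
    have := hv.2
    change ((levelChart Θ h1 p).symm v).1 ∈ Θ'.source at this
    rwa [levelChart_symm_coe Θ h1 p hv.1] at this
  · intro v hv
    rw [OpenPartialHomeomorph.trans_source] at hv
    change (Θ' ((levelChart Θ h1 p).symm v).1).2 = _
    rw [levelChart_symm_coe Θ h1 p hv.1]

/-- The charts of a regular level set as an embedded hypersurface. -/
@[reducible] noncomputable def levelChartedSpace [I.Boundaryless] [IsManifold I ∞ N] {f : N → ℝ}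
    (hf : ContMDiff I 𝓘(ℝ, ℝ) ∞ f) (c : ℝ)
    (hreg : ∀ p, f p = c → mfderiv I 𝓘(ℝ, ℝ) f p ≠ 0) :
    ChartedSpace (HyperModel E) {q : N // f q = c} where
  atlas := Set.range fun p : {q : N // f q = c} =>
    levelChart (exists_sliceChart hf p.1 (hreg p.1 p.2)).choose
      (exists_sliceChart hf p.1 (hreg p.1 p.2)).choose_spec.2.1 p
  chartAt := fun p =>
    levelChart (exists_sliceChart hf p.1 (hreg p.1 p.2)).choose
      (exists_sliceChart hf p.1 (hreg p.1 p.2)).choose_spec.2.1 p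
  mem_chart_source := fun p => (exists_sliceChart hf p.1 (hreg p.1 p.2)).choose_spec.1
  chart_mem_atlas := fun p => ⟨p, rfl⟩

lemma levelIsManifold [I.Boundaryless] [IsManifold I ∞ N] {f : N → ℝ}
    (hf : ContMDiff I 𝓘(ℝ, ℝ) ∞ f) (c : ℝ)
    (hreg : ∀ p, f p = c → mfderiv I 𝓘(ℝ, ℝ) f p ≠ 0) :
    letI := levelChartedSpace hf c hreg
    IsManifold 𝓘(ℝ, HyperModel E) ∞ {q : N // f q = c} := by
  let _ := levelChartedSpace hf c hreg
  refine isManifold_of_contDiffOn _ _ _ ?_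
  rintro _ _ ⟨p, rfl⟩ ⟨p', rfl⟩
  obtain ⟨-, h1, -, h2⟩ := (exists_sliceChart hf p.1 (hreg p.1 p.2)).choose_spec
  obtain ⟨-, h1', h2', -⟩ := (exists_sliceChart hf p'.1 (hreg p'.1 p'.2)).choose_spec
  simp only [modelWithCornersSelf_coe, modelWithCornersSelf_coe_symm, Set.preimage_id,
    Function.id_comp, Function.comp_id, Set.range_id, Set.inter_univ]
  exact levelChart_compat _ _ h1 h1' h2 h2' p p'

/-- The inclusion of a regular level set is smooth. -/
lemma level_contMDiff_val [I.Boundaryless] [IsManifold I ∞ N] {f : N → ℝ}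
    (hf : ContMDiff I 𝓘(ℝ, ℝ) ∞ f) (c : ℝ)
    (hreg : ∀ p, f p = c → mfderiv I 𝓘(ℝ, ℝ) f p ≠ 0) :
    letI := levelChartedSpace hf c hreg
    ContMDiff 𝓘(ℝ, HyperModel E) I ∞ (Subtype.val : {q : N // f q = c} → N) := by
  let _ := levelChartedSpace hf c hreg
  have _ := levelIsManifold hf c hreg
  intro p
  obtain ⟨hp, h1, -, h2⟩ := (exists_sliceChart hf p.1 (hreg p.1 p.2)).choose_spec
  have hc : chartAt (HyperModel E) p
    = levelChart (exists_sliceChart hf p.1 (hreg p.1 p.2)).choose h1 p := rfl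
  generalize (exists_sliceChart hf p.1 (hreg p.1 p.2)).choose = Θ at *
  have h3 : ContMDiffOn 𝓘(ℝ, HyperModel E) I ∞ (fun v => Θ.symm (c, v)) {v | (c, v) ∈ Θ.target} :=
    h2.comp (ContDiff.contMDiff (by fun_prop)).contMDiffOn fun v hv => hv
  have h4 : ContMDiffOn 𝓘(ℝ, HyperModel E) 𝓘(ℝ, HyperModel E) ∞
    (chartAt (HyperModel E) p) (chartAt (HyperModel E) p).source := contMDiffOn_chart
  have h5 := h3.comp h4 fun q hq => by
    have := (chartAt (HyperModel E) p).map_source hq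
    rw [hc] at this ⊢; exact this
  refine ((h5.congr ?_).contMDiffAt ((chartAt (HyperModel E) p).open_source.mem_nhds
    (mem_chart_source _ p)))
  intro q hq
  simp only [Function.comp]
  rw [hc] at hq ⊢
  have ht := (levelChart Θ h1 p).map_source hq
  rw [← levelChart_symm_coe Θ h1 p ht, (levelChart Θ h1 p).left_inv hq]

/-- A map into a regular level set is smooth as soon as it is smooth into the ambient manifold. -/
lemma level_contMDiff_of_val [I.Boundaryless] [IsManifold I ∞ N] {f : N → ℝ}
    (hf : ContMDiff I 𝓘(ℝ, ℝ) ∞ f) (c : ℝ)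
    (hreg : ∀ p, f p = c → mfderiv I 𝓘(ℝ, ℝ) f p ≠ 0)
    {E' : Type*} [NormedAddCommGroup E'] [NormedSpace ℝ E'] {H' : Type*} [TopologicalSpace H']
    {I' : ModelWithCorners ℝ E' H'} {M : Type*} [TopologicalSpace M] [ChartedSpace H' M]
    {g : M → {q : N // f q = c}} {x : M} (hg : ContMDiffAt I' I ∞ (fun x => (g x).1) x) :
    letI := levelChartedSpace hf c hreg
    ContMDiffAt I' 𝓘(ℝ, HyperModel E) ∞ g x := by
  let _ := levelChartedSpace hf c hreg
  have _ := levelIsManifold hf c hreg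
  have hgc : ContinuousAt g x := Topology.IsInducing.subtypeVal.continuousAt_iff.2 hg.continuousAt
  rw [contMDiffAt_iff_target]
  refine ⟨hgc, ?_⟩
  obtain ⟨hp, h1, h2, -⟩ := (exists_sliceChart hf (g x).1 (hreg (g x).1 (g x).2)).choose_spec
  have hc : chartAt (HyperModel E) (g x)
    = levelChart (exists_sliceChart hf (g x).1 (hreg (g x).1 (g x).2)).choose h1 (g x) := rfl
  have h3 := (h2.contMDiffAt (OpenPartialHomeomorph.open_source _ |>.mem_nhds hp)).comp x hg
  have h4 := (contDiff_snd (𝕜 := ℝ) (E := ℝ) (F := HyperModel E) (n := ∞)).contMDiff.contMDiffAt.comp x h3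
  exact h4

end LevelSet

/-! ### First jets of sections -/

section Jets

variable {E : Type*} [NormedAddCommGroup E] [NormedSpace ℝ E]
  {H : Type*} [TopologicalSpace H]

/-- A smooth submersion `N → ℝ`, the time coordinate of a configuration bundle. -/
structure TimeFibration (I : ModelWithCorners ℝ E H) (N : Type*) [TopologicalSpace N]
    [ChartedSpace H N] where
  toFun : N → ℝ
  smooth : ContMDiff I 𝓘(ℝ, ℝ) ∞ toFun
  submersive : ∀ q, Function.Surjective (mfderiv I 𝓘(ℝ, ℝ) toFun q)

namespace TimeFibration

variable {I : ModelWithCorners ℝ E H} {N : Type*} [TopologicalSpace N] [ChartedSpace H N]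

/-- The differential of the time function at `q`. -/
noncomputable def dAt (ρ : TimeFibration I N) (q : N) : E →L[ℝ] ℝ :=
  mfderiv I 𝓘(ℝ, ℝ) ρ.toFun q

/-- The function `ṫ` on the tangent bundle. -/
noncomputable def tdot (ρ : TimeFibration I N) (v : TangentBundle I N) : ℝ := ρ.dAt v.1 v.2

/-- The vertical tangent space `ker dρ` at `q`. -/
noncomputable def vert (ρ : TimeFibration I N) (q : N) : Submodule ℝ E :=
  LinearMap.ker (ρ.dAt q).toLinearMap

lemma contMDiff_tdot [IsManifold I ∞ N] (ρ : TimeFibration I N) :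
    ContMDiff I.tangent 𝓘(ℝ, ℝ) ∞ ρ.tdot := by
  have h1 : ContMDiff I.tangent 𝓘(ℝ, ℝ).tangent ∞ (tangentMap I 𝓘(ℝ, ℝ) ρ.toFun) :=
    ρ.smooth.contMDiff_tangentMap (by simp)
  exact (contMDiff_snd_tangentBundle_modelSpace ℝ 𝓘(ℝ, ℝ)).comp h1

lemma mfderiv_tdot_ne_zero [IsManifold I ∞ N] (ρ : TimeFibration I N) (v : TangentBundle I N)
    (hv : ρ.tdot v = 1) : mfderiv I.tangent 𝓘(ℝ, ℝ) ρ.tdot v ≠ 0 := by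
  intro h0
  let γ : ℝ → TangentBundle I N := fun s => ⟨v.1, s • v.2⟩
  have hγ : ContMDiffAt 𝓘(ℝ, ℝ) I.tangent ∞ γ 1 := by
    rw [contMDiffAt_totalSpace]
    refine ⟨contMDiffAt_const, ?_⟩
    have hb : v.1 ∈ (trivializationAt E (TangentSpace I) v.1).baseSet :=
      FiberBundle.mem_baseSet_trivializationAt' v.1
    have : (fun s : ℝ => (trivializationAt E (TangentSpace I) (γ 1).proj (γ s)).2)
        = fun s => s • (trivializationAt E (TangentSpace I) v.1 v).2 := by
      funext s
      exact ((trivializationAt E (TangentSpace I) v.1).linear ℝ hb).map_smul s v.2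
    rw [this]
    exact (ContDiff.contMDiff (by fun_prop)).contMDiffAt
  have hγ1 : γ 1 = v := by simp [γ]
  have hc : ρ.tdot ∘ γ = fun s => s := by
    funext s
    have : ρ.tdot (γ s) = s * ρ.tdot v := (ρ.dAt v.1).map_smul s v.2
    simp [this, hv]
  have h2 : HasMFDerivAt 𝓘(ℝ, ℝ) 𝓘(ℝ, ℝ) (ρ.tdot ∘ γ) 1
      ((mfderiv I.tangent 𝓘(ℝ, ℝ) ρ.tdot (γ 1)).comp (mfderiv 𝓘(ℝ, ℝ) I.tangent γ 1)) :=
    ((ρ.contMDiff_tdot.mdifferentiableAt (by simp)).hasMFDerivAt).comp 1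
      (hγ.mdifferentiableAt (by simp)).hasMFDerivAt
  have h3 : HasMFDerivAt 𝓘(ℝ, ℝ) 𝓘(ℝ, ℝ) (ρ.tdot ∘ γ) 1
      (ContinuousLinearMap.id ℝ ℝ) := by
    rw [hc]; exact hasMFDerivAt_id (1 : ℝ)
  have h4 := hasMFDerivAt_unique h2 h3
  rw [hγ1, h0] at h4
  have h5 := congrArg (fun l : ℝ →L[ℝ] ℝ => l 1) h4
  exact (zero_ne_one (α := ℝ)) h5

variable [FiniteDimensional ℝ E] [I.Boundaryless] [IsManifold I ∞ N]

/-- The first jet bundle of `ρ : N → ℝ`: the jet of a (local) section `γ` at `t` is identified with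
its velocity `γ_* (∂/∂t)`, so that jets are the tangent vectors `v` of `N` with `dρ v = 1`. -/
def Jet (ρ : TimeFibration I N) : Type _ := {v : TangentBundle I N // ρ.tdot v = 1}

end TimeFibration

/-- The model space of the first jet bundle of a fibration whose total space is modelled on `E`. -/
abbrev JetModel (E : Type*) [NormedAddCommGroup E] [NormedSpace ℝ E] : Type := HyperModel (E × E)

namespace TimeFibration

variable {I : ModelWithCorners ℝ E H} {N : Type*} [TopologicalSpace N] [ChartedSpace H N]
  [FiniteDimensional ℝ E] [I.Boundaryless] [IsManifold I ∞ N]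

noncomputable instance (ρ : TimeFibration I N) : TopologicalSpace ρ.Jet := instTopologicalSpaceSubtype

/-- The jet bundle as an embedded hypersurface of the tangent bundle. -/
noncomputable instance (ρ : TimeFibration I N) : ChartedSpace (JetModel E) ρ.Jet :=
  levelChartedSpace ρ.contMDiff_tdot 1 ρ.mfderiv_tdot_ne_zero

instance (ρ : TimeFibration I N) : IsManifold 𝓘(ℝ, JetModel E) ∞ ρ.Jet :=
  levelIsManifold ρ.contMDiff_tdot 1 ρ.mfderiv_tdot_ne_zero

namespace Jet

variable {ρ : TimeFibration I N}

/-- The tangent space of the jet bundle at `v`. -/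
abbrev Tan (v : ρ.Jet) : Type := TangentSpace 𝓘(ℝ, JetModel E) v

/-- The canonical embedding of jets into tangent vectors. -/
def toTangent (v : ρ.Jet) : TangentBundle I N := v.1

/-- The projection of the jet bundle onto the configuration bundle. -/
def base (v : ρ.Jet) : N := v.toTangent.1

/-- The velocity of a jet. -/
def vec (v : ρ.Jet) : E := v.toTangent.2

lemma dAt_vec (v : ρ.Jet) : ρ.dAt v.base v.vec = 1 := v.2

lemma contMDiff_toTangent :
    ContMDiff 𝓘(ℝ, JetModel E) I.tangent ∞ (toTangent : ρ.Jet → TangentBundle I N) :=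
  level_contMDiff_val ρ.contMDiff_tdot 1 ρ.mfderiv_tdot_ne_zero

lemma contMDiff_base : ContMDiff 𝓘(ℝ, JetModel E) I ∞ (base : ρ.Jet → N) :=
  (contMDiff_proj (TangentSpace I)).comp contMDiff_toTangent

/-- A map into the jet bundle is smooth as soon as it is smooth into the tangent bundle. -/
lemma contMDiffAt_of_toTangent {E' : Type*} [NormedAddCommGroup E'] [NormedSpace ℝ E']
    {H' : Type*} [TopologicalSpace H'] {I' : ModelWithCorners ℝ E' H'} {M : Type*}
    [TopologicalSpace M] [ChartedSpace H' M] {g : M → ρ.Jet} {x : M}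
    (hg : ContMDiffAt I' I.tangent ∞ (fun x => (g x).toTangent) x) :
    ContMDiffAt I' 𝓘(ℝ, JetModel E) ∞ g x :=
  level_contMDiff_of_val ρ.contMDiff_tdot 1 ρ.mfderiv_tdot_ne_zero hg

/-- The differential of the projection onto the configuration bundle. -/
noncomputable def dBase (v : ρ.Jet) : v.Tan →L[ℝ] E := mfderiv 𝓘(ℝ, JetModel E) I base v

/-- The 1-form `dt` on the jet bundle. -/
noncomputable def dt (v : ρ.Jet) : v.Tan →L[ℝ] ℝ :=
  mfderiv 𝓘(ℝ, JetModel E) 𝓘(ℝ, ℝ) (fun w : ρ.Jet => ρ.toFun w.base) v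

lemma dt_apply (v : ρ.Jet) (w : v.Tan) : dt v w = ρ.dAt v.base (dBase v w) :=
  mfderiv_comp_apply v (ρ.smooth.mdifferentiableAt (by simp))
    (contMDiff_base.mdifferentiableAt (by simp)) w

/-- The affine action of vertical tangent vectors on jets. -/
noncomputable def translate (v : ρ.Jet) (u : ρ.vert v.base) : ρ.Jet :=
  ⟨⟨v.base, (v.vec + u.1 : E)⟩, by
    have hu : ρ.dAt v.base u.1 = 0 := u.2
    change ρ.dAt v.base (v.vec + u.1) = 1
    rw [map_add, dAt_vec, hu, add_zero]⟩

/-- The vertical lift at the jet `v`: the derivative of `u ↦ v + u` at `u = 0`. -/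
noncomputable def verticalLift (v : ρ.Jet) : ρ.vert v.base →L[ℝ] v.Tan :=
  mfderiv 𝓘(ℝ, ρ.vert v.base) 𝓘(ℝ, JetModel E) (translate v) 0

/-- The contact form `w ↦ (dq - q̇ dt)(w)`, with values in vertical vectors of the configuration
bundle. -/
noncomputable def contact (v : ρ.Jet) : v.Tan →L[ℝ] ρ.vert v.base :=
  (dBase v - (dt v).smulRight v.vec).codRestrict (ρ.vert v.base) fun w => by
    change ρ.dAt v.base (dBase v w - dt v w • v.vec) = 0
    rw [map_sub, map_smul, dAt_vec, ← dt_apply, smul_eq_mul, mul_one, sub_self]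

/-- The vertical endomorphism `S = (dq - q̇ dt) ⊗ ∂/∂q̇`. -/
noncomputable def vertEndo (v : ρ.Jet) : v.Tan →L[ℝ] v.Tan := verticalLift v ∘L contact v

end Jet

end TimeFibration

end Jets

/-! ### Differential forms and cosymplectic structures -/

section Forms

variable {E : Type*} [NormedAddCommGroup E] [NormedSpace ℝ E]
  {H : Type*} [TopologicalSpace H]

/-- Differential `k`-forms (not necessarily smooth) on a manifold. -/
abbrev DForm (I : ModelWithCorners ℝ E H) (M : Type*) [TopologicalSpace M] [ChartedSpace H M]
    (k : ℕ) : Type _ :=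
  ∀ p : M, TangentSpace I p [⋀^Fin k]→L[ℝ] ℝ

variable {I : ModelWithCorners ℝ E H} {M : Type*} [TopologicalSpace M] [ChartedSpace H M] {k : ℕ}

namespace DForm

/-- The coordinate expression of a form in the preferred chart at `p` (its pull-back under the
inverse of that chart). -/
noncomputable def inChart (Ω : DForm I M k) (p : M) (y : E) : E [⋀^Fin k]→L[ℝ] ℝ :=
  (Ω ((extChartAt I p).symm y)).compContinuousLinearMap
    (mfderiv 𝓘(ℝ, E) I (extChartAt I p).symm y)

/-- Smoothness of a form near `p`. -/
def SmoothAt (Ω : DForm I M k) (p : M) : Prop :=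
  ContDiffAt ℝ ∞ (Ω.inChart p) (extChartAt I p p)

/-- The exterior derivative of a form on a boundaryless manifold, computed in charts. -/
noncomputable def d (Ω : DForm I M k) : DForm I M (k + 1) := fun p =>
  (extDeriv (Ω.inChart p) (extChartAt I p p)).compContinuousLinearMap
    (mfderiv I 𝓘(ℝ, E) (extChartAt I p) p)

/-- A field of covectors as a 1-form. -/
noncomputable def ofCovector (θ : ∀ p : M, TangentSpace I p →L[ℝ] ℝ) : DForm I M 1 := fun p =>
  ContinuousAlternatingMap.ofSubsingleton ℝ (TangentSpace I p) ℝ (0 : Fin 1) (θ p)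

end DForm

/-- `(Ω, τ)` is a cosymplectic structure on the open set `U`: the manifold is odd-dimensional, both
forms are smooth and closed, and `v ↦ Ω(v, ·) + τ(v) τ` is an isomorphism from tangent to cotangent
spaces (on a manifold of dimension `2n + 1` this says that `τ ∧ Ωⁿ` vanishes nowhere). -/
structure IsCosymplecticOn (U : Set M) (Ω : DForm I M 2) (τ : DForm I M 1) : Prop where
  odd_dim : ∀ p ∈ U, Odd (Module.finrank ℝ (TangentSpace I p))
  smooth_two : ∀ p ∈ U, Ω.SmoothAt p
  smooth_one : ∀ p ∈ U, τ.SmoothAt p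
  closed_two : ∀ p ∈ U, Ω.d p = 0
  closed_one : ∀ p ∈ U, τ.d p = 0
  nondegenerate : ∀ p ∈ U, ∀ v : TangentSpace I p,
    (∀ w : TangentSpace I p, Ω p ![v, w] + τ p ![v] * τ p ![w] = 0) → v = 0

/-- `i : M → N` is a closed coisotropic embedding of `(M, ΩM, τM)` into the open subset `U` of `N`
with its cosymplectic structure `(ΩN, τN)`: a closed smooth embedding that pulls `(ΩN, τN)` back to
`(ΩM, τM)`, and such that `(TM)^⊥ ⊆ TM`, where the orthogonal of a subspace `W` of a cosymplectic
vector space `(Ω, τ)` is `W^⊥ = {v ∈ ker τ | Ω(v, w) = 0 for all w ∈ W ∩ ker τ}`. -/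
structure IsCoisotropicEmbedding {E' : Type*} [NormedAddCommGroup E'] [NormedSpace ℝ E']
    {H' : Type*} [TopologicalSpace H'] {I' : ModelWithCorners ℝ E' H'} {N : Type*}
    [TopologicalSpace N] [ChartedSpace H' N] (i : M → N) (U : Set N)
    (ΩM : DForm I M 2) (τM : DForm I M 1) (ΩN : DForm I' N 2) (τN : DForm I' N 1) : Prop where
  smooth : ContMDiff I I' ∞ i
  immersive : ∀ p, Function.Injective (mfderiv I I' i p)
  closedEmbedding : Topology.IsClosedEmbedding i
  range_subset : Set.range i ⊆ U
  pullback_two : ∀ p, (ΩN (i p)).compContinuousLinearMap (mfderiv I I' i p) = ΩM p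
  pullback_one : ∀ p, (τN (i p)).compContinuousLinearMap (mfderiv I I' i p) = τM p
  coisotropic : ∀ p, ∀ v : TangentSpace I' (i p), τN (i p) ![v] = 0 →
    (∀ w : TangentSpace I p, τN (i p) ![mfderiv I I' i p w] = 0 →
      ΩN (i p) ![v, mfderiv I I' i p w] = 0) →
    v ∈ LinearMap.range (mfderiv I I' i p).toLinearMap

end Forms

/-! ### Non-autonomous Lagrangians -/

section Lagrangians

variable {E : Type*} [NormedAddCommGroup E] [NormedSpace ℝ E] [FiniteDimensional ℝ E]
  {H : Type*} [TopologicalSpace H] {I : ModelWithCorners ℝ E H} [I.Boundaryless]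
  {N : Type*} [TopologicalSpace N] [ChartedSpace H N] [IsManifold I ∞ N]
  {ρ : TimeFibration I N}

/-- The 1-form `dt` on the jet bundle. -/
noncomputable def timeForm (ρ : TimeFibration I N) : DForm 𝓘(ℝ, JetModel E) ρ.Jet 1 :=
  DForm.ofCovector fun v => v.dt

/-- The differential of a function on the jet bundle. -/
noncomputable def differential (L : ρ.Jet → ℝ) (v : ρ.Jet) : v.Tan →L[ℝ] ℝ :=
  mfderiv 𝓘(ℝ, JetModel E) 𝓘(ℝ, ℝ) L v

/-- The Poincaré–Cartan form `θ_L = L dt + i_S dL`. -/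
noncomputable def cartanForm (L : ρ.Jet → ℝ) : DForm 𝓘(ℝ, JetModel E) ρ.Jet 1 :=
  DForm.ofCovector fun v =>
    L v • v.dt + (differential L v).comp v.vertEndo

/-- The Lagrangian 2-form `ω_L = - dθ_L`. -/
noncomputable def lagrangianForm (L : ρ.Jet → ℝ) : DForm 𝓘(ℝ, JetModel E) ρ.Jet 2 :=
  -DForm.d (cartanForm L)

/-- A Lagrangian is regular if `(ω_L, dt)` is a cosymplectic structure, and singular otherwise. -/
def IsRegularLagrangian (L : ρ.Jet → ℝ) : Prop :=
  IsCosymplecticOn Set.univ (lagrangianForm L) (timeForm ρ)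

/-- A Lagrangian is consistent if there is a global second-order Reeb field: a smooth vector field
`X` with `i_X ω_L = 0`, `dt(X) = 1` and `S(X) = 0`. -/
def IsConsistentLagrangian (L : ρ.Jet → ℝ) : Prop :=
  ∃ X : ∀ v : ρ.Jet, v.Tan,
    ContMDiff 𝓘(ℝ, JetModel E) (𝓘(ℝ, JetModel E)).tangent ∞
      (fun v => (⟨v, X v⟩ : TangentBundle 𝓘(ℝ, JetModel E) ρ.Jet)) ∧
    ∀ v : ρ.Jet, (∀ w : v.Tan, lagrangianForm L v ![X v, w] = 0) ∧ v.dt (X v) = 1 ∧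
      v.vertEndo (X v) = 0

/-- `w` lies in the characteristic distribution `ker ω_L ∩ ker dt`. -/
def IsCharacteristic (L : ρ.Jet → ℝ) (v : ρ.Jet) (w : v.Tan) : Prop :=
  (∀ u : v.Tan, lagrangianForm L v ![w, u] = 0) ∧ v.dt w = 0

/-- `w` is the value at the jet `v` of the complete lift `X^C` of the vertical vector field `X`,
characterised by `X^C(f) = X(f)` and `X^C(ḟ) = (X f)˙` for all functions `f` on the configuration
bundle, where `ḟ(v) = df(v)`. -/
def IsCompleteLift (X : ∀ q : N, TangentSpace I q) (v : ρ.Jet) (w : v.Tan) : Prop :=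
  ∀ f : N → ℝ, ContMDiffAt I 𝓘(ℝ, ℝ) ∞ f v.base →
    (mfderiv 𝓘(ℝ, JetModel E) 𝓘(ℝ, ℝ) (fun u : ρ.Jet => f u.base) v w : ℝ)
        = mfderiv I 𝓘(ℝ, ℝ) f v.base (X v.base) ∧
    (mfderiv 𝓘(ℝ, JetModel E) 𝓘(ℝ, ℝ)
        (fun u : ρ.Jet => (mfderiv I 𝓘(ℝ, ℝ) f u.base u.vec : ℝ)) v w : ℝ)
        = mfderiv I 𝓘(ℝ, ℝ) (fun q => (mfderiv I 𝓘(ℝ, ℝ) f q (X q) : ℝ)) v.base v.vec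

end Lagrangians

/-! ### Vertical distributions, their duals, and the extended Lagrangian -/

section Extension

variable {E : Type*} [NormedAddCommGroup E] [NormedSpace ℝ E]
  {H : Type*} [TopologicalSpace H] {I : ModelWithCorners ℝ E H}
  {Q : Type*} [TopologicalSpace Q] [ChartedSpace H Q]
  {F : Type*} [NormedAddCommGroup F] [NormedSpace ℝ F]
  {𝒦 : Q → Type*} [∀ q, TopologicalSpace (𝒦 q)] [∀ q, AddCommGroup (𝒦 q)] [∀ q, Module ℝ (𝒦 q)]
  [TopologicalSpace (TotalSpace F 𝒦)] [FiberBundle F 𝒦]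

/-- The section `X` of the vector bundle `𝒦` is smooth near `q`. -/
def SmoothSectionAt (I : ModelWithCorners ℝ E H) (F : Type*) [NormedAddCommGroup F]
    [NormedSpace ℝ F] {𝒦 : Q → Type*} [∀ q, TopologicalSpace (𝒦 q)]
    [TopologicalSpace (TotalSpace F 𝒦)] [FiberBundle F 𝒦] (X : ∀ q, 𝒦 q) (q : Q) : Prop :=
  ContMDiffAt I (I.prod 𝓘(ℝ, F)) ∞ (fun q' => TotalSpace.mk' F q' (X q')) q

/-- A regular integrable distribution on `Q` which is vertical for `ρ`, given as a vector bundle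
`𝒦` (with typical fibre `F`) together with its inclusion as a subbundle of the tangent bundle. -/
structure VerticalDistribution [IsManifold I ∞ Q] (ρ : TimeFibration I Q) (F : Type*) [NormedAddCommGroup F]
    [NormedSpace ℝ F] (𝒦 : Q → Type*) [∀ q, TopologicalSpace (𝒦 q)] [∀ q, AddCommGroup (𝒦 q)]
    [∀ q, Module ℝ (𝒦 q)] [TopologicalSpace (TotalSpace F 𝒦)] [FiberBundle F 𝒦] where
  incl : ∀ q, 𝒦 q →L[ℝ] TangentSpace I q
  smooth : ContMDiff (I.prod 𝓘(ℝ, F)) I.tangent ∞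
    (fun x : TotalSpace F 𝒦 => (⟨x.1, incl x.1 x.2⟩ : TangentBundle I Q))
  injective : ∀ q, Function.Injective (incl q)
  vertical : ∀ q k, ρ.dAt q (incl q k) = 0
  involutive : ∀ X Y : ∀ q, 𝒦 q, ∀ q, SmoothSectionAt I F X q → SmoothSectionAt I F Y q →
    VectorField.mlieBracket I (fun q' => incl q' (X q')) (fun q' => incl q' (Y q')) q ∈
      LinearMap.range (incl q).toLinearMap

/-- The total space of the dual bundle `𝒦*`. -/
abbrev DualTotal (F : Type*) [NormedAddCommGroup F] [NormedSpace ℝ F] (𝒦 : Q → Type*)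
    [∀ q, TopologicalSpace (𝒦 q)] [∀ q, AddCommGroup (𝒦 q)] [∀ q, Module ℝ (𝒦 q)] : Type _ :=
  TotalSpace (F →L[ℝ] ℝ) (fun q => 𝒦 q →L[ℝ] ℝ)

variable [IsManifold I ∞ Q] [VectorBundle ℝ F 𝒦] [ContMDiffVectorBundle ∞ F 𝒦 I]
  [∀ q, IsTopologicalAddGroup (𝒦 q)] [∀ q, ContinuousSMul ℝ (𝒦 q)] {ρ : TimeFibration I Q}

/-- The differential at `x` of the projection `𝒦* → Q`. -/
noncomputable def dualProj (I : ModelWithCorners ℝ E H) (x : DualTotal F 𝒦) :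
    TangentSpace (I.prod 𝓘(ℝ, F →L[ℝ] ℝ)) x →L[ℝ] TangentSpace I x.proj :=
  mfderiv (I.prod 𝓘(ℝ, F →L[ℝ] ℝ)) I TotalSpace.proj x

lemma dualProj_surjective (x : DualTotal F 𝒦) : Function.Surjective (dualProj I x) := by
  let e := trivializationAt (F →L[ℝ] ℝ) (fun q => 𝒦 q →L[ℝ] ℝ) x.proj
  have hx : x.proj ∈ e.baseSet := FiberBundle.mem_baseSet_trivializationAt' x.proj
  let s : Q → DualTotal F 𝒦 := fun q => e.toOpenPartialHomeomorph.symm (q, (e x).2)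
  have hsx : s x.proj = x := e.symm_apply_mk_proj (e.mem_source.2 hx)
  have hs : ContMDiffAt I (I.prod 𝓘(ℝ, F →L[ℝ] ℝ)) ∞ s x.proj := by
    have h1 : ContMDiffOn (I.prod 𝓘(ℝ, F →L[ℝ] ℝ)) (I.prod 𝓘(ℝ, F →L[ℝ] ℝ)) ∞
      e.toOpenPartialHomeomorph.symm e.target := e.contMDiffOn_symm
    have ht : (x.proj, (e x).2) ∈ e.target := by rw [e.mem_target]; exact hx
    exact (h1.contMDiffAt (e.open_target.mem_nhds ht)).comp x.proj
      (contMDiffAt_id.prodMk contMDiffAt_const)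
  have hp : MDifferentiableAt (I.prod 𝓘(ℝ, F →L[ℝ] ℝ)) I
      (TotalSpace.proj : DualTotal F 𝒦 → Q) (s x.proj) :=
    (contMDiff_proj (n := ∞) _).mdifferentiableAt (by simp)
  have hc := mfderiv_comp x.proj hp (hs.mdifferentiableAt (by simp))
  have hid : (TotalSpace.proj ∘ s : Q → Q) =ᶠ[𝓝 x.proj] id := by
    filter_upwards [e.open_baseSet.mem_nhds hx] with q hq
    exact e.proj_symm_apply (by rw [e.mem_target]; exact hq)
  rw [hid.mfderiv_eq, mfderiv_id, hsx] at hc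
  intro u
  exact ⟨mfderiv I (I.prod 𝓘(ℝ, F →L[ℝ] ℝ)) s x.proj u,
    (congrArg (fun l : TangentSpace I x.proj →L[ℝ] TangentSpace I x.proj => l u) hc).symm⟩

/-- The vertical lift of `β ∈ 𝒦*_q` to the tangent space of `𝒦*` at `x ∈ 𝒦*_q`. -/
noncomputable def fibreLift (I : ModelWithCorners ℝ E H) (x : DualTotal F 𝒦)
    (β : 𝒦 x.proj →L[ℝ] ℝ) : TangentSpace (I.prod 𝓘(ℝ, F →L[ℝ] ℝ)) x :=
  mfderiv 𝓘(ℝ, ℝ) (I.prod 𝓘(ℝ, F →L[ℝ] ℝ))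
    (fun s : ℝ => (⟨x.proj, x.2 + s • β⟩ : DualTotal F 𝒦)) 0 (1 : ℝ)

/-- An Ehresmann connection on `𝒦* → Q`, given by the projector of `T𝒦*` onto the vertical bundle
along the horizontal one, which along the zero section is the canonical splitting. -/
structure DualConnection (I : ModelWithCorners ℝ E H) (F : Type*) [NormedAddCommGroup F]
    [NormedSpace ℝ F] (𝒦 : Q → Type*) [∀ q, TopologicalSpace (𝒦 q)] [∀ q, AddCommGroup (𝒦 q)]
    [∀ q, Module ℝ (𝒦 q)] [TopologicalSpace (TotalSpace F 𝒦)] [FiberBundle F 𝒦]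
    [VectorBundle ℝ F 𝒦] [ContMDiffVectorBundle ∞ F 𝒦 I] [IsManifold I ∞ Q]
    [∀ q, IsTopologicalAddGroup (𝒦 q)] [∀ q, ContinuousSMul ℝ (𝒦 q)] where
  vproj : ∀ x : DualTotal F 𝒦, TangentSpace (I.prod 𝓘(ℝ, F →L[ℝ] ℝ)) x →L[ℝ]
    TangentSpace (I.prod 𝓘(ℝ, F →L[ℝ] ℝ)) x
  smooth : ContMDiff (I.prod 𝓘(ℝ, F →L[ℝ] ℝ)).tangent (I.prod 𝓘(ℝ, F →L[ℝ] ℝ)).tangent ∞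
    (fun ξ : TangentBundle (I.prod 𝓘(ℝ, F →L[ℝ] ℝ)) (DualTotal F 𝒦) =>
      (⟨ξ.1, vproj ξ.1 ξ.2⟩ : TangentBundle (I.prod 𝓘(ℝ, F →L[ℝ] ℝ)) (DualTotal F 𝒦)))
  idem : ∀ x w, vproj x (vproj x w) = vproj x w
  range_eq : ∀ x, LinearMap.range (vproj x).toLinearMap = LinearMap.ker (dualProj I x).toLinearMap
  zero_section : ∀ q : Q,
    LinearMap.ker (vproj (zeroSection (F →L[ℝ] ℝ) (fun q => 𝒦 q →L[ℝ] ℝ) q)).toLinearMap =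
      LinearMap.range (mfderiv I (I.prod 𝓘(ℝ, F →L[ℝ] ℝ))
        (zeroSection (F →L[ℝ] ℝ) (fun q => 𝒦 q →L[ℝ] ℝ)) q).toLinearMap

/-- An almost product structure on `Q` that complements the distribution `K`: a smooth projector
with image `K`. -/
structure AlmostProduct (K : VerticalDistribution ρ F 𝒦) where
  proj : ∀ q : Q, TangentSpace I q →L[ℝ] TangentSpace I q
  smooth : ContMDiff I.tangent I.tangent ∞
    (fun v : TangentBundle I Q => (⟨v.1, proj v.1 v.2⟩ : TangentBundle I Q))
  idem : ∀ q v, proj q (proj q v) = proj q v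
  range_eq : ∀ q, LinearMap.range (proj q).toLinearMap = LinearMap.range (K.incl q).toLinearMap

namespace VerticalDistribution

/-- The extended configuration bundle `ρ_K : 𝒦* → Q → ℝ`. -/
noncomputable def ext (_K : VerticalDistribution ρ F 𝒦) :
    TimeFibration (I.prod 𝓘(ℝ, F →L[ℝ] ℝ)) (DualTotal F 𝒦) where
  toFun := fun x => ρ.toFun x.proj
  smooth := ρ.smooth.comp (contMDiff_proj _)
  submersive := fun x => by
    rw [show (fun x : DualTotal F 𝒦 => ρ.toFun x.proj) = ρ.toFun ∘ TotalSpace.proj from rfl,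
      mfderiv_comp x (ρ.smooth.mdifferentiableAt (by simp))
        ((contMDiff_proj (n := ∞) _).mdifferentiableAt (by simp))]
    exact (ρ.submersive x.proj).comp (dualProj_surjective x)

lemma ext_dAt (K : VerticalDistribution ρ F 𝒦) (x : DualTotal F 𝒦)
    (w : TangentSpace (I.prod 𝓘(ℝ, F →L[ℝ] ℝ)) x) :
    K.ext.dAt x w = ρ.dAt x.proj (dualProj I x w) :=
  mfderiv_comp_apply x (ρ.smooth.mdifferentiableAt (by simp))
    ((contMDiff_proj (n := ∞) _).mdifferentiableAt (by simp)) w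

variable [FiniteDimensional ℝ E] [FiniteDimensional ℝ F] [I.Boundaryless]
  (K : VerticalDistribution ρ F 𝒦)

/-- The map `J¹ρ_K → J¹ρ` induced by the projection `𝒦* → Q`. -/
noncomputable def jetProj (ξ : K.ext.Jet) : ρ.Jet :=
  ⟨⟨ξ.base.proj, dualProj I ξ.base ξ.vec⟩, (K.ext_dAt ξ.base ξ.vec).symm.trans ξ.2⟩

/-- Elements of the distribution as vertical tangent vectors. -/
noncomputable def toVert (q : Q) (k : 𝒦 q) : ρ.vert q := ⟨K.incl q k, K.vertical q k⟩

/-- The complete lift `K^C`, spanned by the complete and the vertical lifts of the local sections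
of `K`. -/
noncomputable def completeLift (v : ρ.Jet) : Submodule ℝ v.Tan :=
  Submodule.span ℝ {w | ∃ X : ∀ q, 𝒦 q, SmoothSectionAt I F X v.base ∧
    (IsCompleteLift (fun q => K.incl q (X q)) v w ∨
      w = v.verticalLift (K.toVert v.base (X v.base)))}

/-- The dual bundle `(K^C)*` of the complete lift, over `J¹ρ`. -/
abbrev DualCompleteLift : Type _ := Σ v : ρ.Jet, Module.Dual ℝ (K.completeLift v)

/-- The zero section of `(K^C)*`. -/
noncomputable def zeroDual (v : ρ.Jet) : K.DualCompleteLift := ⟨v, 0⟩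

/-- `α : J¹ρ_K ≅ (K^C)*` is the Tulczyjew isomorphism: it covers the identity of `J¹ρ`, and for every
local section `X` of `K` and every jet `ξ = j¹μ`, `⟨α(ξ), X^C⟩ = d/dt ⟨μ, X⟩` and
`⟨α(ξ), X^V⟩ = ⟨μ, X⟩`. -/
def IsTulczyjew (α : K.ext.Jet ≃ K.DualCompleteLift) : Prop :=
  ∀ ξ : K.ext.Jet, (α ξ).1 = K.jetProj ξ ∧
    ∀ X : ∀ q, 𝒦 q, SmoothSectionAt I F X (α ξ).1.base →
      ∀ w : K.completeLift (α ξ).1,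
        (IsCompleteLift (fun q => K.incl q (X q)) (α ξ).1 w.1 →
          (α ξ).2 w = (mfderiv (I.prod 𝓘(ℝ, F →L[ℝ] ℝ)) 𝓘(ℝ, ℝ)
            (fun μ : DualTotal F 𝒦 => (μ.2 (X μ.proj) : ℝ)) ξ.base ξ.vec : ℝ)) ∧
        (w.1 = (α ξ).1.verticalLift (K.toVert _ (X (α ξ).1.base)) →
          (α ξ).2 w = ξ.base.2 (X ξ.base.proj))

variable {K}

/-- The function `F^{P,∇}(ξ) = ⟨P(v), p_V(ξ)⟩` on `J¹ρ_K`, where `v ∈ J¹ρ` is the projection of `ξ`,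
and the vertical part of `ξ` is identified with an element of the fibre of `𝒦*`. -/
noncomputable def correction (P : AlmostProduct K) (C : DualConnection I F 𝒦) (ξ : K.ext.Jet) : ℝ :=
  (Function.invFun (fibreLift I ξ.base) (C.vproj ξ.base ξ.vec))
    (Function.invFun (K.incl ξ.base.proj) (P.proj ξ.base.proj (K.jetProj ξ).vec))

/-- The extended Lagrangian `L̃ = L + F^{P,∇}`. -/
noncomputable def extendedLagrangian (L : ρ.Jet → ℝ) (P : AlmostProduct K)
    (C : DualConnection I F 𝒦) (ξ : K.ext.Jet) : ℝ :=
  L (K.jetProj ξ) + correction P C ξ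

end VerticalDistribution

end Extension

/-! ### Pull-back and exterior derivative of differential forms in charts. -/

section FormCalculus

variable {E : Type*} [NormedAddCommGroup E] [NormedSpace ℝ E]
  {H : Type*} [TopologicalSpace H] {I : ModelWithCorners ℝ E H} [I.Boundaryless]
  {M : Type*} [TopologicalSpace M] [ChartedSpace H M] [IsManifold I ∞ M]
  {E' : Type*} [NormedAddCommGroup E'] [NormedSpace ℝ E']
  {H' : Type*} [TopologicalSpace H'] {I' : ModelWithCorners ℝ E' H'} [I'.Boundaryless]
  {M' : Type*} [TopologicalSpace M'] [ChartedSpace H' M'] [IsManifold I' ∞ M']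
  {E'' : Type*} [NormedAddCommGroup E''] [NormedSpace ℝ E'']
  {H'' : Type*} [TopologicalSpace H''] {I'' : ModelWithCorners ℝ E'' H''}
  {M'' : Type*} [TopologicalSpace M''] [ChartedSpace H'' M''] {k : ℕ}

/-! The whole argument takes place along the zero section of 𝒦*. Composing the zero section with α⁻¹
gives the first jet prolongation `zeroJet` of the zero section of 𝒦* (`tulczyjew_zeroJet`). The
Poincaré–Cartan form is natural under prolongations of maps over the time axis, and F^{P,∇} vanishes
on the image, so ω_L̃ pulls back to ω_L (`pullback_zeroJet`).

The directions transverse to the image are controlled by a Hessian. For any Lagrangian, ω paired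
with the vertical lift of z and a vector projecting to a vertical z' is minus the fibre Hessian at
(z, z') (`lagrangianForm_verticalLift`). Over a zero covector the vertical projector of the
connection is the canonical one, so on that entire affine fibre of the jet bundle F^{P,∇} is the
quadratic function (u, η) ↦ η(P(v + u)). Hence the Hessian of L̃ at the image of v is Hess L(u, u')
+ η(Pu') + η'(Pu) (`fibreHessian_extendedLagrangian`). The last two terms put K in duality with the
new directions K*, and Hess L vanishes on K because vertical lifts of K are characteristic.

Coisotropy (`mem_range_dZeroJet`): let y, with dt(y) = 0, be orthogonal to the image. Pairing y with
vertical lifts of K kills the K*-component of its base projection, so y is tangent to the image up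
to the vertical lift of some μ in K*. Pairing with complete lifts of K, which ω_L does not see,
gives μ(c) = 0 for every c, so μ = 0.

Nondegeneracy (`nondegenerateAt_zeroJet`): a vector in the kernel is orthogonal to the image, hence
tangent to it, hence the image of a characteristic vector, which lies in K^C. Its two K-components
are detected by the vertical lift and by the base directions of K*, so both vanish. Nondegeneracy is
an open condition, expressed by a determinant, and U is the locus where it holds. Closedness is d² =
0.

The isomorphism α is explicit. In a frame, K^C has coordinates (c, b), a jet of a section of 𝒦* has
a velocity and a value (ṁ, m), and the pairing is ṁ(c) + m(b). The Leibniz rule for ⟨μ, X⟩ is the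
defining identity (`isTulczyjew_tulczyjew`). -/

lemma two_le_infty : (2 : WithTop ℕ∞) ≤ ∞ := ENat.LEInfty.out

lemma contMDiffAt_extChartAt_symm_of_mem {p : M} {y : E} (hy : y ∈ (extChartAt I p).target) :
    ContMDiffAt 𝓘(ℝ, E) I ∞ (extChartAt I p).symm y :=
  (contMDiffOn_extChartAt_symm p).contMDiffAt
    ((isOpen_extChartAt_target p).mem_nhds hy)

lemma contMDiffAt_extChartAt_of_mem {p q : M} (hq : q ∈ (extChartAt I p).source) :
    ContMDiffAt I 𝓘(ℝ, E) ∞ (extChartAt I p) q :=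
  contMDiffAt_extChartAt' (by rwa [extChartAt_source] at hq)

lemma ContMDiffAt.eventually_mdifferentiableAt {g : M → M'} {p : M}
    (hg : ContMDiffAt I I' ∞ g p) : ∀ᶠ q in 𝓝 p, MDifferentiableAt I I' g q := by
  have h1 : ContMDiffAt I I' 1 g p := hg.of_le (by simp)
  filter_upwards [(contMDiffAt_iff_contMDiffAt_nhds (by simp)).1 h1] with q hq
  exact hq.mdifferentiableAt (by simp)

lemma tendsto_extChartAt_symm (p : M) :
    Filter.Tendsto (extChartAt I p).symm (𝓝 (extChartAt I p p)) (𝓝 p) := by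
  have := (contMDiffAt_extChartAt_symm_of_mem (I := I) (mem_extChartAt_target p)).continuousAt
  rwa [ContinuousAt, extChartAt_to_inv] at this

namespace DForm

/-- The pull-back of a differential form. -/
noncomputable def pullback (I : ModelWithCorners ℝ E H) {M : Type*} [TopologicalSpace M]
    [ChartedSpace H M] (g : M → M') (Ω : DForm I' M' k) : DForm I M k := fun p =>
  (Ω (g p)).compContinuousLinearMap (mfderiv I I' g p)

lemma pullback_comp_apply {g : M → M'} {h : M'' → M} {x : M''} (Ω : DForm I' M' k)
    (hg : MDifferentiableAt I I' g (h x)) (hh : MDifferentiableAt I'' I h x) :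
    pullback I'' (g ∘ h) Ω x = pullback I'' h (pullback I g Ω) x := by
  simp only [pullback]
  rw [mfderiv_comp x hg hh]
  rfl

lemma pullback_congr {g g' : M → M'} {x : M} (Ω : DForm I' M' k) (h : g =ᶠ[𝓝 x] g') :
    pullback I g Ω x = pullback I g' Ω x := by
  have h1 : mfderiv I I' g x = mfderiv I I' g' x := h.mfderiv_eq
  have h2 := h.eq_of_nhds
  ext v
  change Ω (g x) (fun i => mfderiv I I' g x (v i)) = Ω (g' x) (fun i => mfderiv I I' g' x (v i))
  rw [h1]
  generalize mfderiv I I' g' x = l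
  -- The types of Ω at g x and at g' x differ formally; reading both as alternating forms on E'
  -- makes the rewriting possible.
  change ((fun y => (Ω y : E' [⋀^Fin k]→L[ℝ] ℝ)) (g x)) (fun i => l (v i)) =
    ((fun y => (Ω y : E' [⋀^Fin k]→L[ℝ] ℝ)) (g' x)) (fun i => l (v i))
  rw [h2]

/-- The coordinate expression of a pull-back. -/
lemma inChart_pullback {g : M → M'} {p : M} (Ω : DForm I' M' k) (hg : ContMDiffAt I I' ∞ g p) :
    (pullback I g Ω).inChart p =ᶠ[𝓝 (extChartAt I p p)] fun y =>
      (Ω.inChart (g p) (writtenInExtChartAt I I' p g y)).compContinuousLinearMap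
        (fderiv ℝ (writtenInExtChartAt I I' p g) y) := by
  have h1 := (tendsto_extChartAt_symm (I := I) p).eventually hg.eventually_mdifferentiableAt
  have h2 : ∀ᶠ y in 𝓝 (extChartAt I p p), g ((extChartAt I p).symm y) ∈
      (extChartAt I' (g p)).source :=
    (hg.continuousAt.tendsto.comp (tendsto_extChartAt_symm (I := I) p)).eventually
      ((isOpen_extChartAt_source (g p)).mem_nhds (mem_extChartAt_source _))
  filter_upwards [h1, h2.eventually_nhds, (isOpen_extChartAt_target p).mem_nhds
    (mem_extChartAt_target p)] with y hy1 hy2 hy3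
  have hφ := (contMDiffAt_extChartAt_symm_of_mem hy3).mdifferentiableAt (by simp)
  have hw : MDifferentiableAt 𝓘(ℝ, E) 𝓘(ℝ, E') (writtenInExtChartAt I I' p g) y :=
    ((contMDiffAt_extChartAt_of_mem (I := I') hy2.self_of_nhds).mdifferentiableAt (by simp)).comp y
      (hy1.comp y hφ)
  have hψ := (contMDiffAt_extChartAt_symm_of_mem ((extChartAt I' (g p)).map_source
    hy2.self_of_nhds)).mdifferentiableAt (n := ∞) (by simp)
  -- The map g ∘ φ⁻¹ also factors as ψ⁻¹ followed after the written form of g. Expanding the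
  -- pull-back along both factorisations and comparing gives the formula.
  have e1 := pullback_comp_apply Ω hy1 hφ
  have e2 := pullback_comp_apply Ω (h := writtenInExtChartAt I I' p g) (x := y) hψ hw
  have e3 : (g ∘ (extChartAt I p).symm) =ᶠ[𝓝 y]
      ((extChartAt I' (g p)).symm ∘ writtenInExtChartAt I I' p g) := by
    filter_upwards [hy2] with z hz
    exact ((extChartAt I' (g p)).left_inv hz).symm
  have e4 := pullback_congr (I := 𝓘(ℝ, E)) Ω e3
  have e5 : mfderiv 𝓘(ℝ, E) 𝓘(ℝ, E') (writtenInExtChartAt I I' p g) y =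
    fderiv ℝ (writtenInExtChartAt I I' p g) y := mfderiv_eq_fderiv
  have e6 := e1.symm.trans (e4.trans e2)
  refine e6.trans ?_
  simp only [pullback] at *
  rw [e5]
  rfl

lemma contDiffAt_writtenInExtChartAt {g : M → M'} {p : M} (hg : ContMDiffAt I I' ∞ g p) :
    ContDiffAt ℝ ∞ (writtenInExtChartAt I I' p g) (extChartAt I p p) := by
  have := (contMDiffAt_iff.1 hg).2
  rwa [I.range_eq_univ, contDiffWithinAt_univ] at this

lemma fderiv_writtenInExtChartAt {g : M → M'} {p : M} (hg : MDifferentiableAt I I' g p) :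
    mfderiv I I' g p = fderiv ℝ (writtenInExtChartAt I I' p g) (extChartAt I p p) := by
  have h : mfderiv I I' g p = fderivWithin ℝ (writtenInExtChartAt I I' p g) (Set.range I)
      (extChartAt I p p) := by
    unfold mfderiv; exact if_pos hg
  rw [h, I.range_eq_univ, fderivWithin_univ]

lemma d_congr {Ω Ω' : DForm I M k} {p : M} (h : ∀ᶠ q in 𝓝 p, Ω q = Ω' q) : Ω.d p = Ω'.d p := by
  have : Ω.inChart p =ᶠ[𝓝 (extChartAt I p p)] Ω'.inChart p := by
    filter_upwards [(tendsto_extChartAt_symm (I := I) p).eventually h] with y hy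
    rw [inChart, hy]; rfl
  rw [d, d, this.extDeriv_eq]

lemma SmoothAt.congr {Ω Ω' : DForm I M k} {p : M} (hs : Ω.SmoothAt p)
    (h : ∀ᶠ q in 𝓝 p, Ω' q = Ω q) : Ω'.SmoothAt p := by
  refine ContDiffAt.congr_of_eventuallyEq hs ?_
  filter_upwards [(tendsto_extChartAt_symm (I := I) p).eventually h] with y hy
  rw [inChart, hy]; rfl

/-- The exterior derivative commutes with pull-backs. -/
lemma d_pullback {g : M → M'} {p : M} {Ω : DForm I' M' k} (hg : ContMDiffAt I I' ∞ g p)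
    (hΩ : Ω.SmoothAt (g p)) : (pullback I g Ω).d p = pullback I g Ω.d p := by
  have hw : writtenInExtChartAt I I' p g (extChartAt I p p) = extChartAt I' (g p) (g p) := by
    simp [writtenInExtChartAt]
  have e1 := (inChart_pullback Ω hg).extDeriv_eq
  rw [extDeriv_pullback (r := ∞) (by rw [hw]; exact hΩ.differentiableAt (by simp))
    (contDiffAt_writtenInExtChartAt hg) (by simpa using two_le_infty), hw] at e1
  rw [d, e1]
  have e2 := fderiv_writtenInExtChartAt (hg.mdifferentiableAt (by simp))
  rw [← e2]
  -- The tangent space at p is the model space through the preferred chart at p, so that chart has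
  -- the identity as derivative at its own centre.
  have e3 : mfderiv I 𝓘(ℝ, E) (extChartAt I p) p = ContinuousLinearMap.id ℝ E :=
    mfderiv_extChartAt_self
  have e4 : mfderiv I' 𝓘(ℝ, E') (extChartAt I' (g p)) (g p) = ContinuousLinearMap.id ℝ E' :=
    mfderiv_extChartAt_self
  rw [e3]
  simp only [pullback, d]
  rw [e4]
  rfl

end DForm

end FormCalculus

/-! ### Forms on vector spaces, smoothness of 1-forms and their differentials, d² = 0. -/

section OneForms

variable {E : Type*} [NormedAddCommGroup E] [NormedSpace ℝ E]
  {H : Type*} [TopologicalSpace H] {I : ModelWithCorners ℝ E H} [I.Boundaryless]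
  {M : Type*} [TopologicalSpace M] [ChartedSpace H M] [IsManifold I ∞ M]
  {E' : Type*} [NormedAddCommGroup E'] [NormedSpace ℝ E']
  {H' : Type*} [TopologicalSpace H'] {I' : ModelWithCorners ℝ E' H'} [I'.Boundaryless]
  {M' : Type*} [TopologicalSpace M'] [ChartedSpace H' M'] [IsManifold I' ∞ M'] {k : ℕ}

namespace DForm

/-- A 1-form on a normed space, given by a field of covectors. -/
noncomputable def ofModel (Θ : E → E →L[ℝ] ℝ) : DForm 𝓘(ℝ, E) E 1 := ofCovector Θ

lemma inChart_model (Ω : DForm 𝓘(ℝ, E) E k) (p : E) : Ω.inChart p = Ω := by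
  funext y
  have h : mfderiv 𝓘(ℝ, E) 𝓘(ℝ, E) (extChartAt 𝓘(ℝ, E) p).symm y = ContinuousLinearMap.id ℝ E := by
    rw [show ((extChartAt 𝓘(ℝ, E) p).symm : E → E) = id from by
      rw [extChartAt_model_space_eq_id]; rfl]
    exact mfderiv_id
  rw [inChart, h, extChartAt_model_space_eq_id]
  rfl

lemma d_model (Ω : DForm 𝓘(ℝ, E) E k) (p : E) : Ω.d p = extDeriv (E := E) Ω p := by
  have h : mfderiv 𝓘(ℝ, E) 𝓘(ℝ, E) (extChartAt 𝓘(ℝ, E) p) p = ContinuousLinearMap.id ℝ E :=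
    mfderiv_extChartAt_self
  rw [d, h, inChart_model, extChartAt_model_space_eq_id]
  rfl

lemma smoothAt_model_iff {Ω : DForm 𝓘(ℝ, E) E k} {p : E} :
    Ω.SmoothAt p ↔ ContDiffAt ℝ ∞ (F := E [⋀^Fin k]→L[ℝ] ℝ) Ω p := by
  rw [SmoothAt, inChart_model, extChartAt_model_space_eq_id]
  rfl

lemma ofModel_smoothAt {Θ : E → E →L[ℝ] ℝ} {p : E} (h : ContDiffAt ℝ ∞ Θ p) :
    (ofModel Θ).SmoothAt p := by
  rw [smoothAt_model_iff]
  exact (ContinuousAlternatingMap.ofSubsingletonLIE (𝕜 := ℝ) (E := E) (F := ℝ)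
    (0 : Fin 1)).toContinuousLinearEquiv.contDiff.contDiffAt.comp p h

lemma extDeriv_ofSubsingleton {Θ : E → E →L[ℝ] ℝ} {p : E} (h : DifferentiableAt ℝ Θ p) (a b : E) :
    extDeriv (fun y => ContinuousAlternatingMap.ofSubsingleton ℝ E ℝ (0 : Fin 1) (Θ y)) p ![a, b] =
      fderiv ℝ Θ p a b - fderiv ℝ Θ p b a := by
  have h1 : DifferentiableAt ℝ
      (fun y => ContinuousAlternatingMap.ofSubsingleton ℝ E ℝ (0 : Fin 1) (Θ y)) p :=
    (ContinuousAlternatingMap.ofSubsingletonLIE (𝕜 := ℝ) (E := E) (F := ℝ)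
      (0 : Fin 1)).toContinuousLinearEquiv.differentiableAt.comp p h
  rw [extDeriv_apply h1]
  have h3 : ∀ c b' : E, fderiv ℝ (fun x => Θ x c) p b' = fderiv ℝ Θ p b' c := by
    intro c b'
    rw [fderiv_clm_apply h (differentiableAt_const c)]
    simp
  simp [Fin.sum_univ_two, h3, Fin.removeNth, sub_eq_add_neg]

lemma d_ofModel {Θ : E → E →L[ℝ] ℝ} {p : E} (h : DifferentiableAt ℝ Θ p) (a b : E) :
    (ofModel Θ).d p ![a, b] = fderiv ℝ Θ p a b - fderiv ℝ Θ p b a := by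
  rw [d_model]
  exact extDeriv_ofSubsingleton h a b

/-- A 1-form is a covector field, and composing covectors with the derivative of g is a smooth
bilinear operation. Degree 1 suffices: the 2-forms that occur are exterior derivatives of smooth
1-forms. -/
lemma smoothAt_pullback_one {g : M → M'} {p : M} {Ω : DForm I' M' 1} (hg : ContMDiffAt I I' ∞ g p)
    (hΩ : Ω.SmoothAt (g p)) : (pullback I g Ω).SmoothAt p := by
  refine ContDiffAt.congr_of_eventuallyEq ?_ (inChart_pullback Ω hg)
  have hw : writtenInExtChartAt I I' p g (extChartAt I p p) = extChartAt I' (g p) (g p) := by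
    simp [writtenInExtChartAt]
  have h1 := contDiffAt_writtenInExtChartAt hg
  have h2 : ContDiffAt ℝ ∞ (fderiv ℝ (writtenInExtChartAt I I' p g)) (extChartAt I p p) :=
    h1.fderiv_right (by simp)
  have h3 : ContDiffAt ℝ ∞ (fun y => Ω.inChart (g p) (writtenInExtChartAt I I' p g y))
      (extChartAt I p p) := by
    exact ContDiffAt.comp (g := Ω.inChart (g p)) _ (by rw [hw]; exact hΩ) h1
  have h4 : ContDiffAt ℝ ∞ (fun y => (ContinuousAlternatingMap.ofSubsingletonLIE (𝕜 := ℝ) (E := E')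
      (F := ℝ) (0 : Fin 1)).symm (Ω.inChart (g p) (writtenInExtChartAt I I' p g y)))
      (extChartAt I p p) :=
    (ContinuousAlternatingMap.ofSubsingletonLIE (𝕜 := ℝ) (E := E') (F := ℝ)
      (0 : Fin 1)).symm.toContinuousLinearEquiv.contDiff.contDiffAt.comp _ h3
  have h5 : ContDiffAt ℝ ∞ (fun y => ContinuousAlternatingMap.ofSubsingletonLIE (𝕜 := ℝ) (E := E)
      (F := ℝ) (0 : Fin 1) (((ContinuousAlternatingMap.ofSubsingletonLIE (𝕜 := ℝ) (E := E')
      (F := ℝ) (0 : Fin 1)).symm (Ω.inChart (g p) (writtenInExtChartAt I I' p g y))).comp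
        (fderiv ℝ (writtenInExtChartAt I I' p g) y))) (extChartAt I p p) :=
    (ContinuousAlternatingMap.ofSubsingletonLIE (𝕜 := ℝ) (E := E) (F := ℝ)
    (0 : Fin 1)).toContinuousLinearEquiv.contDiff.contDiffAt.comp _ (h4.clm_comp h2)
  refine h5.congr_of_eventuallyEq (Filter.Eventually.of_forall fun y => ?_)
  ext v
  change _ = Ω.inChart (g p) (writtenInExtChartAt I I' p g y) (fun _ =>
    fderiv ℝ (writtenInExtChartAt I I' p g) y (v 0))
  change Ω.inChart (g p) (writtenInExtChartAt I I' p g y) (fun i =>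
    fderiv ℝ (writtenInExtChartAt I I' p g) y (v i)) = _
  congr 1
  funext i
  rw [Subsingleton.elim i 0]

/-- The coordinate expression of the exterior derivative of a smooth form. -/
lemma inChart_d {Ω : DForm I M k} (hΩ : ∀ q, Ω.SmoothAt q) (p : M) :
    Ω.d.inChart p =ᶠ[𝓝 (extChartAt I p p)] extDeriv (Ω.inChart p) := by
  filter_upwards [(isOpen_extChartAt_target p).mem_nhds (mem_extChartAt_target p)] with y hy
  -- A coordinate expression is the pull-back along the inverse chart, so this is naturality of d
  -- applied to that map.
  have h := d_pullback (contMDiffAt_extChartAt_symm_of_mem hy) (hΩ _)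
  rw [d_model] at h
  exact h.symm

lemma smoothAt_d {Ω : DForm I M k} (hΩ : ∀ q, Ω.SmoothAt q) (p : M) : Ω.d.SmoothAt p := by
  refine ContDiffAt.congr_of_eventuallyEq ?_ (inChart_d hΩ p)
  have h : ContDiffAt ℝ ∞ (fderiv ℝ (Ω.inChart p)) (extChartAt I p p) :=
    (hΩ p).fderiv_right (by simp)
  exact (ContinuousAlternatingMap.alternatizeUncurryFinCLM ℝ E ℝ (n := k)).contDiff.contDiffAt.comp
    _ h

lemma d_d {Ω : DForm I M k} (hΩ : ∀ q, Ω.SmoothAt q) (p : M) : Ω.d.d p = 0 := by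
  rw [d, (inChart_d hΩ p).extDeriv_eq, extDeriv_extDeriv_apply (hΩ p) (by simpa using two_le_infty)]
  rfl

lemma inChart_neg (Ω : DForm I M k) (p : M) : (-Ω).inChart p = -Ω.inChart p := rfl

lemma SmoothAt.neg {Ω : DForm I M k} {p : M} (hΩ : Ω.SmoothAt p) : (-Ω).SmoothAt p :=
  ContDiffAt.neg hΩ

lemma d_neg_eq_zero {Ω : DForm I M k} {p : M} (h : Ω.d p = 0) :
    (-Ω).d p = 0 := by
  have h2 : (-Ω).d p = -Ω.d p := by
    have := extDeriv_smul (x := extChartAt I p p) (-1 : ℝ) (Ω.inChart p)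
    rw [neg_one_smul, neg_one_smul] at this
    rw [d, inChart_neg, this]
    rfl
  rw [h2, h, neg_zero]

end DForm

end OneForms

/-! ### Charts of vector bundles and derivatives of maps into and along their fibres. -/

section BundleCharts

variable {E : Type*} [NormedAddCommGroup E] [NormedSpace ℝ E]
  {H : Type*} [TopologicalSpace H] {I : ModelWithCorners ℝ E H} [I.Boundaryless]
  {B : Type*} [TopologicalSpace B] [ChartedSpace H B] [IsManifold I ∞ B]
  {F : Type*} [NormedAddCommGroup F] [NormedSpace ℝ F]
  {Z : B → Type*} [∀ q, TopologicalSpace (Z q)] [∀ q, AddCommGroup (Z q)] [∀ q, Module ℝ (Z q)]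
  [TopologicalSpace (TotalSpace F Z)] [FiberBundle F Z] [VectorBundle ℝ F Z]
  [ContMDiffVectorBundle ∞ F Z I]
  {E' : Type*} [NormedAddCommGroup E'] [NormedSpace ℝ E']
  {H' : Type*} [TopologicalSpace H'] {I' : ModelWithCorners ℝ E' H'}
  {M : Type*} [TopologicalSpace M] [ChartedSpace H' M]
  {V : Type*} [NormedAddCommGroup V] [NormedSpace ℝ V]

/-- The fibre coordinate of a vector bundle in the preferred trivialization at `q`. -/
noncomputable def fibreCoord (F : Type*) [NormedAddCommGroup F] [NormedSpace ℝ F] {Z : B → Type*}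
    [∀ q, TopologicalSpace (Z q)] [TopologicalSpace (TotalSpace F Z)] [FiberBundle F Z] (q : B)
    (x : TotalSpace F Z) : F :=
  (trivializationAt F Z q x).2

lemma extChartAt_totalSpace_apply (x : TotalSpace F Z) {y : TotalSpace F Z}
    (hy : y.proj ∈ (trivializationAt F Z x.proj).baseSet) :
    extChartAt (I.prod 𝓘(ℝ, F)) x y = (extChartAt I x.proj y.proj, fibreCoord F x.proj y) := by
  rw [FiberBundle.extChartAt]
  have : (trivializationAt F Z x.proj y).1 = y.proj :=
    (trivializationAt F Z x.proj).coe_fst ((trivializationAt F Z x.proj).mem_source.2 hy)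
  simp [fibreCoord, this]

lemma mem_source_extChartAt_totalSpace {x y : TotalSpace F Z} :
    y ∈ (extChartAt (I.prod 𝓘(ℝ, F)) x).source ↔
      y.proj ∈ (trivializationAt F Z x.proj).baseSet ∧ y.proj ∈ (extChartAt I x.proj).source := by
  rw [FiberBundle.extChartAt, PartialEquiv.trans_source]
  have h : y ∈ (trivializationAt F Z x.proj).source ↔
    y.proj ∈ (trivializationAt F Z x.proj).baseSet := (trivializationAt F Z x.proj).mem_source
  constructor
  · rintro ⟨h1, h2⟩
    refine ⟨h.1 h1, ?_⟩
    have h3 : (trivializationAt F Z x.proj y).1 ∈ (extChartAt I x.proj).source := h2.1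
    rwa [(trivializationAt F Z x.proj).coe_fst h1] at h3
  · rintro ⟨h1, h2⟩
    refine ⟨h.2 h1, ?_, Set.mem_univ _⟩
    change (trivializationAt F Z x.proj y).1 ∈ (extChartAt I x.proj).source
    rwa [(trivializationAt F Z x.proj).coe_fst (h.2 h1)]

lemma contMDiffAt_fibreCoord {q : B} {x : TotalSpace F Z}
    (hx : x.proj ∈ (trivializationAt F Z q).baseSet) :
    ContMDiffAt (I.prod 𝓘(ℝ, F)) 𝓘(ℝ, F) ∞ (fibreCoord F q : TotalSpace F Z → F) x :=
  (((trivializationAt F Z q).contMDiffAt_iff ((trivializationAt F Z q).mem_source.2 hx)).1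
    contMDiffAt_id).2

/-- The preferred chart at x is the pair (base chart, fibre coordinate), and preferred charts have
identity derivative at their centres. With the companion for the fibre coordinate, this splits
tangent vectors at x as E × F, the form in which all later computations are done. -/
lemma mfderiv_totalSpace_proj (x : TotalSpace F Z) :
    mfderiv (I.prod 𝓘(ℝ, F)) I (TotalSpace.proj : TotalSpace F Z → B) x =
      ContinuousLinearMap.fst ℝ E F := by
  have h1 : (extChartAt I x.proj ∘ TotalSpace.proj : TotalSpace F Z → E) =ᶠ[𝓝 x]
      Prod.fst ∘ extChartAt (I.prod 𝓘(ℝ, F)) x := by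
    filter_upwards [(isOpen_extChartAt_source (I := I.prod 𝓘(ℝ, F)) x).mem_nhds
      (mem_extChartAt_source x)] with y hy
    rw [mem_source_extChartAt_totalSpace] at hy
    simp only [Function.comp_apply, extChartAt_totalSpace_apply x hy.1]
  have h2 := h1.mfderiv_eq (I := I.prod 𝓘(ℝ, F)) (I' := 𝓘(ℝ, E))
  have h3 := mfderiv_comp (I := I.prod 𝓘(ℝ, F)) (I' := I) (I'' := 𝓘(ℝ, E)) x
    ((contMDiffAt_extChartAt (n := ∞)).mdifferentiableAt (by simp))
    ((contMDiff_proj (n := ∞) Z).mdifferentiableAt (x := x) (by simp))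
  have h4 := mfderiv_comp (I := I.prod 𝓘(ℝ, F)) (I' := 𝓘(ℝ, E × F)) (I'' := 𝓘(ℝ, E)) x
    (g := Prod.fst) (contDiff_fst.contMDiff.mdifferentiableAt (n := ∞) (by simp))
    ((contMDiffAt_extChartAt (I := I.prod 𝓘(ℝ, F)) (n := ∞) (x := x)).mdifferentiableAt (by simp))
  have e1 : mfderiv I 𝓘(ℝ, E) (extChartAt I x.proj) x.proj = ContinuousLinearMap.id ℝ E :=
    mfderiv_extChartAt_self
  have e2 : mfderiv (I.prod 𝓘(ℝ, F)) 𝓘(ℝ, E × F) (extChartAt (I.prod 𝓘(ℝ, F)) x) x =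
    ContinuousLinearMap.id ℝ (E × F) := mfderiv_extChartAt_self
  have e3 : mfderiv 𝓘(ℝ, E × F) 𝓘(ℝ, E) Prod.fst (extChartAt (I.prod 𝓘(ℝ, F)) x x) =
    ContinuousLinearMap.fst ℝ E F := mfderiv_eq_fderiv.trans fderiv_fst
  rw [h2, h4, e1, e2, e3] at h3
  exact h3.symm

lemma mfderiv_fibreCoord (x : TotalSpace F Z) :
    mfderiv (I.prod 𝓘(ℝ, F)) 𝓘(ℝ, F) (fibreCoord F x.proj : TotalSpace F Z → F) x =
      ContinuousLinearMap.snd ℝ E F := by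
  have h1 : (fibreCoord F x.proj : TotalSpace F Z → F) =ᶠ[𝓝 x]
      Prod.snd ∘ extChartAt (I.prod 𝓘(ℝ, F)) x := by
    filter_upwards [(isOpen_extChartAt_source (I := I.prod 𝓘(ℝ, F)) x).mem_nhds
      (mem_extChartAt_source x)] with y hy
    rw [mem_source_extChartAt_totalSpace] at hy
    simp only [Function.comp_apply, extChartAt_totalSpace_apply x hy.1]
  have h2 := h1.mfderiv_eq (I := I.prod 𝓘(ℝ, F)) (I' := 𝓘(ℝ, F))
  have h4 := mfderiv_comp (I := I.prod 𝓘(ℝ, F)) (I' := 𝓘(ℝ, E × F)) (I'' := 𝓘(ℝ, F)) x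
    (g := Prod.snd) (contDiff_snd.contMDiff.mdifferentiableAt (n := ∞) (by simp))
    ((contMDiffAt_extChartAt (I := I.prod 𝓘(ℝ, F)) (n := ∞) (x := x)).mdifferentiableAt (by simp))
  have e2 : mfderiv (I.prod 𝓘(ℝ, F)) 𝓘(ℝ, E × F) (extChartAt (I.prod 𝓘(ℝ, F)) x) x =
    ContinuousLinearMap.id ℝ (E × F) := mfderiv_extChartAt_self
  have e3 : mfderiv 𝓘(ℝ, E × F) 𝓘(ℝ, F) Prod.snd (extChartAt (I.prod 𝓘(ℝ, F)) x x) =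
    ContinuousLinearMap.snd ℝ E F := mfderiv_eq_fderiv.trans fderiv_snd
  rw [h4, e2, e3] at h2
  exact h2

/-- The derivative of a map into a vector bundle, by components. -/
lemma mfderiv_totalSpace_apply {g : M → TotalSpace F Z} {y : M}
    (hg : MDifferentiableAt I' (I.prod 𝓘(ℝ, F)) g y) (w : TangentSpace I' y) :
    (mfderiv I' (I.prod 𝓘(ℝ, F)) g y w : E × F) =
      ((mfderiv I' I (fun z => (g z).proj) y w : E),
        (mfderiv I' 𝓘(ℝ, F) (fun z => fibreCoord F (g y).proj (g z)) y w : F)) := by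
  have h1 := mfderiv_comp_apply y
    ((contMDiff_proj (n := ∞) Z).mdifferentiableAt (x := g y) (I := I.prod 𝓘(ℝ, F)) (I' := I)
      (by simp)) hg w
  have h2 := mfderiv_comp_apply y
    ((contMDiffAt_fibreCoord (I := I) (FiberBundle.mem_baseSet_trivializationAt' (F := F) (E := Z)
      (g y).proj)).mdifferentiableAt (x := g y) (by simp)) hg w
  rw [mfderiv_totalSpace_proj] at h1
  rw [mfderiv_fibreCoord] at h2
  exact Prod.ext h1.symm h2.symm

lemma fibreCoord_eq {q : B} (x : TotalSpace F Z)
    (hx : x.proj ∈ (trivializationAt F Z q).baseSet) :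
    fibreCoord F q x = (trivializationAt F Z q).continuousLinearMapAt ℝ x.proj x.2 := by
  rw [Trivialization.continuousLinearMapAt_apply, Trivialization.linearMapAt_apply, if_pos hx]
  rfl

/-- Affine maps into a fibre are smooth. -/
lemma contMDiff_fibre_affine (x : TotalSpace F Z) (ℓ : V →L[ℝ] Z x.proj)
    {f : V → Z x.proj} (hf : ∀ s, f s = x.2 + ℓ s) :
    ContMDiff 𝓘(ℝ, V) (I.prod 𝓘(ℝ, F)) ∞ (fun s => (⟨x.proj, f s⟩ : TotalSpace F Z)) := by
  intro s
  rw [contMDiffAt_totalSpace]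
  refine ⟨contMDiffAt_const, ?_⟩
  have hb := FiberBundle.mem_baseSet_trivializationAt' (F := F) (E := Z) x.proj
  have : (fun s => (trivializationAt F Z x.proj (⟨x.proj, f s⟩ : TotalSpace F Z)).2) = fun s =>
      (trivializationAt F Z x.proj).continuousLinearMapAt ℝ x.proj x.2 +
      (trivializationAt F Z x.proj).continuousLinearMapAt ℝ x.proj (ℓ s) := by
    funext s
    rw [← map_add, ← hf]
    exact fibreCoord_eq ⟨x.proj, f s⟩ hb
  rw [this]
  exact (contDiff_const.add (((trivializationAt F Z x.proj).continuousLinearMapAt ℝ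
    x.proj).comp ℓ).contDiff).contMDiff.contMDiffAt

lemma hasMFDerivAt_fibreCoord_affine {q : B} (x : TotalSpace F Z)
    (hx : x.proj ∈ (trivializationAt F Z q).baseSet) (ℓ : V →L[ℝ] Z x.proj)
    {f : V → Z x.proj} (hf : ∀ s, f s = x.2 + ℓ s) (s : V) :
    HasMFDerivAt 𝓘(ℝ, V) 𝓘(ℝ, F) (fun s => fibreCoord F q (⟨x.proj, f s⟩ : TotalSpace F Z)) s
      (((trivializationAt F Z q).continuousLinearMapAt ℝ x.proj).comp ℓ) := by
  have : (fun s => fibreCoord F q (⟨x.proj, f s⟩ : TotalSpace F Z)) = fun s =>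
      (trivializationAt F Z q).continuousLinearMapAt ℝ x.proj x.2 +
      (((trivializationAt F Z q).continuousLinearMapAt ℝ x.proj).comp ℓ) s := by
    funext s
    rw [fibreCoord_eq ⟨x.proj, f s⟩ hx, hf, map_add]
    rfl
  rw [this]
  exact ((((trivializationAt F Z q).continuousLinearMapAt ℝ x.proj).comp ℓ).hasFDerivAt.const_add
    _).hasMFDerivAt

lemma mfderiv_fibre_affine (x : TotalSpace F Z) (ℓ : V →L[ℝ] Z x.proj)
    {f : V → Z x.proj} (hf : ∀ s, f s = x.2 + ℓ s) (s w : V) :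
    (mfderiv 𝓘(ℝ, V) (I.prod 𝓘(ℝ, F)) (fun s => (⟨x.proj, f s⟩ : TotalSpace F Z)) s w : E × F) =
      (0, (trivializationAt F Z x.proj).continuousLinearMapAt ℝ x.proj (ℓ w)) := by
  refine (mfderiv_totalSpace_apply
    ((contMDiff_fibre_affine x ℓ hf).mdifferentiableAt (by simp)) w).trans ?_
  refine Prod.ext ?_ ?_
  · change mfderiv 𝓘(ℝ, V) I (fun _ : V => x.proj) s w = 0
    rw [mfderiv_const]; rfl
  · have h := (hasMFDerivAt_fibreCoord_affine x (FiberBundle.mem_baseSet_trivializationAt'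
      (F := F) (E := Z) x.proj) ℓ hf s).mfderiv
    change mfderiv 𝓘(ℝ, V) 𝓘(ℝ, F)
      (fun s => fibreCoord F x.proj (⟨x.proj, f s⟩ : TotalSpace F Z)) s w = _
    rw [h]; rfl

lemma fibreCoord_tangent {q q' : B} (hq : q' ∈ (chartAt H q).source) (w : TangentSpace I q') :
    fibreCoord E q (⟨q', w⟩ : TangentBundle I B) = mfderiv I 𝓘(ℝ, E) (extChartAt I q) q' w := by
  rw [← TangentBundle.continuousLinearMapAt_trivializationAt hq]
  exact fibreCoord_eq (⟨q', w⟩ : TangentBundle I B) hq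

lemma fibreCoord_tangent_self (v : TangentBundle I B) : fibreCoord E v.1 v = v.2 := by
  have h : mfderiv I 𝓘(ℝ, E) (extChartAt I v.1) v.1 = ContinuousLinearMap.id ℝ E :=
    mfderiv_extChartAt_self
  refine (fibreCoord_tangent (mem_chart_source H v.1) v.2).trans ?_
  rw [h]; rfl

lemma continuousLinearMapAt_tangent_self (q : B) :
    (trivializationAt E (TangentSpace I) q).continuousLinearMapAt ℝ q =
      ContinuousLinearMap.id ℝ E := by
  rw [TangentBundle.continuousLinearMapAt_trivializationAt (mem_chart_source H q)]
  exact mfderiv_extChartAt_self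

end BundleCharts

/-! ### The tangent space of the jet bundle as the kernel of dṫ. -/

namespace TimeFibration

section JetCalculus

variable {E : Type*} [NormedAddCommGroup E] [NormedSpace ℝ E] [FiniteDimensional ℝ E]
  {H : Type*} [TopologicalSpace H] {I : ModelWithCorners ℝ E H} [I.Boundaryless]
  {N : Type*} [TopologicalSpace N] [ChartedSpace H N] [IsManifold I ∞ N]
  {ρ : TimeFibration I N}

/-- The differential of `ṫ`. -/
noncomputable def dTdot (ρ : TimeFibration I N) (u : TangentBundle I N) : E × E →L[ℝ] ℝ :=
  mfderiv I.tangent 𝓘(ℝ, ℝ) ρ.tdot u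

/-- The function ṫ is linear on each tangent space, with coefficient dρ; along u + b it is therefore
affine. -/
lemma dTdot_vertical (u : TangentBundle I N) (b : E) : ρ.dTdot u (0, b) = ρ.dAt u.1 b := by
  let ℓ : E →L[ℝ] TangentSpace I u.1 := ContinuousLinearMap.id ℝ E
  let f : E → TangentSpace I u.1 := fun s => u.2 + ℓ s
  have h1 := mfderiv_comp_apply (I := 𝓘(ℝ, E)) (I' := I.tangent) (I'' := 𝓘(ℝ, ℝ)) (0 : E)
    (f := fun s => (⟨u.1, f s⟩ : TangentBundle I N)) (g := ρ.tdot)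
    (ρ.contMDiff_tdot.mdifferentiableAt (by simp))
    ((contMDiff_fibre_affine (V := E) (I := I) u ℓ (fun _ => rfl)).mdifferentiableAt
      (by simp)) b
  have h2 := mfderiv_fibre_affine (V := E) (I := I) u ℓ (f := f) (fun _ => rfl) 0 b
  have h3 : (⟨u.1, f 0⟩ : TangentBundle I N) = u := by simp [f]
  have h4 : HasFDerivAt (ρ.tdot ∘ fun s => (⟨u.1, f s⟩ : TangentBundle I N)) (ρ.dAt u.1) 0 := by
    have : (ρ.tdot ∘ fun s => (⟨u.1, f s⟩ : TangentBundle I N)) =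
        fun s => ρ.dAt u.1 u.2 + ρ.dAt u.1 s := by
      funext s; exact map_add (ρ.dAt u.1) u.2 s
    rw [this]
    exact (ρ.dAt u.1).hasFDerivAt.const_add _
  have h5 : mfderiv 𝓘(ℝ, E) 𝓘(ℝ, ℝ) (ρ.tdot ∘ fun s => (⟨u.1, f s⟩ : TangentBundle I N)) 0 =
    ρ.dAt u.1 := h4.hasMFDerivAt.mfderiv
  have h6 : (trivializationAt E (TangentSpace I) u.proj).continuousLinearMapAt ℝ u.proj b = b := by
    rw [continuousLinearMapAt_tangent_self]; rfl
  rw [h5] at h1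
  refine Eq.trans ?_ h1.symm
  change ρ.dTdot u (0, b) = ρ.dTdot (⟨u.1, f 0⟩ : TangentBundle I N) _
  rw [h3]
  congr 1
  exact (congrArg (Prod.mk (0 : E)) h6.symm).trans h2.symm

/-- The jet spanned by a tangent vector that is transverse to the fibres. -/
noncomputable def jetOfTransverse (u : TangentBundle I N) (h : ρ.tdot u ≠ 0) : ρ.Jet :=
  ⟨⟨u.1, (ρ.tdot u)⁻¹ • u.2⟩, by
    have : ρ.tdot (⟨u.1, (ρ.tdot u)⁻¹ • u.2⟩ : TangentBundle I N) = (ρ.tdot u)⁻¹ * ρ.tdot u :=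
      (ρ.dAt u.1).map_smul _ u.2
    rw [this, inv_mul_cancel₀ h]⟩

open Classical in
/-- Normalisation of tangent vectors to jets. -/
noncomputable def normalize (v : ρ.Jet) (u : TangentBundle I N) : ρ.Jet :=
  if h : ρ.tdot u ≠ 0 then jetOfTransverse u h else v

/-- Normalisation is a retraction onto the jets, smooth wherever ṫ ≠ 0; its default value is taken
only where ṫ = 0. It yields injectivity of the differential of the inclusion and extends Lagrangians
to a neighbourhood of the jets in the tangent bundle. -/
lemma normalize_of_tdot_eq_one (v : ρ.Jet) (u : ρ.Jet) : normalize v u.toTangent = u := by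
  have hu : ρ.tdot u.toTangent = 1 := u.2
  have h : ρ.tdot u.toTangent ≠ 0 := by rw [hu]; exact one_ne_zero
  rw [normalize, dif_pos h]
  apply Subtype.ext
  change (⟨u.toTangent.1, (ρ.tdot u.toTangent)⁻¹ • u.toTangent.2⟩ : TangentBundle I N) =
    u.toTangent
  rw [hu, inv_one, one_smul]

lemma contMDiffAt_normalize (v : ρ.Jet) {u : TangentBundle I N} (hu : ρ.tdot u ≠ 0) :
    ContMDiffAt I.tangent 𝓘(ℝ, JetModel E) ∞ (normalize v) u := by
  have hev : ∀ᶠ z in 𝓝 u, ρ.tdot z ≠ 0 :=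
    ρ.contMDiff_tdot.continuous.continuousAt.eventually_ne hu
  apply Jet.contMDiffAt_of_toTangent
  have h1 : ContMDiffAt I.tangent I.tangent ∞
      (fun z : TangentBundle I N => (⟨z.1, (ρ.tdot z)⁻¹ • z.2⟩ : TangentBundle I N)) u := by
    rw [contMDiffAt_totalSpace]
    refine ⟨contMDiffAt_proj _, ?_⟩
    have hb := FiberBundle.mem_baseSet_trivializationAt' (F := E) (E := (TangentSpace I : N → Type _))
      u.1
    have h2 : ContMDiffAt I.tangent 𝓘(ℝ, E) ∞
        (fun z : TangentBundle I N => (ρ.tdot z)⁻¹ • fibreCoord E u.1 z) u := by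
      have h3 : ContMDiffAt I.tangent 𝓘(ℝ, ℝ) ∞ (fun z => (ρ.tdot z)⁻¹) u :=
        ((contDiffAt_inv ℝ hu).contMDiffAt).comp u ρ.contMDiff_tdot.contMDiffAt
      exact h3.smul (contMDiffAt_fibreCoord hb)
    refine h2.congr_of_eventuallyEq ?_
    have : ∀ᶠ z : TangentBundle I N in 𝓝 u,
        z.1 ∈ (trivializationAt E (TangentSpace I) u.1).baseSet :=
      (FiberBundle.continuous_proj E (TangentSpace I)).continuousAt.eventually
        ((trivializationAt E (TangentSpace I) u.1).open_baseSet.mem_nhds hb)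
    filter_upwards [this] with z hz
    exact ((trivializationAt E (TangentSpace I) u.1).linear ℝ hz).map_smul _ z.2
  refine h1.congr_of_eventuallyEq ?_
  filter_upwards [hev] with z hz
  rw [normalize, dif_pos hz]
  rfl

namespace Jet

/-- The differential of the inclusion of the jet bundle into the tangent bundle. -/
noncomputable def dTan (v : ρ.Jet) : v.Tan →L[ℝ] E × E :=
  mfderiv 𝓘(ℝ, JetModel E) I.tangent toTangent v

lemma mdifferentiableAt_toTangent (v : ρ.Jet) :
    MDifferentiableAt 𝓘(ℝ, JetModel E) I.tangent (toTangent : ρ.Jet → TangentBundle I N) v :=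
  contMDiff_toTangent.mdifferentiableAt (by simp)

lemma dTan_fst (v : ρ.Jet) (w : v.Tan) : (dTan v w).1 = dBase v w :=
  congrArg Prod.fst (mfderiv_totalSpace_apply (mdifferentiableAt_toTangent v) w)

/-- The chain rule for `normalize v ∘ toTangent = id` provides a left inverse. -/
lemma dTan_injective (v : ρ.Jet) : Function.Injective (dTan v) := by
  have h1 : mfderiv 𝓘(ℝ, JetModel E) 𝓘(ℝ, JetModel E) (normalize v ∘ toTangent : ρ.Jet → ρ.Jet) v =
      ContinuousLinearMap.id ℝ _ := by
    rw [show (normalize v ∘ toTangent : ρ.Jet → ρ.Jet) = id from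
      funext (normalize_of_tdot_eq_one v)]
    exact mfderiv_id
  have hv : ρ.tdot v.toTangent ≠ 0 := by rw [show ρ.tdot v.toTangent = 1 from v.2]; exact one_ne_zero
  intro w w' hw
  have h2 := fun w => mfderiv_comp_apply v
    ((contMDiffAt_normalize v hv).mdifferentiableAt (by simp)) (mdifferentiableAt_toTangent v) w
  have h3 : ∀ w : v.Tan, mfderiv 𝓘(ℝ, JetModel E) 𝓘(ℝ, JetModel E)
      (normalize v ∘ toTangent : ρ.Jet → ρ.Jet) v w = w := fun w => by rw [h1]; rfl
  have e1 := (h2 w).symm.trans (h3 w)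
  have e2 := (h2 w').symm.trans (h3 w')
  rw [← e1, ← e2]
  exact congrArg _ hw

lemma dTdot_dTan (v : ρ.Jet) (w : v.Tan) : ρ.dTdot v.toTangent (dTan v w) = 0 := by
  have h1 := mfderiv_comp_apply v (ρ.contMDiff_tdot.mdifferentiableAt (by simp))
    (mdifferentiableAt_toTangent v) w
  have h2 : (ρ.tdot ∘ toTangent : ρ.Jet → ℝ) = fun _ => 1 := funext fun u => u.2
  rw [h2, mfderiv_const] at h1
  exact h1.symm

lemma finrank_ker_dTdot (v : ρ.Jet) :
    Module.finrank ℝ (LinearMap.ker (ρ.dTdot v.toTangent).toLinearMap) =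
      Module.finrank ℝ (JetModel E) := by
  have h0 : ρ.dTdot v.toTangent (0, v.vec) = 1 := (dTdot_vertical _ _).trans v.dAt_vec
  have h1 := LinearMap.finrank_range_add_finrank_ker (ρ.dTdot v.toTangent).toLinearMap
  have h2 : LinearMap.range (ρ.dTdot v.toTangent).toLinearMap = ⊤ := by
    rw [LinearMap.range_eq_top]
    intro c
    refine ⟨c • (0, v.vec), ?_⟩
    rw [map_smul]
    change c • ρ.dTdot v.toTangent (0, v.vec) = c
    rw [h0, smul_eq_mul, mul_one]
  rw [h2, finrank_top, Module.finrank_self] at h1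
  rw [finrank_euclideanSpace_fin]
  omega

/-- The range of `dTan` lies in the kernel of dṫ because ṫ is constant on jets, and the dimensions
agree. Tangent vectors of jets can thus be prescribed by their components in E × E. -/
lemma exists_dTan_eq (v : ρ.Jet) {c : E × E} (hc : ρ.dTdot v.toTangent c = 0) :
    ∃ w : v.Tan, dTan v w = c := by
  have h1 : LinearMap.range (dTan v).toLinearMap =
      LinearMap.ker (ρ.dTdot v.toTangent).toLinearMap := by
    have : FiniteDimensional ℝ v.Tan := inferInstanceAs (FiniteDimensional ℝ (JetModel E))
    refine Submodule.eq_of_le_of_finrank_eq ?_ ?_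
    · rintro _ ⟨w, rfl⟩
      exact dTdot_dTan v w
    · rw [LinearMap.finrank_range_of_inj (dTan_injective v), finrank_ker_dTdot]
      rfl
  have h2 : c ∈ LinearMap.ker (ρ.dTdot v.toTangent).toLinearMap := hc
  rw [← h1] at h2
  exact h2

/-- The inclusion of the vertical space into the tangent space. -/
noncomputable def vertIncl (v : ρ.Jet) : ρ.vert v.base →L[ℝ] TangentSpace I v.toTangent.1 :=
  (ρ.vert v.base).subtypeL

lemma contMDiff_translate (v : ρ.Jet) :
    ContMDiff 𝓘(ℝ, ρ.vert v.base) 𝓘(ℝ, JetModel E) ∞ (translate v) := fun s => by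
  apply contMDiffAt_of_toTangent
  exact (contMDiff_fibre_affine (V := ρ.vert v.base) (I := I) v.toTangent
    (ℓ := vertIncl v) (f := fun s => v.toTangent.2 + vertIncl v s)
    fun s => rfl).contMDiffAt

lemma translate_zero (v : ρ.Jet) : translate v 0 = v := by
  apply Subtype.ext
  change (⟨v.base, (v.vec + (0 : ρ.vert v.base).1 : E)⟩ : TangentBundle I N) = v.toTangent
  rw [Submodule.coe_zero, add_zero]
  rfl

lemma dTan_verticalLift (v : ρ.Jet) (u : ρ.vert v.base) : dTan v (verticalLift v u) = (0, u.1) := by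
  have h1 := mfderiv_comp_apply (I := 𝓘(ℝ, ρ.vert v.base)) (I' := 𝓘(ℝ, JetModel E))
    (I'' := I.tangent) (0 : ρ.vert v.base) (f := translate v) (g := toTangent)
    (mdifferentiableAt_toTangent _) ((contMDiff_translate v).mdifferentiableAt (by simp)) u
  have h2 := mfderiv_fibre_affine (V := ρ.vert v.base) (I := I) v.toTangent
    (ℓ := vertIncl v) (f := fun s => v.toTangent.2 + vertIncl v s)
    (fun s => rfl) 0 u
  have h6 : (trivializationAt E (TangentSpace I) v.toTangent.proj).continuousLinearMapAt ℝ
      v.toTangent.proj u.1 = u.1 := by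
    rw [continuousLinearMapAt_tangent_self]; rfl
  have h3 : dTan (translate v 0) (verticalLift v u) = (0, u.1) := by
    refine (h1.symm.trans h2).trans ?_
    exact Prod.ext rfl h6
  -- The chain rule produces the differential at `translate v 0`, which equals v only
  -- propositionally; the equality is transported with all tangent spaces read as the model space.
  have h4 : ∀ v' : ρ.Jet, v' = v →
      (dTan v' : JetModel E →L[ℝ] E × E) = (dTan v : JetModel E →L[ℝ] E × E) := by
    rintro _ rfl; rfl
  have h5 := h4 _ (translate_zero v)
  exact (congrArg (fun l : JetModel E →L[ℝ] E × E => l (verticalLift v u)) h5).symm.trans h3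

lemma dBase_verticalLift (v : ρ.Jet) (u : ρ.vert v.base) : dBase v (verticalLift v u) = 0 := by
  rw [← dTan_fst, dTan_verticalLift]

lemma dt_verticalLift (v : ρ.Jet) (u : ρ.vert v.base) : dt v (verticalLift v u) = 0 := by
  rw [dt_apply, dBase_verticalLift, map_zero]

lemma exists_verticalLift_eq (v : ρ.Jet) {w : v.Tan} (hw : dBase v w = 0) :
    ∃ u : ρ.vert v.base, verticalLift v u = w := by
  have h1 : dTan v w = (0, (dTan v w).2) := Prod.ext ((dTan_fst v w).trans hw) rfl
  have h2 : ρ.dAt v.base (dTan v w).2 = 0 := by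
    have := dTdot_dTan v w
    rw [h1, dTdot_vertical] at this
    exact this
  refine ⟨⟨(dTan v w).2, h2⟩, dTan_injective v ?_⟩
  rw [dTan_verticalLift]
  exact h1.symm

lemma exists_dBase_eq (v : ρ.Jet) (a : E) : ∃ w : v.Tan, dBase v w = a := by
  have h0 : ρ.dTdot v.toTangent (0, v.vec) = 1 := (dTdot_vertical _ _).trans v.dAt_vec
  -- Since dṫ(0, v) = 1, subtracting dṫ(a, 0) times (0, v) moves (a, 0) into the kernel of dṫ
  -- without changing its base component.
  obtain ⟨w, hw⟩ := exists_dTan_eq v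
    (c := (a, 0) - ρ.dTdot v.toTangent (a, 0) • ((0 : E), (v.vec : E))) (by
    rw [map_sub, map_smul, h0, smul_eq_mul, mul_one, sub_self])
  refine ⟨w, ?_⟩
  rw [← dTan_fst, hw]
  simp

end Jet

end JetCalculus

end TimeFibration

/-! ### The Poincaré–Cartan form in coordinates and the fibre Hessian. -/

namespace TimeFibration

section CartanForm

variable {E : Type*} [NormedAddCommGroup E] [NormedSpace ℝ E] [FiniteDimensional ℝ E]
  {H : Type*} [TopologicalSpace H] {I : ModelWithCorners ℝ E H} [I.Boundaryless]
  {N : Type*} [TopologicalSpace N] [ChartedSpace H N] [IsManifold I ∞ N]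
  {ρ : TimeFibration I N}

/-- The differential of the time function in the preferred chart at `q`. -/
noncomputable def localTime (ρ : TimeFibration I N) (q : N) (x : E) : E →L[ℝ] ℝ :=
  fderiv ℝ (ρ.toFun ∘ (extChartAt I q).symm) x

lemma contDiffAt_localTime (ρ : TimeFibration I N) {q : N} {x : E}
    (hx : x ∈ (extChartAt I q).target) : ContDiffAt ℝ ∞ (ρ.localTime q) x := by
  have h1 : ContMDiffAt 𝓘(ℝ, E) 𝓘(ℝ, ℝ) ∞ (ρ.toFun ∘ (extChartAt I q).symm) x :=
    ρ.smooth.contMDiffAt.comp x (contMDiffAt_extChartAt_symm_of_mem hx)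
  exact h1.contDiffAt.fderiv_right (by simp)

lemma mfderiv_eq_fderiv_comp_mfderiv_extChartAt {V : Type*} [NormedAddCommGroup V]
    [NormedSpace ℝ V] {f : N → V} {q q' : N}
    (hq : q' ∈ (extChartAt I q).source) (hf : MDifferentiableAt I 𝓘(ℝ, V) f q')
    (a : TangentSpace I q') :
    (mfderiv I 𝓘(ℝ, V) f q' a : V) = fderiv ℝ (f ∘ (extChartAt I q).symm) (extChartAt I q q')
      (mfderiv I 𝓘(ℝ, E) (extChartAt I q) q' a : E) := by
  have h0 : (extChartAt I q).symm (extChartAt I q q') = q' := (extChartAt I q).left_inv hq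
  have h1 : MDifferentiableAt 𝓘(ℝ, E) 𝓘(ℝ, V) (f ∘ (extChartAt I q).symm)
      (extChartAt I q q') := by
    refine MDifferentiableAt.comp (extChartAt I q q') (I' := I) ?_
      ((contMDiffAt_extChartAt_symm_of_mem ((extChartAt I q).map_source hq)).mdifferentiableAt
        (n := ∞) (by simp))
    rw [h0]; exact hf
  have h2 := mfderiv_comp_apply (I'' := 𝓘(ℝ, V)) q' h1
    ((contMDiffAt_extChartAt_of_mem (I := I) hq).mdifferentiableAt (by simp)) a
  have h3 : f =ᶠ[𝓝 q'] ((f ∘ (extChartAt I q).symm) ∘ extChartAt I q) := by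
    filter_upwards [(isOpen_extChartAt_source q).mem_nhds hq] with z hz
    simp only [Function.comp_apply, (extChartAt I q).left_inv hz]
  have h4 := h3.mfderiv_eq (I := I) (I' := 𝓘(ℝ, V))
  rw [mfderiv_eq_fderiv] at h2
  exact (congrArg (fun l : E →L[ℝ] V => l a) h4).trans h2

lemma dAt_eq_localTime (ρ : TimeFibration I N) {q q' : N} (hq : q' ∈ (extChartAt I q).source)
    (a : E) : ρ.dAt q' a = ρ.localTime q (extChartAt I q q')
      (mfderiv I 𝓘(ℝ, E) (extChartAt I q) q' a : E) :=
  mfderiv_eq_fderiv_comp_mfderiv_extChartAt hq (ρ.smooth.mdifferentiableAt (by simp)) a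

namespace Jet

/-- The preferred tangent chart at `v₀`, restricted to jets. -/
noncomputable def coord (v₀ v : ρ.Jet) : E × E := extChartAt I.tangent v₀.toTangent v.toTangent

lemma coord_eq {v₀ v : ρ.Jet} (hv : v.base ∈ (extChartAt I v₀.base).source) :
    coord v₀ v = (extChartAt I v₀.base v.base,
      (mfderiv I 𝓘(ℝ, E) (extChartAt I v₀.base) v.base v.vec : E)) := by
  rw [extChartAt_source] at hv
  rw [coord, extChartAt_totalSpace_apply (I := I) v₀.toTangent (y := v.toTangent) hv]
  exact Prod.ext rfl (fibreCoord_tangent hv v.vec)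

lemma toTangent_mem_source {v₀ v : ρ.Jet} (hv : v.base ∈ (extChartAt I v₀.base).source) :
    v.toTangent ∈ (extChartAt I.tangent v₀.toTangent).source :=
  mem_source_extChartAt_totalSpace.2 ⟨by rw [extChartAt_source] at hv; exact hv, hv⟩

lemma eventually_base_mem (v₀ : ρ.Jet) :
    ∀ᶠ v : ρ.Jet in 𝓝 v₀, v.base ∈ (extChartAt I v₀.base).source :=
  contMDiff_base.continuous.continuousAt.eventually
    ((isOpen_extChartAt_source v₀.base).mem_nhds (mem_extChartAt_source _))

lemma contMDiffAt_coord {v₀ v : ρ.Jet} (hv : v.base ∈ (extChartAt I v₀.base).source) :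
    ContMDiffAt 𝓘(ℝ, JetModel E) 𝓘(ℝ, E × E) ∞ (coord v₀) v :=
  (contMDiffAt_extChartAt_of_mem (I := I.tangent) (toTangent_mem_source hv)).comp v
    contMDiff_toTangent.contMDiffAt

/-- The differential of the preferred tangent chart at `v₀`, restricted to jets. -/
noncomputable def dCoord (v₀ v : ρ.Jet) : v.Tan →L[ℝ] E × E :=
  mfderiv 𝓘(ℝ, JetModel E) 𝓘(ℝ, E × E) (coord v₀) v

lemma dCoord_self (v : ρ.Jet) (w : v.Tan) :
    dCoord v v w = dTan v w := by
  have h := mfderiv_comp_apply v (I := 𝓘(ℝ, JetModel E)) (I' := I.tangent) (I'' := 𝓘(ℝ, E × E))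
    (f := toTangent) (g := extChartAt I.tangent v.toTangent)
    ((contMDiffAt_extChartAt (n := ∞)).mdifferentiableAt (by simp))
    (mdifferentiableAt_toTangent v) w
  have e : mfderiv I.tangent 𝓘(ℝ, E × E) (extChartAt I.tangent v.toTangent) v.toTangent =
    ContinuousLinearMap.id ℝ (E × E) := mfderiv_extChartAt_self
  rw [e] at h
  exact h

lemma dCoord_fst {v₀ v : ρ.Jet} (hv : v.base ∈ (extChartAt I v₀.base).source)
    (w : v.Tan) :
    (dCoord v₀ v w).1 =
      (mfderiv I 𝓘(ℝ, E) (extChartAt I v₀.base) v.base (dBase v w) : E) := by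
  have h1 : (Prod.fst ∘ coord v₀ : ρ.Jet → E) =ᶠ[𝓝 v] extChartAt I v₀.base ∘ base := by
    filter_upwards [contMDiff_base.continuous.continuousAt.eventually
      ((isOpen_extChartAt_source v₀.base).mem_nhds hv)] with z hz
    rw [Function.comp_apply, coord_eq hz, Function.comp_apply]
  have h2 := mfderiv_comp_apply v (I := 𝓘(ℝ, JetModel E)) (I' := I) (I'' := 𝓘(ℝ, E))
    (f := base) (g := extChartAt I v₀.base)
    ((contMDiffAt_extChartAt_of_mem (I := I) hv).mdifferentiableAt (by simp))
    (contMDiff_base.mdifferentiableAt (by simp)) w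
  have h3 := mfderiv_comp_apply v (I := 𝓘(ℝ, JetModel E)) (I' := 𝓘(ℝ, E × E)) (I'' := 𝓘(ℝ, E))
    (f := coord v₀) (g := Prod.fst)
    (contDiff_fst.contMDiff.mdifferentiableAt (n := ∞) (by simp))
    ((contMDiffAt_coord hv).mdifferentiableAt (by simp)) w
  have e3 : mfderiv 𝓘(ℝ, E × E) 𝓘(ℝ, E) Prod.fst (coord v₀ v) =
    ContinuousLinearMap.fst ℝ E E := mfderiv_eq_fderiv.trans fderiv_fst
  rw [h1.mfderiv_eq, e3] at h3
  exact h3.symm.trans h2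

lemma dt_eq_localTime {v₀ v : ρ.Jet} (hv : v.base ∈ (extChartAt I v₀.base).source)
    (w : v.Tan) : dt v w = ρ.localTime v₀.base (coord v₀ v).1
      (dCoord v₀ v w).1 := by
  rw [dt_apply, dAt_eq_localTime ρ hv, dCoord_fst hv, coord_eq hv]

/-- A Lagrangian in the preferred tangent chart at `v₀`, extended by homogeneity. -/
noncomputable def localLagrangian (L : ρ.Jet → ℝ) (v₀ : ρ.Jet) (y : E × E) : ℝ :=
  L (normalize v₀ ((extChartAt I.tangent v₀.toTangent).symm y))

lemma contDiffAt_localLagrangian {L : ρ.Jet → ℝ} (hL : ContMDiff 𝓘(ℝ, JetModel E) 𝓘(ℝ, ℝ) ∞ L)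
    {v₀ v : ρ.Jet} (hv : v.base ∈ (extChartAt I v₀.base).source) :
    ContDiffAt ℝ ∞ (localLagrangian L v₀) (coord v₀ v) := by
  have hs := toTangent_mem_source hv
  have h0 : (extChartAt I.tangent v₀.toTangent).symm (coord v₀ v) = v.toTangent :=
    (extChartAt I.tangent v₀.toTangent).left_inv hs
  have h1 : ρ.tdot v.toTangent ≠ 0 := by
    rw [show ρ.tdot v.toTangent = 1 from v.2]; exact one_ne_zero
  have h2 : ContMDiffAt 𝓘(ℝ, E × E) I.tangent ∞ (extChartAt I.tangent v₀.toTangent).symm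
    (coord v₀ v) := contMDiffAt_extChartAt_symm_of_mem (PartialEquiv.map_source _ hs)
  have h3 : ContMDiffAt I.tangent 𝓘(ℝ, ℝ) ∞ (L ∘ normalize v₀)
      ((extChartAt I.tangent v₀.toTangent).symm (coord v₀ v)) := by
    rw [h0]
    exact hL.contMDiffAt.comp _ (contMDiffAt_normalize v₀ h1)
  exact (h3.comp _ h2).contDiffAt

/-- The differential of the preferred chart at `v₀`, on vertical vectors at `v`. -/
noncomputable def vertCoord (v₀ v : ρ.Jet) : ρ.vert v.base →L[ℝ] E :=
  ContinuousLinearMap.comp (mfderiv I 𝓘(ℝ, E) (extChartAt I v₀.base) v.base : E →L[ℝ] E)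
    (ρ.vert v.base).subtypeL

/-- In tangent coordinates, translation along a jet fibre is an affine shift of the velocity
component, so fibre derivatives of L become derivatives of `localLagrangian` along the second
factor. -/
lemma comp_translate_eq (L : ρ.Jet → ℝ) {v₀ v : ρ.Jet}
    (hv : v.base ∈ (extChartAt I v₀.base).source) :
    L ∘ translate v = fun z => localLagrangian L v₀ (coord v₀ v + (0, vertCoord v₀ v z)) := by
  funext z
  have hz : (translate v z).base ∈ (extChartAt I v₀.base).source := hv
  have h1 : coord v₀ v + (0, vertCoord v₀ v z) = coord v₀ (translate v z) := by
    rw [coord_eq hv, coord_eq hz]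
    refine Prod.ext (add_zero _) ?_
    exact (map_add (mfderiv I 𝓘(ℝ, E) (extChartAt I v₀.base) v.base : E →L[ℝ] E) v.vec z.1).symm
  rw [h1, localLagrangian, coord, PartialEquiv.left_inv _ (toTangent_mem_source hz),
    normalize_of_tdot_eq_one]
  rfl

lemma hasFDerivAt_comp_add {V W X : Type*} [NormedAddCommGroup V] [NormedSpace ℝ V]
    [NormedAddCommGroup W] [NormedSpace ℝ W] [NormedAddCommGroup X] [NormedSpace ℝ X] {g : W → X}
    {p : W} {A : V →L[ℝ] W} {z : V} (hg : DifferentiableAt ℝ g (p + A z)) :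
    HasFDerivAt (fun z => g (p + A z)) ((fderiv ℝ g (p + A z)).comp A) z :=
  hg.hasFDerivAt.comp z (f := fun z => p + A z) (A.hasFDerivAt.const_add p)

lemma differential_verticalLift {L : ρ.Jet → ℝ} (hL : ContMDiff 𝓘(ℝ, JetModel E) 𝓘(ℝ, ℝ) ∞ L)
    (v : ρ.Jet) (z : ρ.vert v.base) :
    differential L v (verticalLift v z) = fderiv ℝ (L ∘ translate v) 0 z := by
  have h0 : MDifferentiableAt 𝓘(ℝ, JetModel E) 𝓘(ℝ, ℝ) L (translate v 0) :=
    hL.mdifferentiableAt (by simp)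
  have h1 := mfderiv_comp_apply (I := 𝓘(ℝ, ρ.vert v.base)) (I' := 𝓘(ℝ, JetModel E))
    (I'' := 𝓘(ℝ, ℝ)) (0 : ρ.vert v.base) (f := translate v) (g := L) h0
    ((contMDiff_translate v).mdifferentiableAt (by simp)) z
  rw [mfderiv_eq_fderiv] at h1
  refine Eq.trans ?_ h1.symm
  have h4 : ∀ v' : ρ.Jet, v' = v →
      (mfderiv 𝓘(ℝ, JetModel E) 𝓘(ℝ, ℝ) L v : JetModel E →L[ℝ] ℝ) =
        mfderiv 𝓘(ℝ, JetModel E) 𝓘(ℝ, ℝ) L v' := by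
    rintro _ rfl; rfl
  exact congrArg (fun l : JetModel E →L[ℝ] ℝ => l (verticalLift v z)) (h4 _ (translate_zero v))

lemma fderiv_comp_translate {L : ρ.Jet → ℝ} (hL : ContMDiff 𝓘(ℝ, JetModel E) 𝓘(ℝ, ℝ) ∞ L)
    {v₀ v : ρ.Jet} (hv : v.base ∈ (extChartAt I v₀.base).source) (z : ρ.vert v.base) :
    fderiv ℝ (L ∘ translate v) 0 z =
      fderiv ℝ (localLagrangian L v₀) (coord v₀ v) (0, vertCoord v₀ v z) := by
  rw [comp_translate_eq L hv]
  have h := hasFDerivAt_comp_add (p := coord v₀ v) (A := ContinuousLinearMap.inr ℝ E E ∘L vertCoord v₀ v)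
    (z := 0) (g := localLagrangian L v₀) (by
      rw [map_zero, add_zero]
      exact (contDiffAt_localLagrangian hL hv).differentiableAt (by simp))
  rw [map_zero, add_zero] at h
  exact congrArg (fun l : ρ.vert v.base →L[ℝ] ℝ => l z) h.fderiv

/-- The covector field whose pull-back to the jet bundle is the Poincaré–Cartan form. -/
noncomputable def localCartan (L : ρ.Jet → ℝ) (v₀ : ρ.Jet) (y : E × E) : E × E →L[ℝ] ℝ :=
  localLagrangian L v₀ y • (ρ.localTime v₀.base y.1).comp (ContinuousLinearMap.fst ℝ E E) +
    (fderiv ℝ (localLagrangian L v₀) y).comp ((ContinuousLinearMap.inr ℝ E E).comp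
      (ContinuousLinearMap.fst ℝ E E -
        ((ρ.localTime v₀.base y.1).comp (ContinuousLinearMap.fst ℝ E E)).smulRight y.2))

lemma localCartan_apply (L : ρ.Jet → ℝ) (v₀ : ρ.Jet) (y c : E × E) :
    localCartan L v₀ y c = localLagrangian L v₀ y * ρ.localTime v₀.base y.1 c.1 +
      fderiv ℝ (localLagrangian L v₀) y (0, c.1 - ρ.localTime v₀.base y.1 c.1 • y.2) := by
  change localLagrangian L v₀ y * _ + fderiv ℝ (localLagrangian L v₀) y (0, _) = _
  rfl

lemma contDiffAt_localCartan {L : ρ.Jet → ℝ} (hL : ContMDiff 𝓘(ℝ, JetModel E) 𝓘(ℝ, ℝ) ∞ L)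
    (v₀ : ρ.Jet) : ContDiffAt ℝ ∞ (localCartan L v₀) (coord v₀ v₀) := by
  have hv : v₀.base ∈ (extChartAt I v₀.base).source := mem_extChartAt_source _
  have h1 := contDiffAt_localLagrangian hL hv
  have h2 : ContDiffAt ℝ ∞ (fderiv ℝ (localLagrangian L v₀)) (coord v₀ v₀) :=
    h1.fderiv_right (by simp)
  have h3 : ContDiffAt ℝ ∞ (fun y : E × E => ρ.localTime v₀.base y.1) (coord v₀ v₀) := by
    refine ContDiffAt.comp (g := ρ.localTime v₀.base) _ ?_ contDiffAt_fst
    rw [coord_eq hv]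
    exact contDiffAt_localTime ρ (mem_extChartAt_target _)
  have h4 := h3.clm_comp (contDiffAt_const (c := ContinuousLinearMap.fst ℝ E E))
  exact (h1.smul h4).add (h2.clm_comp (contDiffAt_const.clm_comp
    (contDiffAt_const.sub (h4.smulRight contDiffAt_snd))))

/-- The map `coord v₀` embeds nearby jets as a hypersurface of E × E. Writing θ_L as the restriction
of a covector field defined in that ambient space reduces its exterior derivative to ordinary
derivatives on a vector space. -/
lemma cartanForm_eq_pullback {L : ρ.Jet → ℝ} (hL : ContMDiff 𝓘(ℝ, JetModel E) 𝓘(ℝ, ℝ) ∞ L)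
    {v₀ v : ρ.Jet} (hv : v.base ∈ (extChartAt I v₀.base).source) :
    cartanForm L v = DForm.pullback 𝓘(ℝ, JetModel E) (coord v₀)
      (DForm.ofModel (localCartan L v₀)) v := by
  ext u
  have hd := dt_eq_localTime hv (u 0)
  have hL' : localLagrangian L v₀ (coord v₀ v) = L v := by
    rw [localLagrangian, coord, PartialEquiv.left_inv _ (toTangent_mem_source hv),
      normalize_of_tdot_eq_one]
  change L v * dt v (u 0) + differential L v (verticalLift v (contact v (u 0))) =
    localCartan L v₀ (coord v₀ v) (dCoord v₀ v (u 0))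
  rw [localCartan_apply, differential_verticalLift hL, fderiv_comp_translate hL hv, hL', ← hd]
  congr 3
  rw [dCoord_fst hv, coord_eq hv]
  have key : ∀ (l : E →L[ℝ] E) (x y : E) (c : ℝ), l (x - c • y) = l x - c • l y :=
    fun l x y c => by rw [map_sub, map_smul]
  exact key _ _ _ _

lemma smoothAt_cartanForm {L : ρ.Jet → ℝ} (hL : ContMDiff 𝓘(ℝ, JetModel E) 𝓘(ℝ, ℝ) ∞ L)
    (v : ρ.Jet) : (cartanForm L).SmoothAt v := by
  refine DForm.SmoothAt.congr (DForm.smoothAt_pullback_one (g := coord v)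
    (contMDiffAt_coord (mem_extChartAt_source _))
    (DForm.ofModel_smoothAt (contDiffAt_localCartan hL v))) ?_
  filter_upwards [eventually_base_mem v] with z hz
  exact cartanForm_eq_pullback hL hz

lemma smoothAt_lagrangianForm {L : ρ.Jet → ℝ} (hL : ContMDiff 𝓘(ℝ, JetModel E) 𝓘(ℝ, ℝ) ∞ L)
    (v : ρ.Jet) : (lagrangianForm L).SmoothAt v :=
  (DForm.smoothAt_d (smoothAt_cartanForm hL) v).neg

lemma d_lagrangianForm {L : ρ.Jet → ℝ} (hL : ContMDiff 𝓘(ℝ, JetModel E) 𝓘(ℝ, ℝ) ∞ L)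
    (v : ρ.Jet) : (lagrangianForm L).d v = 0 :=
  DForm.d_neg_eq_zero (DForm.d_d (smoothAt_cartanForm hL) v)

/-- Naturality of d moves the computation to `localCartan`; the minus sign in ω_L = -dθ_L reverses
the order of the two terms. -/
lemma lagrangianForm_apply {L : ρ.Jet → ℝ} (hL : ContMDiff 𝓘(ℝ, JetModel E) 𝓘(ℝ, ℝ) ∞ L)
    (v : ρ.Jet) (w w' : v.Tan) : lagrangianForm L v ![w, w'] =
      fderiv ℝ (localCartan L v) (coord v v) (dTan v w') (dTan v w) -
        fderiv ℝ (localCartan L v) (coord v v) (dTan v w) (dTan v w') := by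
  have h1 : (cartanForm L).d v = DForm.pullback 𝓘(ℝ, JetModel E) (coord v)
      (DForm.ofModel (localCartan L v)).d v := by
    rw [← DForm.d_pullback (contMDiffAt_coord (mem_extChartAt_source _))
      (DForm.ofModel_smoothAt (contDiffAt_localCartan hL v))]
    refine DForm.d_congr ?_
    filter_upwards [eventually_base_mem v] with z hz
    exact cartanForm_eq_pullback hL hz
  have h2 : DForm.pullback 𝓘(ℝ, JetModel E) (coord v) (DForm.ofModel (localCartan L v)).d v ![w, w']
      = (DForm.ofModel (localCartan L v)).d (coord v v) ![dTan v w, dTan v w'] := by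
    rw [← dCoord_self, ← dCoord_self]
    change (DForm.ofModel (localCartan L v)).d (coord v v) (fun i => _) = _
    congr 1
    funext i
    fin_cases i <;> rfl
  change -((cartanForm L).d v ![w, w']) = _
  rw [h1, h2, DForm.d_ofModel ((contDiffAt_localCartan hL v).differentiableAt (by simp)), neg_sub]

/-- The Hessian of a Lagrangian along the fibres of the jet bundle. -/
noncomputable def fibreHessian (L : ρ.Jet → ℝ) (v : ρ.Jet) (u u' : ρ.vert v.base) : ℝ :=
  fderiv ℝ (fderiv ℝ (L ∘ translate v)) 0 u u'

lemma coord_translate {v₀ v : ρ.Jet} (hv : v.base ∈ (extChartAt I v₀.base).source)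
    (z : ρ.vert v.base) : coord v₀ (translate v z) = coord v₀ v + (0, vertCoord v₀ v z) := by
  have hz : (translate v z).base ∈ (extChartAt I v₀.base).source := hv
  rw [coord_eq hv, coord_eq hz]
  refine (Prod.ext (add_zero _) ?_).symm
  exact (map_add (mfderiv I 𝓘(ℝ, E) (extChartAt I v₀.base) v.base : E →L[ℝ] E) v.vec z.1).symm

lemma vertCoord_self (v : ρ.Jet) (z : ρ.vert v.base) : vertCoord v v z = z.1 := by
  have h : mfderiv I 𝓘(ℝ, E) (extChartAt I v.base) v.base = ContinuousLinearMap.id ℝ E :=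
    mfderiv_extChartAt_self
  rw [vertCoord, h]; rfl

lemma fibreHessian_eq {L : ρ.Jet → ℝ} (hL : ContMDiff 𝓘(ℝ, JetModel E) 𝓘(ℝ, ℝ) ∞ L)
    (v : ρ.Jet) (u u' : ρ.vert v.base) : fibreHessian L v u u' =
      fderiv ℝ (fderiv ℝ (localLagrangian L v)) (coord v v) (0, u.1) (0, u'.1) := by
  have hv : v.base ∈ (extChartAt I v.base).source := mem_extChartAt_source _
  let A := ContinuousLinearMap.inr ℝ E E ∘L vertCoord v v
  have h1 : fderiv ℝ (L ∘ translate v) =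
      fun z => (fderiv ℝ (localLagrangian L v) (coord v v + A z)).comp A := by
    funext z
    rw [comp_translate_eq L hv]
    refine (hasFDerivAt_comp_add (p := coord v v) (A := A) (z := z) ?_).fderiv
    have h2 : coord v v + A z = coord v (translate v z) := (coord_translate hv z).symm
    rw [h2]
    exact (contDiffAt_localLagrangian hL (v₀ := v) (v := translate v z) hv).differentiableAt
      (by simp)
  have h3 : DifferentiableAt ℝ (fderiv ℝ (localLagrangian L v)) (coord v v) :=
    ((contDiffAt_localLagrangian hL hv).fderiv_right (m := ∞) (by simp)).differentiableAt (by simp)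
  have h4 := hasFDerivAt_comp_add (p := coord v v) (A := A) (z := 0)
    (g := fderiv ℝ (localLagrangian L v)) (by rwa [map_zero, add_zero])
  rw [map_zero, add_zero] at h4
  have h5 := (h4.clm_comp (hasFDerivAt_const A (0 : ρ.vert v.base))).fderiv
  rw [fibreHessian, h1, h5]
  have hA : ∀ z, A z = (0, z.1) := fun z => Prod.ext rfl (vertCoord_self v z)
  simp [hA]

/-- Moving in the direction (0, b) keeps the base point fixed, and the dt-terms vanish on a vector a
with vertical base part. What is differentiated is therefore only the fibre derivative of L in the
direction a.1. -/
lemma fderiv_localCartan_verticalLift {L : ρ.Jet → ℝ}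
    (hL : ContMDiff 𝓘(ℝ, JetModel E) 𝓘(ℝ, ℝ) ∞ L) (v : ρ.Jet) (b : E) (a : E × E)
    (ha : ρ.dAt v.base a.1 = 0) :
    fderiv ℝ (localCartan L v) (coord v v) (0, b) a =
      fderiv ℝ (fderiv ℝ (localLagrangian L v)) (coord v v) (0, b) (0, a.1) := by
  have hv : v.base ∈ (extChartAt I v.base).source := mem_extChartAt_source _
  let γ : ℝ → E × E := fun s => coord v v + s • ((0 : E), b)
  have hγ : HasDerivAt γ (0, b) 0 := by
    have h := ((hasDerivAt_id (0 : ℝ)).smul_const ((0 : E), b)).const_add (coord v v)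
    rwa [one_smul] at h
  have hγ0 : γ 0 = coord v v := by simp [γ]
  have h1 : HasFDerivAt (localCartan L v) (fderiv ℝ (localCartan L v) (coord v v)) (γ 0) := by
    rw [hγ0]
    exact ((contDiffAt_localCartan hL v).differentiableAt (by simp)).hasFDerivAt
  have h2 : HasFDerivAt (fderiv ℝ (localLagrangian L v))
      (fderiv ℝ (fderiv ℝ (localLagrangian L v)) (coord v v)) (γ 0) := by
    rw [hγ0]
    exact (((contDiffAt_localLagrangian hL hv).fderiv_right (m := ∞)
      (by simp)).differentiableAt (by simp)).hasFDerivAt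
  have h3 := (h1.comp_hasDerivAt 0 hγ).clm_apply (hasDerivAt_const (0 : ℝ) a)
  have h4 := (h2.comp_hasDerivAt 0 hγ).clm_apply (hasDerivAt_const (0 : ℝ) ((0 : E), a.1))
  have h5 : ρ.localTime v.base (coord v v).1 a.1 = 0 := by
    have := dAt_eq_localTime ρ hv a.1
    have h : mfderiv I 𝓘(ℝ, E) (extChartAt I v.base) v.base = ContinuousLinearMap.id ℝ E :=
      mfderiv_extChartAt_self
    rw [ha, h] at this
    rw [coord_eq hv]
    exact this.symm
  have h6 : (fun s => (localCartan L v ∘ γ) s a) =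
      fun s => (fderiv ℝ (localLagrangian L v) ∘ γ) s (0, a.1) := by
    funext s
    have h7 : (γ s).1 = (coord v v).1 := by simp [γ]
    simp only [Function.comp_apply, localCartan_apply, h7, h5]
    simp
  rw [h6] at h3
  simpa using h3.unique h4

/-- The Lagrangian 2-form along the fibres is the Hessian. -/
lemma lagrangianForm_verticalLift {L : ρ.Jet → ℝ}
    (hL : ContMDiff 𝓘(ℝ, JetModel E) 𝓘(ℝ, ℝ) ∞ L) (v : ρ.Jet) (u u' : ρ.vert v.base) {w : v.Tan}
    (hw : dBase v w = u'.1) :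
    lagrangianForm L v ![verticalLift v u, w] = -fibreHessian L v u u' := by
  have h0 : (dTan v w).1 = u'.1 := (dTan_fst v w).trans hw
  have hd : DifferentiableAt ℝ (localCartan L v) (coord v v) :=
    (contDiffAt_localCartan hL v).differentiableAt (by simp)
  -- θ_L is semibasic: it vanishes identically on vectors (0, u), so only one of the two terms of
  -- dθ_L survives.
  have h1 : fderiv ℝ (localCartan L v) (coord v v) (dTan v w) (0, u.1) = 0 := by
    have h2 : (fun y => localCartan L v y (0, u.1)) = fun _ => 0 := by
      funext y
      rw [localCartan_apply, map_zero, mul_zero, zero_smul, sub_zero, zero_add]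
      exact map_zero _
    have h3 := fderiv_clm_apply hd (differentiableAt_const ((0 : E), u.1))
    rw [h2] at h3
    have := congrArg (fun l : E × E →L[ℝ] ℝ => l (dTan v w)) h3
    simpa using this.symm
  rw [lagrangianForm_apply hL, dTan_verticalLift, h1,
    fderiv_localCartan_verticalLift hL v u.1 _ (by rw [h0]; exact u'.2), h0,
    ← fibreHessian_eq hL, zero_sub]

end Jet

end CartanForm

end TimeFibration

/-! ### Closedness of dt, jet prolongation and naturality of the Poincaré–Cartan form. -/

namespace TimeFibration

section Prolongation

variable {E : Type*} [NormedAddCommGroup E] [NormedSpace ℝ E] [FiniteDimensional ℝ E]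
  {H : Type*} [TopologicalSpace H] {I : ModelWithCorners ℝ E H} [I.Boundaryless]
  {N : Type*} [TopologicalSpace N] [ChartedSpace H N] [IsManifold I ∞ N]
  {ρ : TimeFibration I N}
  {E' : Type*} [NormedAddCommGroup E'] [NormedSpace ℝ E'] [FiniteDimensional ℝ E']
  {H' : Type*} [TopologicalSpace H'] {I' : ModelWithCorners ℝ E' H'} [I'.Boundaryless]
  {N' : Type*} [TopologicalSpace N'] [ChartedSpace H' N'] [IsManifold I' ∞ N']
  {ρ' : TimeFibration I' N'}

lemma contMDiff_time (ρ : TimeFibration I N) :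
    ContMDiff 𝓘(ℝ, JetModel E) 𝓘(ℝ, ℝ) ∞ (fun w : ρ.Jet => ρ.toFun w.base) :=
  ρ.smooth.comp Jet.contMDiff_base

lemma smoothAt_timeForm (ρ : TimeFibration I N) (v : ρ.Jet) : (timeForm ρ).SmoothAt v :=
  DForm.smoothAt_pullback_one (Ω := DForm.ofModel fun _ : ℝ => ContinuousLinearMap.id ℝ ℝ)
    ρ.contMDiff_time.contMDiffAt (DForm.ofModel_smoothAt contDiffAt_const)

lemma d_timeForm (ρ : TimeFibration I N) (v : ρ.Jet) : (timeForm ρ).d v = 0 := by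
  have h1 : timeForm ρ = DForm.pullback 𝓘(ℝ, JetModel E) (fun w : ρ.Jet => ρ.toFun w.base)
      (DForm.ofModel fun _ : ℝ => ContinuousLinearMap.id ℝ ℝ) := rfl
  rw [h1, DForm.d_pullback ρ.contMDiff_time.contMDiffAt (DForm.ofModel_smoothAt contDiffAt_const)]
  have h2 : ∀ t : ℝ, (DForm.ofModel fun _ : ℝ => ContinuousLinearMap.id ℝ ℝ).d t = 0 := by
    intro t
    rw [DForm.d_model]
    have : extDeriv (fun _ : ℝ => ContinuousAlternatingMap.ofSubsingleton ℝ ℝ ℝ (0 : Fin 1)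
        (ContinuousLinearMap.id ℝ ℝ)) t = 0 := by
      rw [extDeriv, fderiv_fun_const]
      exact map_zero (ContinuousAlternatingMap.alternatizeUncurryFinCLM ℝ ℝ ℝ)
    exact this
  rw [DForm.pullback, h2]
  rfl

variable {Φ : N → N'}

lemma dAt_mfderiv (hΦ : ContMDiff I I' ∞ Φ) (h : ∀ q, ρ'.toFun (Φ q) = ρ.toFun q) (q : N)
    (a : TangentSpace I q) : ρ'.dAt (Φ q) (mfderiv I I' Φ q a : E') = ρ.dAt q a := by
  have h1 := mfderiv_comp_apply q (ρ'.smooth.mdifferentiableAt (x := Φ q) (by simp))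
    (hΦ.mdifferentiableAt (x := q) (by simp)) a
  have h2 : ρ'.toFun ∘ Φ = ρ.toFun := funext h
  rw [h2] at h1
  exact h1.symm

/-- The first jet prolongation of a bundle map over the time axis. -/
noncomputable def prolong (hΦ : ContMDiff I I' ∞ Φ) (h : ∀ q, ρ'.toFun (Φ q) = ρ.toFun q)
    (v : ρ.Jet) : ρ'.Jet :=
  ⟨⟨Φ v.base, mfderiv I I' Φ v.base v.vec⟩, (dAt_mfderiv hΦ h v.base v.vec).trans v.2⟩

variable (hΦ : ContMDiff I I' ∞ Φ) (h : ∀ q, ρ'.toFun (Φ q) = ρ.toFun q)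

lemma contMDiff_prolong :
    ContMDiff 𝓘(ℝ, JetModel E) 𝓘(ℝ, JetModel E') ∞ (prolong hΦ h) := fun v => by
  apply Jet.contMDiffAt_of_toTangent
  exact ((hΦ.contMDiff_tangentMap (m := ∞) (by simp)).comp Jet.contMDiff_toTangent).contMDiffAt

/-- The differential of the first jet prolongation. -/
noncomputable def dProlong (v : ρ.Jet) : v.Tan →L[ℝ] (prolong hΦ h v).Tan :=
  mfderiv 𝓘(ℝ, JetModel E) 𝓘(ℝ, JetModel E') (prolong hΦ h) v

lemma dBase_dProlong (v : ρ.Jet) (w : v.Tan) :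
    (prolong hΦ h v).dBase (dProlong hΦ h v w) = (mfderiv I I' Φ v.base (v.dBase w) : E') := by
  have h1 := mfderiv_comp_apply v (Jet.contMDiff_base.mdifferentiableAt (x := prolong hΦ h v)
    (by simp)) ((contMDiff_prolong hΦ h).mdifferentiableAt (x := v) (by simp)) w
  have h2 := mfderiv_comp_apply v (hΦ.mdifferentiableAt (x := v.base) (by simp))
    (Jet.contMDiff_base.mdifferentiableAt (x := v) (by simp)) w
  exact h1.symm.trans h2

lemma dt_dProlong (v : ρ.Jet) (w : v.Tan) :
    (prolong hΦ h v).dt (dProlong hΦ h v w) = v.dt w := by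
  rw [Jet.dt_apply, dBase_dProlong, Jet.dt_apply]
  exact dAt_mfderiv hΦ h v.base _

/-- The differential of a bundle map over the time axis, on vertical vectors. -/
noncomputable def vertMap (v : ρ.Jet) : ρ.vert v.base →L[ℝ] ρ'.vert (prolong hΦ h v).base :=
  (ContinuousLinearMap.comp (mfderiv I I' Φ v.base : E →L[ℝ] E')
    (ρ.vert v.base).subtypeL).codRestrict _ fun z => (dAt_mfderiv hΦ h v.base z.1).trans z.2

/-- TΦ is linear on tangent spaces, so the prolongation is affine along jet fibres. Differentiating
this shows that it respects vertical lifts. -/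
lemma prolong_translate (v : ρ.Jet) (z : ρ.vert v.base) :
    prolong hΦ h (v.translate z) = (prolong hΦ h v).translate (vertMap hΦ h v z) := by
  apply Subtype.ext
  have h1 : (mfderiv I I' Φ v.base : E →L[ℝ] E') (v.vec + z.1) =
    (mfderiv I I' Φ v.base : E →L[ℝ] E') v.vec + (mfderiv I I' Φ v.base : E →L[ℝ] E') z.1 :=
    map_add _ _ _
  exact congrArg (fun a => (⟨Φ v.base, a⟩ : TangentBundle I' N')) h1

lemma dProlong_verticalLift (v : ρ.Jet) (z : ρ.vert v.base) :
    dProlong hΦ h v (v.verticalLift z) = (prolong hΦ h v).verticalLift (vertMap hΦ h v z) := by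
  have h1 := mfderiv_comp_apply (I := 𝓘(ℝ, ρ.vert v.base)) (I' := 𝓘(ℝ, JetModel E))
    (I'' := 𝓘(ℝ, JetModel E')) (0 : ρ.vert v.base) (f := v.translate) (g := prolong hΦ h)
    ((contMDiff_prolong hΦ h).mdifferentiableAt (by simp))
    ((Jet.contMDiff_translate v).mdifferentiableAt (by simp)) z
  have h2 := mfderiv_comp_apply (I := 𝓘(ℝ, ρ.vert v.base))
    (I' := 𝓘(ℝ, ρ'.vert (prolong hΦ h v).base))
    (I'' := 𝓘(ℝ, JetModel E')) (0 : ρ.vert v.base) (f := vertMap hΦ h v)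
    (g := (prolong hΦ h v).translate)
    ((Jet.contMDiff_translate _).mdifferentiableAt (by simp))
    ((vertMap hΦ h v).contDiff.contMDiff.mdifferentiableAt (n := ∞) (by simp)) z
  have h3 : prolong hΦ h ∘ v.translate = (prolong hΦ h v).translate ∘ vertMap hΦ h v :=
    funext (prolong_translate hΦ h v)
  have h4 : ∀ v' : ρ.Jet, v' = v →
      (mfderiv 𝓘(ℝ, JetModel E) 𝓘(ℝ, JetModel E') (prolong hΦ h) v : JetModel E →L[ℝ] JetModel E') =
        mfderiv 𝓘(ℝ, JetModel E) 𝓘(ℝ, JetModel E') (prolong hΦ h) v' := by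
    rintro _ rfl; rfl
  have h5 := congrArg (fun l : JetModel E →L[ℝ] JetModel E' => l (v.verticalLift z))
    (h4 _ (Jet.translate_zero v))
  have h6 : ∀ u : ρ'.vert (prolong hΦ h v).base, u = 0 →
      (mfderiv 𝓘(ℝ, ρ'.vert (prolong hΦ h v).base) 𝓘(ℝ, JetModel E') (prolong hΦ h v).translate u :
        ρ'.vert (prolong hΦ h v).base →L[ℝ] JetModel E') = (prolong hΦ h v).verticalLift := by
    rintro _ rfl; rfl
  have h7 := congrArg (fun l : ρ'.vert (prolong hΦ h v).base →L[ℝ] JetModel E' =>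
    l (vertMap hΦ h v z)) (h6 (vertMap hΦ h v 0) (map_zero _))
  have h8 : mfderiv 𝓘(ℝ, ρ.vert v.base) 𝓘(ℝ, ρ'.vert (prolong hΦ h v).base) (vertMap hΦ h v) 0 =
    vertMap hΦ h v := mfderiv_eq_fderiv.trans (vertMap hΦ h v).fderiv
  rw [h8] at h2
  rw [h3] at h1
  exact h5.trans (h1.symm.trans (h2.trans h7))

lemma contact_dProlong (v : ρ.Jet) (w : v.Tan) :
    (prolong hΦ h v).contact (dProlong hΦ h v w) = vertMap hΦ h v (v.contact w) := by
  apply Subtype.ext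
  change (prolong hΦ h v).dBase (dProlong hΦ h v w) -
    (prolong hΦ h v).dt (dProlong hΦ h v w) • (prolong hΦ h v).vec =
      (mfderiv I I' Φ v.base : E →L[ℝ] E') (v.dBase w - v.dt w • v.vec)
  have key : ∀ (l : E →L[ℝ] E') (x y : E) (c : ℝ), l (x - c • y) = l x - c • l y :=
    fun l x y c => by rw [map_sub, map_smul]
  rw [dBase_dProlong, dt_dProlong]
  exact (key _ _ _ _).symm

/-- A prolongation preserves dt and intertwines the vertical endomorphisms, because it intertwines
both the contact forms and the vertical lifts; θ_L is built from L, dt and S alone. -/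
lemma cartanForm_comp_prolong {L : ρ'.Jet → ℝ}
    (hL : ContMDiff 𝓘(ℝ, JetModel E') 𝓘(ℝ, ℝ) ∞ L) :
    cartanForm (L ∘ prolong hΦ h) =
      DForm.pullback 𝓘(ℝ, JetModel E) (prolong hΦ h) (cartanForm L) := by
  funext v
  ext u
  have h1 := mfderiv_comp_apply v (hL.mdifferentiableAt (x := prolong hΦ h v) (by simp))
    ((contMDiff_prolong hΦ h).mdifferentiableAt (x := v) (by simp)) (v.vertEndo (u 0))
  have h2 : dProlong hΦ h v (v.vertEndo (u 0)) =
      (prolong hΦ h v).vertEndo (dProlong hΦ h v (u 0)) := by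
    change dProlong hΦ h v (v.verticalLift (v.contact (u 0))) =
      (prolong hΦ h v).verticalLift ((prolong hΦ h v).contact (dProlong hΦ h v (u 0)))
    rw [contact_dProlong, dProlong_verticalLift]
  have h3 := congrArg (differential L (prolong hΦ h v)) h2
  change L (prolong hΦ h v) * v.dt (u 0) + differential (L ∘ prolong hΦ h) v (v.vertEndo (u 0)) =
    L (prolong hΦ h v) * (prolong hΦ h v).dt (dProlong hΦ h v (u 0)) +
      differential L (prolong hΦ h v) ((prolong hΦ h v).vertEndo (dProlong hΦ h v (u 0)))
  rw [dt_dProlong, ← h3]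
  exact congrArg _ h1

lemma lagrangianForm_comp_prolong {L : ρ'.Jet → ℝ}
    (hL : ContMDiff 𝓘(ℝ, JetModel E') 𝓘(ℝ, ℝ) ∞ L) (v : ρ.Jet) :
    lagrangianForm (L ∘ prolong hΦ h) v =
      DForm.pullback 𝓘(ℝ, JetModel E) (prolong hΦ h) (lagrangianForm L) v := by
  change -(cartanForm (L ∘ prolong hΦ h)).d v = _
  rw [cartanForm_comp_prolong hΦ h hL, DForm.d_pullback (contMDiff_prolong hΦ h).contMDiffAt
    (Jet.smoothAt_cartanForm hL _)]
  rfl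

end Prolongation

end TimeFibration

/-! ### Complete lifts of vector fields in coordinates. -/

namespace TimeFibration

section CompleteLift

variable {E : Type*} [NormedAddCommGroup E] [NormedSpace ℝ E] [FiniteDimensional ℝ E]
  {H : Type*} [TopologicalSpace H] {I : ModelWithCorners ℝ E H} [I.Boundaryless]
  {N : Type*} [TopologicalSpace N] [ChartedSpace H N] [IsManifold I ∞ N]
  {ρ : TimeFibration I N}

/-- The coordinate expression of a vector field in the preferred chart at `q`. -/
noncomputable def fieldCoord (X : ∀ q : N, TangentSpace I q) (q q' : N) : E :=
  fibreCoord E q (⟨q', X q'⟩ : TangentBundle I N)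

/-- The derivative along `a` of the coordinate expression of a vector field. -/
noncomputable def fieldDeriv (X : ∀ q : N, TangentSpace I q) (q : N) : E →L[ℝ] E :=
  mfderiv I 𝓘(ℝ, E) (fieldCoord X q) q

lemma contDiffAt_comp_extChartAt_symm {V : Type*} [NormedAddCommGroup V] [NormedSpace ℝ V]
    {f : N → V} {q : N} (hf : ContMDiffAt I 𝓘(ℝ, V) ∞ f q) :
    ContDiffAt ℝ ∞ (f ∘ (extChartAt I q).symm) (extChartAt I q q) := by
  refine ContMDiffAt.contDiffAt (ContMDiffAt.comp (I' := I) _ ?_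
    (contMDiffAt_extChartAt_symm_of_mem (mem_extChartAt_target q)))
  rwa [extChartAt_to_inv]

lemma mfderiv_eq_fderiv_extChartAt_symm {V : Type*} [NormedAddCommGroup V] [NormedSpace ℝ V]
    {f : N → V} {q : N} (hf : MDifferentiableAt I 𝓘(ℝ, V) f q) (a : E) :
    (mfderiv I 𝓘(ℝ, V) f q a : V) = fderiv ℝ (f ∘ (extChartAt I q).symm) (extChartAt I q q) a := by
  have h : mfderiv I 𝓘(ℝ, E) (extChartAt I q) q = ContinuousLinearMap.id ℝ E :=
    mfderiv_extChartAt_self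
  have := mfderiv_eq_fderiv_comp_mfderiv_extChartAt (mem_extChartAt_source (I := I) q) hf a
  rw [h] at this
  exact this

lemma HasFDerivAt.apply_snd {V : Type*} [NormedAddCommGroup V] [NormedSpace ℝ V]
    {A : V → V →L[ℝ] ℝ} {A' : V →L[ℝ] V →L[ℝ] ℝ} {x : V} (hA : HasFDerivAt A A' x) (b : V) :
    HasFDerivAt (fun y : V × V => A y.1 y.2) ((A x).comp (ContinuousLinearMap.snd ℝ V V) +
      (A'.comp (ContinuousLinearMap.fst ℝ V V)).flip b) (x, b) :=
  (hA.comp (f := Prod.fst) (x, b) hasFDerivAt_fst).clm_apply hasFDerivAt_snd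

/-- The derivative of the function `ḟ` on the tangent bundle, in the preferred chart. -/
noncomputable def velocityDeriv (f : N → ℝ) (u : TangentBundle I N) : E × E →L[ℝ] ℝ :=
  (fderiv ℝ (f ∘ (extChartAt I u.1).symm) (extChartAt I u.1 u.1)).comp
    (ContinuousLinearMap.snd ℝ E E) +
  ((fderiv ℝ (fderiv ℝ (f ∘ (extChartAt I u.1).symm)) (extChartAt I u.1 u.1)).comp
    (ContinuousLinearMap.fst ℝ E E)).flip u.2

lemma velocityDeriv_apply (f : N → ℝ) (u : TangentBundle I N) (c : E × E) :
    velocityDeriv f u c =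
      fderiv ℝ (fderiv ℝ (f ∘ (extChartAt I u.1).symm)) (extChartAt I u.1 u.1) c.1 u.2 +
        fderiv ℝ (f ∘ (extChartAt I u.1).symm) (extChartAt I u.1 u.1) c.2 :=
  add_comm _ _

lemma hasMFDerivAt_velocity {f : N → ℝ} {u : TangentBundle I N}
    (hf : ContMDiffAt I 𝓘(ℝ, ℝ) ∞ f u.1) :
    HasMFDerivAt I.tangent 𝓘(ℝ, ℝ) (fun z : TangentBundle I N => (mfderiv I 𝓘(ℝ, ℝ) f z.1 z.2 : ℝ))
      u (velocityDeriv f u) := by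
  let g : E × E → ℝ := fun y => fderiv ℝ (f ∘ (extChartAt I u.1).symm) y.1 y.2
  have hu : extChartAt I.tangent u u = (extChartAt I u.1 u.1, (u.2 : E)) := by
    rw [extChartAt_totalSpace_apply (I := I) u (y := u)
      (FiberBundle.mem_baseSet_trivializationAt' u.1)]
    exact Prod.ext rfl (fibreCoord_tangent_self u)
  have hg : HasFDerivAt g (velocityDeriv f u) (extChartAt I.tangent u u) := by
    have h1 : HasFDerivAt (fderiv ℝ (f ∘ (extChartAt I u.1).symm))
        (fderiv ℝ (fderiv ℝ (f ∘ (extChartAt I u.1).symm)) (extChartAt I u.1 u.1))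
        (extChartAt I u.1 u.1) :=
      (((contDiffAt_comp_extChartAt_symm hf).fderiv_right (m := ∞) (by simp)).differentiableAt
        (by simp)).hasFDerivAt
    exact hu.symm ▸ HasFDerivAt.apply_snd h1 (u.2 : E)
  have h1 : (fun z : TangentBundle I N => (mfderiv I 𝓘(ℝ, ℝ) f z.1 z.2 : ℝ)) =ᶠ[𝓝 u]
      g ∘ extChartAt I.tangent u := by
    have e1 : ∀ᶠ z : TangentBundle I N in 𝓝 u, MDifferentiableAt I 𝓘(ℝ, ℝ) f z.1 :=
      (FiberBundle.continuous_proj E (TangentSpace I)).continuousAt.eventually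
        hf.eventually_mdifferentiableAt
    have e2 : ∀ᶠ z : TangentBundle I N in 𝓝 u, z.1 ∈ (extChartAt I u.1).source :=
      (FiberBundle.continuous_proj E (TangentSpace I)).continuousAt.eventually
        ((isOpen_extChartAt_source u.1).mem_nhds (mem_extChartAt_source _))
    filter_upwards [e1, e2] with z hz1 hz2
    rw [extChartAt_source] at hz2
    have h := mfderiv_eq_fderiv_comp_mfderiv_extChartAt (I := I) (q := u.1)
      (by rwa [extChartAt_source]) hz1 z.2
    rw [Function.comp_apply, extChartAt_totalSpace_apply (I := I) u (y := z) hz2]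
    refine h.trans ?_
    exact congrArg (fderiv ℝ (f ∘ (extChartAt I u.1).symm) (extChartAt I u.1 z.1))
      (fibreCoord_tangent hz2 z.2).symm
  have e : mfderiv I.tangent 𝓘(ℝ, E × E) (extChartAt I.tangent u) u =
    ContinuousLinearMap.id ℝ (E × E) := mfderiv_extChartAt_self
  have h2 := (hg.hasMFDerivAt).comp u
    ((contMDiffAt_extChartAt (I := I.tangent) (x := u) (n := ∞)).mdifferentiableAt
      (by simp)).hasMFDerivAt
  rw [e] at h2
  exact h2.congr_of_eventuallyEq h1

/-- The derivative of the function `X f`. -/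
lemma mfderiv_lieDerivative {f : N → ℝ} {q : N} (hf : ContMDiffAt I 𝓘(ℝ, ℝ) ∞ f q)
    {X : ∀ q : N, TangentSpace I q}
    (hX : ContMDiffAt I I.tangent ∞ (fun q' => (⟨q', X q'⟩ : TangentBundle I N)) q) (a : E) :
    (mfderiv I 𝓘(ℝ, ℝ) (fun q' => (mfderiv I 𝓘(ℝ, ℝ) f q' (X q') : ℝ)) q a : ℝ) =
      fderiv ℝ (fderiv ℝ (f ∘ (extChartAt I q).symm)) (extChartAt I q q) a (X q) +
        fderiv ℝ (f ∘ (extChartAt I q).symm) (extChartAt I q q) (fieldDeriv X q a) := by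
  have h1 := ((hasMFDerivAt_velocity (u := ⟨q, X q⟩) hf).comp q
    (hX.mdifferentiableAt (by simp)).hasMFDerivAt).mfderiv
  refine (congrArg (fun l : E →L[ℝ] ℝ => l a) h1).trans ?_
  have h2 : (mfderiv I I.tangent (fun q' => (⟨q', X q'⟩ : TangentBundle I N)) q a : E × E) =
      (a, fieldDeriv X q a) := by
    refine (mfderiv_totalSpace_apply (hX.mdifferentiableAt (by simp)) a).trans (Prod.ext ?_ rfl)
    have h3 : mfderiv I I (fun q' : N => q') q = ContinuousLinearMap.id ℝ E := mfderiv_id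
    exact congrArg (fun l : E →L[ℝ] E => l a) h3
  refine (congrArg (velocityDeriv f (⟨q, X q⟩ : TangentBundle I N)) h2).trans ?_
  exact velocityDeriv_apply _ _ _

/-- The values of the complete lift of `X`, in terms of the derivative of `X`. -/
lemma isCompleteLift_iff {X : ∀ q : N, TangentSpace I q} {v : ρ.Jet} {w : v.Tan}
    (hX : ContMDiffAt I I.tangent ∞ (fun q' => (⟨q', X q'⟩ : TangentBundle I N)) v.base) :
    IsCompleteLift X v w ↔ v.dTan w = ((X v.base : E), fieldDeriv X v.base v.vec) := by
  have hb : ∀ f : N → ℝ, ContMDiffAt I 𝓘(ℝ, ℝ) ∞ f v.base →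
      (mfderiv 𝓘(ℝ, JetModel E) 𝓘(ℝ, ℝ) (fun u : ρ.Jet => f u.base) v w : ℝ) =
        fderiv ℝ (f ∘ (extChartAt I v.base).symm) (extChartAt I v.base v.base) (v.dTan w).1 := by
    intro f hf
    refine (mfderiv_comp_apply v (hf.mdifferentiableAt (by simp))
      (Jet.contMDiff_base.mdifferentiableAt (by simp)) w).trans ?_
    refine (mfderiv_eq_fderiv_extChartAt_symm (hf.mdifferentiableAt (by simp)) _).trans ?_
    exact congrArg _ (Jet.dTan_fst v w).symm
  have hv : ∀ f : N → ℝ, ContMDiffAt I 𝓘(ℝ, ℝ) ∞ f v.base →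
      (mfderiv 𝓘(ℝ, JetModel E) 𝓘(ℝ, ℝ)
        (fun u : ρ.Jet => (mfderiv I 𝓘(ℝ, ℝ) f u.base u.vec : ℝ)) v w : ℝ) =
        velocityDeriv f v.toTangent (v.dTan w) := by
    intro f hf
    have := ((hasMFDerivAt_velocity (u := v.toTangent) hf).comp v
      (Jet.mdifferentiableAt_toTangent v).hasMFDerivAt).mfderiv
    exact congrArg (fun l : JetModel E →L[ℝ] ℝ => l w) this
  constructor
  · intro hw
    -- It suffices to test on linear functions of the chart at v. Their second derivatives vanish in
    -- coordinates, and continuous functionals separate the points of E.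
    have hfl : ∀ ℓ : E →L[ℝ] ℝ, ContMDiffAt I 𝓘(ℝ, ℝ) ∞ (ℓ ∘ extChartAt I v.base) v.base :=
      fun ℓ => (ℓ.contDiff.contMDiff).contMDiffAt.comp v.base contMDiffAt_extChartAt
    have hev : ∀ ℓ : E →L[ℝ] ℝ, (ℓ ∘ extChartAt I v.base) ∘ (extChartAt I v.base).symm
        =ᶠ[𝓝 (extChartAt I v.base v.base)] ℓ := fun ℓ => by
      filter_upwards [(isOpen_extChartAt_target (I := I) v.base).mem_nhds
        (mem_extChartAt_target _)] with y hy
      rw [Function.comp_apply, Function.comp_apply, (extChartAt I v.base).right_inv hy]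
    have hd : ∀ ℓ : E →L[ℝ] ℝ, fderiv ℝ ((ℓ ∘ extChartAt I v.base) ∘ (extChartAt I v.base).symm)
        (extChartAt I v.base v.base) = ℓ := fun ℓ => by
      rw [(hev ℓ).fderiv_eq, ℓ.fderiv]
    have hdd : ∀ ℓ : E →L[ℝ] ℝ, fderiv ℝ (fderiv ℝ
        ((ℓ ∘ extChartAt I v.base) ∘ (extChartAt I v.base).symm))
        (extChartAt I v.base v.base) = 0 := fun ℓ => by
      rw [(hev ℓ).fderiv.fderiv_eq]
      have : fderiv ℝ (ℓ : E → ℝ) = fun _ => ℓ := funext fun y => ℓ.fderiv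
      rw [this, fderiv_const_apply]
    refine Prod.ext ?_ ?_
    · refine (SeparatingDual.eq_iff_forall_dual_eq (R := ℝ)).2 fun ℓ => ?_
      have h1 := (hb _ (hfl ℓ)).symm.trans (hw _ (hfl ℓ)).1
      have h2 := mfderiv_eq_fderiv_extChartAt_symm ((hfl ℓ).mdifferentiableAt (by simp)) (X v.base)
      rw [hd] at h1 h2
      exact h1.trans h2
    · refine (SeparatingDual.eq_iff_forall_dual_eq (R := ℝ)).2 fun ℓ => ?_
      have h1 := (hv _ (hfl ℓ)).symm.trans ((hw _ (hfl ℓ)).2.trans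
        (mfderiv_lieDerivative (hfl ℓ) hX v.vec))
      rw [velocityDeriv_apply] at h1
      change fderiv ℝ (fderiv ℝ ((ℓ ∘ extChartAt I v.base) ∘ (extChartAt I v.base).symm))
        (extChartAt I v.base v.base) (v.dTan w).1 v.vec + fderiv ℝ
        ((ℓ ∘ extChartAt I v.base) ∘ (extChartAt I v.base).symm)
        (extChartAt I v.base v.base) (v.dTan w).2 = _ at h1
      rw [hd, hdd] at h1
      have key : ∀ x y z : ℝ, x + y = x + z → y = z := fun x y z h => add_left_cancel h
      exact key 0 _ _ h1
  · intro hw f hf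
    refine ⟨(hb f hf).trans ?_, (hv f hf).trans ?_⟩
    · rw [hw]
      exact (mfderiv_eq_fderiv_extChartAt_symm (hf.mdifferentiableAt (by simp)) _).symm
    · rw [hw]
      refine (velocityDeriv_apply f v.toTangent _).trans
        (Eq.trans ?_ (mfderiv_lieDerivative hf hX v.vec).symm)
      -- The second-order terms of X^C(ḟ) and of (Xf)˙ differ by the order of their arguments;
      -- symmetry of the second derivative identifies them.
      exact congrArg (· + _) (((contDiffAt_comp_extChartAt_symm hf).isSymmSndFDerivAt
        (by simpa using two_le_infty)).eq _ _)

/-- The complete lift of a vertical vector field is tangent to the jet bundle. -/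
lemma dTdot_fieldDeriv {X : ∀ q : N, TangentSpace I q} {v : ρ.Jet}
    (hX : ContMDiffAt I I.tangent ∞ (fun q' => (⟨q', X q'⟩ : TangentBundle I N)) v.base)
    (hv : ∀ q, ρ.dAt q (X q) = 0) :
    ρ.dTdot v.toTangent ((X v.base : E), fieldDeriv X v.base v.vec) = 0 := by
  have hf : ContMDiffAt I 𝓘(ℝ, ℝ) ∞ ρ.toFun v.base := ρ.smooth.contMDiffAt
  have h1 : ρ.dTdot v.toTangent = velocityDeriv ρ.toFun v.toTangent :=
    (hasMFDerivAt_velocity (u := v.toTangent) hf).mfderiv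
  have h2 := mfderiv_lieDerivative hf hX v.vec
  -- Verticality says that the function Xρ is identically zero, so the derivative of Xρ along v,
  -- which is the required value of dṫ, vanishes.
  have h3 : (fun q' => (mfderiv I 𝓘(ℝ, ℝ) ρ.toFun q' (X q') : ℝ)) = fun _ => (0 : ℝ) := funext hv
  rw [h3, mfderiv_const] at h2
  rw [h1, velocityDeriv_apply]
  refine Eq.trans ?_ h2.symm
  exact congrArg (· + _) (((contDiffAt_comp_extChartAt_symm hf).isSymmSndFDerivAt
        (by simpa using two_le_infty)).eq _ _)

end CompleteLift

end TimeFibration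

/-! ### Manifold-valued calculus of continuous linear maps. -/

section CLM

variable {E : Type*} [NormedAddCommGroup E] [NormedSpace ℝ E]
  {H : Type*} [TopologicalSpace H] {I : ModelWithCorners ℝ E H}
  {M : Type*} [TopologicalSpace M] [ChartedSpace H M]
  {V W : Type*} [NormedAddCommGroup V] [NormedSpace ℝ V] [NormedAddCommGroup W] [NormedSpace ℝ W]

lemma contMDiffAt_clm_of_apply [FiniteDimensional ℝ V] {A : M → V →L[ℝ] W} {p : M}
    (h : ∀ c, ContMDiffAt I 𝓘(ℝ, W) ∞ (fun q => A q c) p) :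
    ContMDiffAt I 𝓘(ℝ, V →L[ℝ] W) ∞ A p := by
  let b := Module.finBasis ℝ V
  have hA : A = fun q => ∑ i, ContinuousLinearMap.smulRightL ℝ V W
      (LinearMap.toContinuousLinearMap (b.coord i)) (A q (b i)) := by
    funext q
    ext c
    conv_lhs => rw [← b.sum_repr c, map_sum]
    simp
  rw [hA]
  exact contMDiffAt_finsetSum fun i _ =>
    (ContinuousLinearMap.contDiff _).contMDiff.contMDiffAt.comp p (h (b i))

lemma HasMFDerivAt.clm_apply {A : M → V →L[ℝ] W} {x : M → V} {p : M} {A' : E →L[ℝ] V →L[ℝ] W}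
    {x' : E →L[ℝ] V} (hA : HasMFDerivAt I 𝓘(ℝ, V →L[ℝ] W) A p A')
    (hx : HasMFDerivAt I 𝓘(ℝ, V) x p x') :
    HasMFDerivAt I 𝓘(ℝ, W) (fun q => A q (x q)) p ((A p).comp x' + A'.flip (x p)) := by
  have h1 : HasFDerivAt (fun z : (V →L[ℝ] W) × V => z.1 z.2)
      ((A p).comp (ContinuousLinearMap.snd ℝ _ _) +
        (ContinuousLinearMap.fst ℝ (V →L[ℝ] W) V).flip (x p)) (A p, x p) :=
    HasFDerivAt.clm_apply (c := Prod.fst) (u := Prod.snd) (x := (A p, x p)) hasFDerivAt_fst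
      hasFDerivAt_snd
  have h2 : HasMFDerivAt I 𝓘(ℝ, (V →L[ℝ] W) × V) (fun q => (A q, x q)) p (A'.prod x') :=
    ⟨hA.1.prodMk hx.1, hA.2.prodMk hx.2⟩
  exact HasMFDerivAt.comp (g := fun z : (V →L[ℝ] W) × V => z.1 z.2)
    (f := fun q => (A q, x q)) p h1.hasMFDerivAt h2

end CLM

/-! ### Local frames of K and of its complete lift K^C. -/

namespace VerticalDistribution

section Frames

variable {E : Type*} [NormedAddCommGroup E] [NormedSpace ℝ E] [FiniteDimensional ℝ E]
  {H : Type*} [TopologicalSpace H] {I : ModelWithCorners ℝ E H} [I.Boundaryless]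
  {Q : Type*} [TopologicalSpace Q] [ChartedSpace H Q]
  {F : Type*} [NormedAddCommGroup F] [NormedSpace ℝ F] [FiniteDimensional ℝ F]
  {𝒦 : Q → Type*} [∀ q, TopologicalSpace (𝒦 q)] [∀ q, AddCommGroup (𝒦 q)] [∀ q, Module ℝ (𝒦 q)]
  [TopologicalSpace (TotalSpace F 𝒦)] [FiberBundle F 𝒦]
  [IsManifold I ∞ Q] [VectorBundle ℝ F 𝒦] [ContMDiffVectorBundle ∞ F 𝒦 I]
  [∀ q, IsTopologicalAddGroup (𝒦 q)] [∀ q, ContinuousSMul ℝ (𝒦 q)] {ρ : TimeFibration I Q}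

/-- The local frame of `𝒦` given by the preferred trivialization at `q`. -/
noncomputable def frame (F : Type*) [NormedAddCommGroup F] [NormedSpace ℝ F] {𝒦 : Q → Type*}
    [∀ q, TopologicalSpace (𝒦 q)] [∀ q, AddCommGroup (𝒦 q)] [∀ q, Module ℝ (𝒦 q)]
    [TopologicalSpace (TotalSpace F 𝒦)] [FiberBundle F 𝒦] [VectorBundle ℝ F 𝒦]
    (q q' : Q) : F →L[ℝ] 𝒦 q' :=
  (trivializationAt F 𝒦 q).symmL ℝ q'

lemma fibreCoord_frame {q q' : Q} (hq : q' ∈ (trivializationAt F 𝒦 q).baseSet) (c : F) :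
    fibreCoord F q (⟨q', frame F q q' c⟩ : TotalSpace F 𝒦) = c := by
  rw [fibreCoord_eq _ hq]
  exact (trivializationAt F 𝒦 q).continuousLinearMapAt_symmL hq c

lemma frame_fibreCoord {q : Q} {x : TotalSpace F 𝒦}
    (hq : x.proj ∈ (trivializationAt F 𝒦 q).baseSet) :
    frame F q x.proj (fibreCoord F q x) = x.2 := by
  rw [fibreCoord_eq _ hq]
  exact (trivializationAt F 𝒦 q).symmL_continuousLinearMapAt hq x.2

lemma contMDiffAt_frame (q : Q) (c : F) :
    SmoothSectionAt I F (fun q' => (frame F q q' c : 𝒦 q')) q := by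
  have hq := FiberBundle.mem_baseSet_trivializationAt' (F := F) (E := 𝒦) q
  rw [SmoothSectionAt, contMDiffAt_totalSpace]
  refine ⟨contMDiffAt_id, contMDiffAt_const (c := c) |>.congr_of_eventuallyEq ?_⟩
  filter_upwards [(trivializationAt F 𝒦 q).open_baseSet.mem_nhds hq] with q' hq'
  exact fibreCoord_frame hq' c

/-- The trivialisation of the dual bundle is induced from that of 𝒦, the target line bundle being
trivial. -/
lemma fibreCoord_dual (q p : Q) (μ : 𝒦 p →L[ℝ] ℝ) :
    fibreCoord (F →L[ℝ] ℝ) q (⟨p, μ⟩ : DualTotal F 𝒦) = μ.comp (frame F q p) := by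
  unfold fibreCoord
  rw [hom_trivializationAt_apply]
  ext c
  rw [ContinuousLinearMap.inCoordinates]
  simp [frame]

lemma mem_baseSet_dual {q p : Q}
    (hp : p ∈ (trivializationAt F 𝒦 q).baseSet) :
    p ∈ (trivializationAt (F →L[ℝ] ℝ) (fun q => 𝒦 q →L[ℝ] ℝ) q).baseSet :=
  ⟨hp, Set.mem_univ _⟩

/-- The coordinate expression of the inclusion of `𝒦`. -/
noncomputable def inclCoord (K : VerticalDistribution ρ F 𝒦) (q q' : Q) : F →L[ℝ] E :=
  ContinuousLinearMap.comp
    ((trivializationAt E (TangentSpace I) q).continuousLinearMapAt ℝ q' : E →L[ℝ] E)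
    (ContinuousLinearMap.comp (K.incl q') (frame F q q'))

variable (K : VerticalDistribution ρ F 𝒦)

lemma inclCoord_apply {q q' : Q} (hq : q' ∈ (chartAt H q).source) (c : F) :
    K.inclCoord q q' c = fibreCoord E q (⟨q', K.incl q' (frame F q q' c)⟩ : TangentBundle I Q) :=
  (fibreCoord_eq (⟨q', K.incl q' (frame F q q' c)⟩ : TangentBundle I Q) hq).symm

lemma contMDiffAt_incl_comp {X : ∀ q, 𝒦 q} {q : Q} (hX : SmoothSectionAt I F X q) :
    ContMDiffAt I I.tangent ∞ (fun q' => (⟨q', K.incl q' (X q')⟩ : TangentBundle I Q)) q :=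
  K.smooth.contMDiffAt.comp q hX

lemma contMDiffAt_inclCoord (q : Q) : ContMDiffAt I 𝓘(ℝ, F →L[ℝ] E) ∞ (K.inclCoord q) q := by
  refine contMDiffAt_clm_of_apply fun c => ?_
  have h1 := (contMDiffAt_fibreCoord (F := E) (q := q)
    (x := (⟨q, K.incl q (frame F q q c)⟩ : TangentBundle I Q)) (mem_chart_source H q)).comp
    (f := fun q' => (⟨q', K.incl q' (frame F q q' c)⟩ : TangentBundle I Q)) q
    (K.contMDiffAt_incl_comp (contMDiffAt_frame q c))
  refine h1.congr_of_eventuallyEq ?_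
  filter_upwards [(chartAt H q).open_source.mem_nhds (mem_chart_source H q)] with q' hq'
  exact K.inclCoord_apply hq' c

lemma inclCoord_self (q : Q) (c : F) : K.inclCoord q q c = K.incl q (frame F q q c) := by
  rw [inclCoord, continuousLinearMapAt_tangent_self]
  rfl

lemma inclCoord_fibreCoord (q : Q) (k : 𝒦 q) :
    K.inclCoord q q (fibreCoord F q (⟨q, k⟩ : TotalSpace F 𝒦)) = (K.incl q k : E) := by
  have h := frame_fibreCoord (x := (⟨q, k⟩ : TotalSpace F 𝒦))
      (FiberBundle.mem_baseSet_trivializationAt' q)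
  exact (K.inclCoord_self q _).trans (congrArg (K.incl q) h)

lemma frame_injective {q q' : Q} (hq : q' ∈ (trivializationAt F 𝒦 q).baseSet) :
    Function.Injective (frame F q q' : F → 𝒦 q') := fun c c' h => by
  rw [← fibreCoord_frame (𝒦 := 𝒦) hq c, h, fibreCoord_frame hq]

lemma inclCoord_self_injective (q : Q) : Function.Injective (K.inclCoord q q) := fun c c' h => by
  rw [inclCoord_self, inclCoord_self] at h
  exact frame_injective (FiberBundle.mem_baseSet_trivializationAt' q) (K.injective q h)

/-- The derivative at `q` of the coordinate expression of the inclusion of `𝒦`. -/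
noncomputable def inclDeriv (q : Q) (a : E) : F →L[ℝ] E :=
  mfderiv I 𝓘(ℝ, F →L[ℝ] E) (K.inclCoord q) q a

/-- The derivative at `q` of the coordinate expression of a section of `𝒦`. -/
noncomputable def sectionDeriv (I : ModelWithCorners ℝ E H) (F : Type*) [NormedAddCommGroup F]
    [NormedSpace ℝ F] {𝒦 : Q → Type*} [∀ q, TopologicalSpace (𝒦 q)]
    [TopologicalSpace (TotalSpace F 𝒦)] [FiberBundle F 𝒦] (X : ∀ q, 𝒦 q) (q : Q) : E →L[ℝ] F :=
  mfderiv I 𝓘(ℝ, F) (fun q' => fibreCoord F q (⟨q', X q'⟩ : TotalSpace F 𝒦)) q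

lemma contMDiffAt_fibreCoord_section {X : ∀ q, 𝒦 q} {q : Q} (hX : SmoothSectionAt I F X q) :
    ContMDiffAt I 𝓘(ℝ, F) ∞ (fun q' => fibreCoord F q (⟨q', X q'⟩ : TotalSpace F 𝒦)) q :=
  (contMDiffAt_fibreCoord (I := I) (x := (⟨q, X q⟩ : TotalSpace F 𝒦))
    (FiberBundle.mem_baseSet_trivializationAt' q)).comp (f := fun q' => TotalSpace.mk' F q' (X q')) q hX

/-- In the frame, the vector field is the matrix of the inclusion applied to the coordinates of X,
and this is the product rule. -/
lemma fieldDeriv_incl {X : ∀ q, 𝒦 q} {q : Q} (hX : SmoothSectionAt I F X q) (a : E) :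
    TimeFibration.fieldDeriv (fun q' => K.incl q' (X q')) q a =
      K.inclDeriv q a (fibreCoord F q (⟨q, X q⟩ : TotalSpace F 𝒦)) +
        K.inclCoord q q (sectionDeriv I F X q a) := by
  have h1 : TimeFibration.fieldCoord (fun q' => K.incl q' (X q')) q =ᶠ[𝓝 q]
      fun q' => K.inclCoord q q' (fibreCoord F q (⟨q', X q'⟩ : TotalSpace F 𝒦)) := by
    filter_upwards [(chartAt H q).open_source.mem_nhds (mem_chart_source H q),
      (trivializationAt F 𝒦 q).open_baseSet.mem_nhds
        (FiberBundle.mem_baseSet_trivializationAt' q)] with q' hq' hq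
    rw [K.inclCoord_apply hq', TimeFibration.fieldCoord,
      frame_fibreCoord (x := (⟨q', X q'⟩ : TotalSpace F 𝒦)) hq]
  rw [TimeFibration.fieldDeriv, h1.mfderiv_eq]
  have h2 := (HasMFDerivAt.clm_apply
    ((K.contMDiffAt_inclCoord q).mdifferentiableAt (by simp)).hasMFDerivAt
    ((contMDiffAt_fibreCoord_section hX).mdifferentiableAt (by simp)).hasMFDerivAt).mfderiv
  exact (congrArg (fun l : E →L[ℝ] E => l a) h2).trans (add_comm _ _)

/-- Frame sections have constant coordinates. Their complete lifts therefore have coordinates (c, 0)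
in the frame of K^C. -/
lemma sectionDeriv_frame (q : Q) (c : F) (a : E) :
    sectionDeriv I F (fun q' => (frame F q q' c : 𝒦 q')) q a = 0 := by
  have h1 : (fun q' => fibreCoord F q (⟨q', frame F q q' c⟩ : TotalSpace F 𝒦)) =ᶠ[𝓝 q]
      fun _ => c := by
    filter_upwards [(trivializationAt F 𝒦 q).open_baseSet.mem_nhds
        (FiberBundle.mem_baseSet_trivializationAt' q)] with q' hq
    exact fibreCoord_frame hq c
  rw [sectionDeriv, h1.mfderiv_eq, mfderiv_const]
  rfl

/-- The coordinate expression of the complete lift of `𝒦` at a jet. -/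
noncomputable def liftCoord (v : ρ.Jet) : F × F →L[ℝ] E × E :=
  ((K.inclCoord v.base v.base).comp (ContinuousLinearMap.fst ℝ F F)).prod
    ((K.inclDeriv v.base v.vec).comp (ContinuousLinearMap.fst ℝ F F) +
      (K.inclCoord v.base v.base).comp (ContinuousLinearMap.snd ℝ F F))

lemma liftCoord_apply (v : ρ.Jet) (z : F × F) :
    K.liftCoord v z = (K.inclCoord v.base v.base z.1,
      K.inclDeriv v.base v.vec z.1 + K.inclCoord v.base v.base z.2) := rfl

/-- The map is block triangular with the injective inclusion of K in both diagonal blocks. -/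
lemma liftCoord_injective (v : ρ.Jet) : Function.Injective (K.liftCoord v) := by
  rw [injective_iff_map_eq_zero]
  intro z hz
  have h0 : ∀ c : F, K.inclCoord v.base v.base c = 0 → c = 0 := fun c hc =>
    K.inclCoord_self_injective v.base (hc.trans (map_zero _).symm)
  have h1 : z.1 = 0 := h0 _ (congrArg Prod.fst hz)
  have h2 := congrArg Prod.snd hz
  rw [liftCoord_apply, h1] at h2
  refine Prod.ext h1 (h0 _ ?_)
  simpa using h2

lemma dTan_completeLift {X : ∀ q, 𝒦 q} {v : ρ.Jet} (hX : SmoothSectionAt I F X v.base)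
    {w : v.Tan} (hw : IsCompleteLift (fun q => K.incl q (X q)) v w) :
    v.dTan w = K.liftCoord v (fibreCoord F v.base (⟨v.base, X v.base⟩ : TotalSpace F 𝒦),
      sectionDeriv I F X v.base v.vec) := by
  refine ((TimeFibration.isCompleteLift_iff (K.contMDiffAt_incl_comp hX)).1 hw).trans
    (Prod.ext ?_ (K.fieldDeriv_incl hX _))
  exact (K.inclCoord_fibreCoord _ _).symm

lemma dTan_verticalLift_toVert (v : ρ.Jet) (k : 𝒦 v.base) :
    v.dTan (v.verticalLift (K.toVert v.base k)) =
      K.liftCoord v (0, fibreCoord F v.base (⟨v.base, k⟩ : TotalSpace F 𝒦)) := by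
  rw [TimeFibration.Jet.dTan_verticalLift, liftCoord_apply, map_zero, map_zero, zero_add]
  exact Prod.ext rfl (K.inclCoord_fibreCoord v.base k).symm

lemma exists_isCompleteLift {X : ∀ q, 𝒦 q} {v : ρ.Jet} (hX : SmoothSectionAt I F X v.base) :
    ∃ w : v.Tan, IsCompleteLift (fun q => K.incl q (X q)) v w := by
  obtain ⟨w, hw⟩ := v.exists_dTan_eq (TimeFibration.dTdot_fieldDeriv
    (K.contMDiffAt_incl_comp hX) fun q => K.vertical q (X q))
  exact ⟨w, (TimeFibration.isCompleteLift_iff (K.contMDiffAt_incl_comp hX)).2 hw⟩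

/-- A complete lift has coordinates (X, DX·v) and a vertical lift (0, X), so the span stays in the
range of `liftCoord`; conversely, frame sections realise every (c, 0) and every (0, b). This
replaces a span over germs of sections by a pointwise parametrisation by F × F. -/
lemma mem_completeLift_iff (v : ρ.Jet) (w : v.Tan) :
    w ∈ K.completeLift v ↔ ∃ z : F × F, v.dTan w = K.liftCoord v z := by
  constructor
  · intro hw
    let S : Submodule ℝ v.Tan :=
      Submodule.comap v.dTan.toLinearMap (LinearMap.range (K.liftCoord v).toLinearMap)
    have hle : K.completeLift v ≤ S := by
      refine Submodule.span_le.2 ?_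
      rintro w ⟨X, hX, hw | rfl⟩
      · exact ⟨_, (K.dTan_completeLift hX hw).symm⟩
      · exact ⟨_, (K.dTan_verticalLift_toVert v _).symm⟩
    obtain ⟨z, hz⟩ := hle hw
    exact ⟨z, hz.symm⟩
  · rintro ⟨z, hz⟩
    have hX := contMDiffAt_frame (I := I) (𝒦 := 𝒦) v.base z.1
    have hq := FiberBundle.mem_baseSet_trivializationAt' (F := F) (E := 𝒦) v.base
    obtain ⟨w₁, hw₁⟩ := K.exists_isCompleteLift hX
    let w₂ := v.verticalLift (K.toVert v.base (frame F v.base v.base z.2))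
    have h : w = w₁ + w₂ := by
      refine v.dTan_injective ?_
      rw [hz, map_add, K.dTan_completeLift hX hw₁, K.dTan_verticalLift_toVert, ← map_add,
        fibreCoord_frame hq, fibreCoord_frame hq, sectionDeriv_frame]
      simp
    rw [h]
    exact Submodule.add_mem _ (Submodule.subset_span ⟨_, hX, Or.inl hw₁⟩)
      (Submodule.subset_span ⟨_, contMDiffAt_frame v.base z.2, Or.inr rfl⟩)

lemma exists_dTan_eq_liftCoord (v : ρ.Jet) (z : F × F) : ∃ w : v.Tan, v.dTan w = K.liftCoord v z := by
  have hX := contMDiffAt_frame (I := I) (𝒦 := 𝒦) v.base z.1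
  have hq := FiberBundle.mem_baseSet_trivializationAt' (F := F) (E := 𝒦) v.base
  obtain ⟨w₁, hw₁⟩ := K.exists_isCompleteLift hX
  refine ⟨w₁ + v.verticalLift (K.toVert v.base (frame F v.base v.base z.2)), ?_⟩
  rw [map_add, K.dTan_completeLift hX hw₁, K.dTan_verticalLift_toVert, ← map_add,
    fibreCoord_frame hq, fibreCoord_frame hq, sectionDeriv_frame]
  simp

/-- The frame of `K^C` at the jet `v`. -/
noncomputable def liftEquiv (v : ρ.Jet) : K.completeLift v ≃ₗ[ℝ] F × F :=
  let e₁ := LinearEquiv.ofInjective v.dTan.toLinearMap v.dTan_injective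
  LinearEquiv.ofBijective
    (LinearMap.codRestrict _ (v.dTan.toLinearMap ∘ₗ (K.completeLift v).subtype) fun w =>
      (by
        obtain ⟨z, hz⟩ := (K.mem_completeLift_iff v w.1).1 w.2
        exact ⟨z, hz.symm⟩ :
        v.dTan w.1 ∈ LinearMap.range (K.liftCoord v).toLinearMap))
    ⟨fun w w' h => Subtype.ext (v.dTan_injective (congrArg Subtype.val h)), by
      rintro ⟨_, z, rfl⟩
      obtain ⟨w, hw⟩ := K.exists_dTan_eq_liftCoord v z
      exact ⟨⟨w, (K.mem_completeLift_iff v w).2 ⟨z, hw⟩⟩, Subtype.ext hw⟩⟩ |>.trans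
  (LinearEquiv.ofInjective (K.liftCoord v).toLinearMap (K.liftCoord_injective v)).symm

lemma liftCoord_liftEquiv (v : ρ.Jet) (w : K.completeLift v) :
    K.liftCoord v (K.liftEquiv v w) = v.dTan w.1 :=
  congrArg Subtype.val
    (LinearEquiv.apply_symm_apply (LinearEquiv.ofInjective (K.liftCoord v).toLinearMap
      (K.liftCoord_injective v)) _)

lemma liftEquiv_eq {v : ρ.Jet} {w : K.completeLift v} {z : F × F}
    (h : v.dTan w.1 = K.liftCoord v z) : K.liftEquiv v w = z :=
  K.liftCoord_injective v ((K.liftCoord_liftEquiv v w).trans h)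

end Frames

end VerticalDistribution

/-! ### The Tulczyjew isomorphism. -/

namespace VerticalDistribution

section Tulczyjew

variable {E : Type*} [NormedAddCommGroup E] [NormedSpace ℝ E] [FiniteDimensional ℝ E]
  {H : Type*} [TopologicalSpace H] {I : ModelWithCorners ℝ E H} [I.Boundaryless]
  {Q : Type*} [TopologicalSpace Q] [ChartedSpace H Q]
  {F : Type*} [NormedAddCommGroup F] [NormedSpace ℝ F] [FiniteDimensional ℝ F]
  {𝒦 : Q → Type*} [∀ q, TopologicalSpace (𝒦 q)] [∀ q, AddCommGroup (𝒦 q)] [∀ q, Module ℝ (𝒦 q)]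
  [TopologicalSpace (TotalSpace F 𝒦)] [FiberBundle F 𝒦]
  [IsManifold I ∞ Q] [VectorBundle ℝ F 𝒦] [ContMDiffVectorBundle ∞ F 𝒦 I]
  [∀ q, IsTopologicalAddGroup (𝒦 q)] [∀ q, ContinuousSMul ℝ (𝒦 q)] {ρ : TimeFibration I Q}

lemma dualProj_apply (x : DualTotal F 𝒦) (w : E × (F →L[ℝ] ℝ)) : (dualProj I x w : E) = w.1 :=
  congrArg (fun l : E × (F →L[ℝ] ℝ) →L[ℝ] E => l w)
    (mfderiv_totalSpace_proj (I := I) x)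

/-- The element of `𝒦*` at `q` with given coordinates in the preferred trivialization at `q`. -/
noncomputable def dualOfCoord (𝒦 : Q → Type*) [∀ q, TopologicalSpace (𝒦 q)]
    [∀ q, AddCommGroup (𝒦 q)] [∀ q, Module ℝ (𝒦 q)] [TopologicalSpace (TotalSpace F 𝒦)]
    [FiberBundle F 𝒦] [VectorBundle ℝ F 𝒦] (q : Q) (m : F →L[ℝ] ℝ) : 𝒦 q →L[ℝ] ℝ :=
  m.comp ((trivializationAt F 𝒦 q).continuousLinearMapAt ℝ q)

lemma fibreCoord_dualOfCoord (q : Q) (m : F →L[ℝ] ℝ) :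
    fibreCoord (F →L[ℝ] ℝ) q (⟨q, dualOfCoord 𝒦 q m⟩ : DualTotal F 𝒦) = m := by
  rw [fibreCoord_dual]
  ext c
  exact congrArg m ((trivializationAt F 𝒦 q).continuousLinearMapAt_symmL
    (FiberBundle.mem_baseSet_trivializationAt' q) c)

lemma dualOfCoord_fibreCoord (q : Q) (μ : 𝒦 q →L[ℝ] ℝ) :
    dualOfCoord 𝒦 q (fibreCoord (F →L[ℝ] ℝ) q (⟨q, μ⟩ : DualTotal F 𝒦)) = μ := by
  rw [fibreCoord_dual]
  ext k
  exact congrArg μ ((trivializationAt F 𝒦 q).symmL_continuousLinearMapAt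
    (FiberBundle.mem_baseSet_trivializationAt' q) k)

variable (K : VerticalDistribution ρ F 𝒦)

lemma jetProj_vec (ξ : K.ext.Jet) : (K.jetProj ξ).vec = (ξ.vec : E × (F →L[ℝ] ℝ)).1 :=
  dualProj_apply ξ.base ξ.vec

lemma ext_dAt_apply (x : DualTotal F 𝒦) (w : E × (F →L[ℝ] ℝ)) : K.ext.dAt x w = ρ.dAt x.proj w.1 :=
  (K.ext_dAt x w).trans (congrArg (ρ.dAt x.proj) (dualProj_apply x w))

/-- A jet of `𝒦* → ℝ` amounts to a jet of `Q → ℝ` and a pair of covectors of the fibre: the value and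
the derivative of a section of `𝒦*`, in the preferred trivialization. -/
noncomputable def jetEquiv : K.ext.Jet ≃ ρ.Jet × ((F →L[ℝ] ℝ) × (F →L[ℝ] ℝ)) where
  -- The velocity precedes the value because it pairs with the first coordinate c of K^C, while the
  -- value pairs with the vertical coordinate b.
  toFun ξ := (K.jetProj ξ, ((ξ.vec : E × (F →L[ℝ] ℝ)).2, fibreCoord (F →L[ℝ] ℝ) ξ.base.proj ξ.base))
  invFun z := ⟨⟨⟨z.1.base, dualOfCoord 𝒦 z.1.base z.2.2⟩, (z.1.vec, z.2.1)⟩,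
    (K.ext_dAt_apply _ _).trans z.1.2⟩
  left_inv := by
    rintro ⟨⟨⟨q, μ⟩, w⟩, h⟩
    apply Subtype.ext
    change (⟨⟨q, dualOfCoord 𝒦 q (fibreCoord (F →L[ℝ] ℝ) q (⟨q, μ⟩ : DualTotal F 𝒦))⟩,
      ((dualProj I ⟨q, μ⟩ w : E), (w : E × (F →L[ℝ] ℝ)).2)⟩ :
        TangentBundle (I.prod 𝓘(ℝ, F →L[ℝ] ℝ)) (DualTotal F 𝒦)) = ⟨⟨q, μ⟩, w⟩
    rw [dualOfCoord_fibreCoord]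
    exact congrArg (fun c : E × (F →L[ℝ] ℝ) =>
      (⟨⟨q, μ⟩, c⟩ : TangentBundle (I.prod 𝓘(ℝ, F →L[ℝ] ℝ)) (DualTotal F 𝒦)))
      (Prod.ext (dualProj_apply _ w) rfl)
  right_inv := by
    rintro ⟨v, b, m⟩
    refine Prod.ext (Subtype.ext ?_) (Prod.ext rfl (fibreCoord_dualOfCoord v.base m))
    exact congrArg (fun c : E => (⟨v.base, c⟩ : TangentBundle I Q)) (dualProj_apply _ (v.vec, b))

/-- The dual of a fibre of `K^C` in the frame. -/
noncomputable def dualEquiv (v : ρ.Jet) :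
    ((F →L[ℝ] ℝ) × (F →L[ℝ] ℝ)) ≃ Module.Dual ℝ (K.completeLift v) :=
  (((LinearMap.toContinuousLinearMap (𝕜 := ℝ) (E := F) (F' := ℝ)).symm.prodCongr
    (LinearMap.toContinuousLinearMap (𝕜 := ℝ) (E := F) (F' := ℝ)).symm).trans
      ((LinearMap.coprodEquiv ℝ).trans (K.liftEquiv v).dualMap)).toEquiv

lemma dualEquiv_apply (v : ρ.Jet) (m : (F →L[ℝ] ℝ) × (F →L[ℝ] ℝ)) (w : K.completeLift v) :
    K.dualEquiv v m w = m.1 (K.liftEquiv v w).1 + m.2 (K.liftEquiv v w).2 := rfl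

/-- The Tulczyjew isomorphism. -/
noncomputable def tulczyjew : K.ext.Jet ≃ K.DualCompleteLift :=
  K.jetEquiv.trans ((Equiv.sigmaEquivProd _ _).symm.trans (Equiv.sigmaCongrRight K.dualEquiv))

/-- The Leibniz rule for the pairing of the coordinates of μ with those of X, the latter depending
on μ only through its base point. -/
lemma mfderiv_pairing {X : ∀ q, 𝒦 q} {x : DualTotal F 𝒦} (hX : SmoothSectionAt I F X x.proj)
    (w : E × (F →L[ℝ] ℝ)) :
    (mfderiv (I.prod 𝓘(ℝ, F →L[ℝ] ℝ)) 𝓘(ℝ, ℝ)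
      (fun μ : DualTotal F 𝒦 => (μ.2 (X μ.proj) : ℝ)) x w : ℝ) =
      w.2 (fibreCoord F x.proj (⟨x.proj, X x.proj⟩ : TotalSpace F 𝒦)) +
        fibreCoord (F →L[ℝ] ℝ) x.proj x (sectionDeriv I F X x.proj w.1) := by
  have hb := FiberBundle.mem_baseSet_trivializationAt' (F := F) (E := 𝒦) x.proj
  have h1 : (fun μ : DualTotal F 𝒦 => (μ.2 (X μ.proj) : ℝ)) =ᶠ[𝓝 x]
      fun μ => fibreCoord (F →L[ℝ] ℝ) x.proj μ
        (fibreCoord F x.proj (⟨μ.proj, X μ.proj⟩ : TotalSpace F 𝒦)) := by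
    have hc : Filter.Tendsto (TotalSpace.proj : DualTotal F 𝒦 → Q) (𝓝 x) (𝓝 x.proj) :=
      (FiberBundle.continuous_proj (F →L[ℝ] ℝ) (fun q => 𝒦 q →L[ℝ] ℝ)).continuousAt
    filter_upwards [hc.eventually ((trivializationAt F 𝒦 x.proj).open_baseSet.mem_nhds hb)]
      with μ hμ
    have h2 := frame_fibreCoord (x := (⟨μ.proj, X μ.proj⟩ : TotalSpace F 𝒦)) hμ
    refine Eq.trans ?_ (congrArg (fun l : F →L[ℝ] ℝ => l _)
      (fibreCoord_dual x.proj μ.proj μ.2)).symm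
    exact (congrArg μ.2 h2).symm
  have hA : HasMFDerivAt (I.prod 𝓘(ℝ, F →L[ℝ] ℝ)) 𝓘(ℝ, F →L[ℝ] ℝ)
      (fibreCoord (F →L[ℝ] ℝ) x.proj : DualTotal F 𝒦 → F →L[ℝ] ℝ) x
      (ContinuousLinearMap.snd ℝ E (F →L[ℝ] ℝ)) := by
    rw [← mfderiv_fibreCoord (I := I) x]
    exact ((contMDiffAt_fibreCoord (I := I) (x := x)
      (FiberBundle.mem_baseSet_trivializationAt' x.proj)).mdifferentiableAt (by simp)).hasMFDerivAt
  have hp : HasMFDerivAt (I.prod 𝓘(ℝ, F →L[ℝ] ℝ)) I (TotalSpace.proj : DualTotal F 𝒦 → Q) x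
      (ContinuousLinearMap.fst ℝ E (F →L[ℝ] ℝ)) := by
    rw [← mfderiv_totalSpace_proj (I := I) x]
    exact ((contMDiff_proj (n := ∞) _).mdifferentiableAt (by simp)).hasMFDerivAt
  have hx := HasMFDerivAt.comp (I := I.prod 𝓘(ℝ, F →L[ℝ] ℝ)) (I' := I) x
    ((contMDiffAt_fibreCoord_section hX).mdifferentiableAt (by simp)).hasMFDerivAt hp
  have h2 := ((HasMFDerivAt.clm_apply hA hx).congr_of_eventuallyEq h1).mfderiv
  refine (congrArg (fun l : E × (F →L[ℝ] ℝ) →L[ℝ] ℝ => l w) h2).trans ?_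
  exact add_comm _ _

/-- With jet coordinates (ṁ, m), pairing against X^C = (X, DX·v) gives ṁ(X) + m(DX·v), the Leibniz
expansion of d/dt ⟨μ, X⟩; pairing against X^V = (0, X) gives m(X). -/
lemma isTulczyjew_tulczyjew : K.IsTulczyjew K.tulczyjew := by
  intro ξ
  refine ⟨rfl, fun X hX w => ⟨fun hw => ?_, fun hw => ?_⟩⟩
  · have h1 := K.liftEquiv_eq (K.dTan_completeLift hX hw)
    refine (K.dualEquiv_apply _ _ w).trans ?_
    rw [h1]
    refine Eq.trans ?_ (mfderiv_pairing (x := ξ.base) hX ξ.vec).symm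
    refine congrArg (_ + ·) (congrArg (fun a => fibreCoord (F →L[ℝ] ℝ) ξ.base.proj ξ.base
      (sectionDeriv I F X ξ.base.proj a)) (K.jetProj_vec ξ))
  · have h1 := K.liftEquiv_eq ((congrArg _ hw).trans (K.dTan_verticalLift_toVert _ _))
    refine (K.dualEquiv_apply _ _ w).trans ?_
    rw [h1, map_zero, zero_add]
    refine (congrArg (fun l : F →L[ℝ] ℝ => l _)
      (fibreCoord_dual ξ.base.proj ξ.base.proj ξ.base.2)).trans ?_
    exact congrArg ξ.base.2 (frame_fibreCoord
      (x := (⟨ξ.base.proj, X ξ.base.proj⟩ : TotalSpace F 𝒦))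
      (FiberBundle.mem_baseSet_trivializationAt' ξ.base.proj))

end Tulczyjew

end VerticalDistribution

/-! ### Second derivatives of a composition with a linear map and of a bilinear pairing. -/

section SecondDerivatives

variable {V V' W : Type*} [NormedAddCommGroup V] [NormedSpace ℝ V] [NormedAddCommGroup V']
  [NormedSpace ℝ V'] [NormedAddCommGroup W] [NormedSpace ℝ W]

lemma fderiv_fderiv_comp_clm {G : V' → ℝ} (hG : ContDiff ℝ ∞ G) (T : V →L[ℝ] V') (x u u' : V) :
    fderiv ℝ (fderiv ℝ (G ∘ T)) x u u' = fderiv ℝ (fderiv ℝ G) (T x) (T u) (T u') := by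
  have h1 : fderiv ℝ (G ∘ T) = fun y => (fderiv ℝ G (T y)).comp T := by
    funext y
    rw [fderiv_comp y (hG.differentiable (by simp) _) T.differentiableAt, T.fderiv]
  have h2 : HasFDerivAt (fderiv ℝ G) (fderiv ℝ (fderiv ℝ G) (T x)) (T x) :=
    ((hG.fderiv_right (m := ∞) (by simp)).differentiable (by simp) _).hasFDerivAt
  have h3 : HasFDerivAt (fun y => (fderiv ℝ G (T y)).comp T)
      ((ContinuousLinearMap.compL ℝ V V' ℝ).flip T ∘L (fderiv ℝ (fderiv ℝ G) (T x) ∘L T)) x :=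
    ((ContinuousLinearMap.compL ℝ V V' ℝ).flip T).hasFDerivAt.comp x (h2.comp x T.hasFDerivAt)
  rw [h1, h3.fderiv]
  rfl

/-- The function is a polynomial of degree two; the shift κ₀ enters only its linear part, and the
Hessian is the polarised quadratic part. -/
lemma fderiv_fderiv_pairing (B : V →L[ℝ] W →L[ℝ] ℝ) (κ : V →L[ℝ] W) (κ₀ : W) (x u u' : V) :
    fderiv ℝ (fderiv ℝ (fun z => B z (κ₀ + κ z))) x u u' = B u (κ u') + B u' (κ u) := by
  have h1 : fderiv ℝ (fun z => B z (κ₀ + κ z)) =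
      fun z => (B z).comp κ + B.flip (κ₀ + κ z) := by
    funext z
    exact (B.hasFDerivAt.clm_apply (κ.hasFDerivAt.const_add κ₀)).fderiv
  have h2 : HasFDerivAt (fun z => (B z).comp κ + B.flip (κ₀ + κ z))
      ((ContinuousLinearMap.compL ℝ V W ℝ).flip κ ∘L B + B.flip ∘L κ) x :=
    ((((ContinuousLinearMap.compL ℝ V W ℝ).flip κ ∘L B).hasFDerivAt (x := x))).add
      ((B.flip.hasFDerivAt).comp x (κ.hasFDerivAt.const_add κ₀))
  rw [h1, h2.fderiv]
  rfl

end SecondDerivatives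

/-! ### The correction term in coordinates. -/

namespace VerticalDistribution

section Correction

variable {E : Type*} [NormedAddCommGroup E] [NormedSpace ℝ E] [FiniteDimensional ℝ E]
  {H : Type*} [TopologicalSpace H] {I : ModelWithCorners ℝ E H} [I.Boundaryless]
  {Q : Type*} [TopologicalSpace Q] [ChartedSpace H Q]
  {F : Type*} [NormedAddCommGroup F] [NormedSpace ℝ F] [FiniteDimensional ℝ F]
  {𝒦 : Q → Type*} [∀ q, TopologicalSpace (𝒦 q)] [∀ q, AddCommGroup (𝒦 q)] [∀ q, Module ℝ (𝒦 q)]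
  [TopologicalSpace (TotalSpace F 𝒦)] [FiberBundle F 𝒦]
  [IsManifold I ∞ Q] [VectorBundle ℝ F 𝒦] [ContMDiffVectorBundle ∞ F 𝒦 I]
  [∀ q, IsTopologicalAddGroup (𝒦 q)] [∀ q, ContinuousSMul ℝ (𝒦 q)] {ρ : TimeFibration I Q}

/-- The zero section of `𝒦*`. -/
noncomputable def dualZero (F : Type*) [NormedAddCommGroup F] [NormedSpace ℝ F] (𝒦 : Q → Type*)
    [∀ q, TopologicalSpace (𝒦 q)] [∀ q, AddCommGroup (𝒦 q)] [∀ q, Module ℝ (𝒦 q)] :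
    Q → DualTotal F 𝒦 :=
  zeroSection (F →L[ℝ] ℝ) (fun q => 𝒦 q →L[ℝ] ℝ)

lemma contMDiff_dualZero : ContMDiff I (I.prod 𝓘(ℝ, F →L[ℝ] ℝ)) ∞ (dualZero F 𝒦) :=
  contMDiff_zeroSection ℝ (fun q => 𝒦 q →L[ℝ] ℝ)

lemma mfderiv_dualZero (q : Q) (a : E) :
    (mfderiv I (I.prod 𝓘(ℝ, F →L[ℝ] ℝ)) (dualZero F 𝒦) q a : E × (F →L[ℝ] ℝ)) = (a, 0) := by
  refine (mfderiv_totalSpace_apply ((contMDiff_dualZero (I := I)).mdifferentiableAt (by simp))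
    a).trans (Prod.ext ?_ ?_)
  · have h3 : mfderiv I I (fun q' : Q => q') q = ContinuousLinearMap.id ℝ E := mfderiv_id
    exact congrArg (fun l : E →L[ℝ] E => l a) h3
  · have h : (fun q' => fibreCoord (F →L[ℝ] ℝ) q (dualZero F 𝒦 q')) = fun _ => 0 := by
      funext q'
      refine (fibreCoord_dual q q' 0).trans ?_
      exact ContinuousLinearMap.zero_comp _
    change (mfderiv I 𝓘(ℝ, F →L[ℝ] ℝ) (fun q' => fibreCoord (F →L[ℝ] ℝ) q (dualZero F 𝒦 q')) q a
      : F →L[ℝ] ℝ) = 0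
    rw [h, mfderiv_const]
    rfl

/-- The vertical lift in the coordinates of the preferred chart at `x₀`. -/
lemma fibreCoord_fibreLift {x₀ x : DualTotal F 𝒦}
    (hx : x.proj ∈ (trivializationAt F 𝒦 x₀.proj).baseSet)
    (hx' : x.proj ∈ (chartAt H x₀.proj).source) (β : 𝒦 x.proj →L[ℝ] ℝ) :
    fibreCoord (E × (F →L[ℝ] ℝ)) x₀ (⟨x, fibreLift I x β⟩ :
      TangentBundle (I.prod 𝓘(ℝ, F →L[ℝ] ℝ)) (DualTotal F 𝒦)) =
        (0, β.comp (frame F x₀.proj x.proj)) := by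
  let f : ℝ → 𝒦 x.proj →L[ℝ] ℝ := fun s => x.2 + s • β
  let ℓ : ℝ →L[ℝ] (𝒦 x.proj →L[ℝ] ℝ) := ContinuousLinearMap.toSpanSingleton ℝ β
  have hf : ∀ s, f s = x.2 + ℓ s := fun s => rfl
  have hfx : (⟨x.proj, f 0⟩ : DualTotal F 𝒦) = x := by
    simp [f]
  have hs : x ∈ (extChartAt (I.prod 𝓘(ℝ, F →L[ℝ] ℝ)) x₀).source := by
    rw [mem_source_extChartAt_totalSpace, extChartAt_source]
    exact ⟨mem_baseSet_dual hx, hx'⟩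
  have h1 := mfderiv_comp_apply (I := 𝓘(ℝ, ℝ)) (I' := I.prod 𝓘(ℝ, F →L[ℝ] ℝ))
    (I'' := 𝓘(ℝ, E × (F →L[ℝ] ℝ))) (0 : ℝ)
    (f := fun s => (⟨x.proj, f s⟩ : DualTotal F 𝒦)) (g := extChartAt (I.prod 𝓘(ℝ, F →L[ℝ] ℝ)) x₀)
    (by
      rw [hfx]
      exact ((contMDiffAt_extChartAt' (n := ∞) (by rwa [extChartAt_source] at hs)).mdifferentiableAt
        (by simp)))
    ((contMDiff_fibre_affine (I := I) (F := F →L[ℝ] ℝ) x ℓ hf).mdifferentiableAt (by simp)) (1 : ℝ)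
  have h2 : (extChartAt (I.prod 𝓘(ℝ, F →L[ℝ] ℝ)) x₀) ∘ (fun s => (⟨x.proj, f s⟩ : DualTotal F 𝒦)) =
      fun s => (extChartAt I x₀.proj x.proj, x.2.comp (frame F x₀.proj x.proj) +
        s • β.comp (frame F x₀.proj x.proj)) := by
    funext s
    refine (extChartAt_totalSpace_apply (I := I) x₀ (y := (⟨x.proj, f s⟩ : DualTotal F 𝒦))
      (mem_baseSet_dual hx)).trans (Prod.ext rfl ?_)
    refine (fibreCoord_dual x₀.proj x.proj (f s)).trans ?_
    ext c
    rfl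
  have h3 : HasFDerivAt (fun s : ℝ => (extChartAt I x₀.proj x.proj,
      x.2.comp (frame F x₀.proj x.proj) + s • β.comp (frame F x₀.proj x.proj)))
      ((0 : ℝ →L[ℝ] E).prod (ContinuousLinearMap.toSpanSingleton ℝ
        (β.comp (frame F x₀.proj x.proj)))) 0 :=
    (hasFDerivAt_const _ _).prodMk
      ((ContinuousLinearMap.toSpanSingleton ℝ (β.comp (frame F x₀.proj x.proj))).hasFDerivAt.const_add
        _)
  rw [h2, mfderiv_eq_fderiv, h3.fderiv] at h1
  rw [fibreCoord_tangent (by rwa [extChartAt_source] at hs)]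
  have h4 : ∀ y : DualTotal F 𝒦, y = x → (mfderiv (I.prod 𝓘(ℝ, F →L[ℝ] ℝ)) 𝓘(ℝ, E × (F →L[ℝ] ℝ))
      (extChartAt (I.prod 𝓘(ℝ, F →L[ℝ] ℝ)) x₀) y : E × (F →L[ℝ] ℝ) →L[ℝ] E × (F →L[ℝ] ℝ)) =
      mfderiv (I.prod 𝓘(ℝ, F →L[ℝ] ℝ)) 𝓘(ℝ, E × (F →L[ℝ] ℝ))
      (extChartAt (I.prod 𝓘(ℝ, F →L[ℝ] ℝ)) x₀) x := by rintro _ rfl; rfl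
  refine (congrArg (fun l : E × (F →L[ℝ] ℝ) →L[ℝ] E × (F →L[ℝ] ℝ) => l (fibreLift I x β))
    (h4 _ hfx)).symm.trans ?_
  exact h1.symm.trans (Prod.ext rfl (one_smul ℝ (β.comp (frame F x₀.proj x.proj))))

lemma fibreLift_eq (x : DualTotal F 𝒦) (β : 𝒦 x.proj →L[ℝ] ℝ) :
    (fibreLift I x β : E × (F →L[ℝ] ℝ)) = (0, β.comp (frame F x.proj x.proj)) := by
  have h := fibreCoord_fibreLift (I := I) (x₀ := x)
    (FiberBundle.mem_baseSet_trivializationAt' x.proj) (mem_chart_source H x.proj) β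
  exact (fibreCoord_tangent_self (⟨x, fibreLift I x β⟩ :
      TangentBundle (I.prod 𝓘(ℝ, F →L[ℝ] ℝ)) (DualTotal F 𝒦))).symm.trans h

/-- The projector takes values in the kernel of the projection to Q, which is filled by the vertical
lifts, so `Function.invFun` returns an actual preimage. -/
lemma fibreLift_invFun_vproj (C : DualConnection I F 𝒦) (x : DualTotal F 𝒦)
    (w : TangentSpace (I.prod 𝓘(ℝ, F →L[ℝ] ℝ)) x) :
    fibreLift I x (Function.invFun (fibreLift I x) (C.vproj x w)) = C.vproj x w := by
  refine Function.invFun_eq ?_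
  have h : C.vproj x w ∈ LinearMap.ker (dualProj I x).toLinearMap := by
    rw [← C.range_eq]; exact ⟨w, rfl⟩
  have h1 : (C.vproj x w : E × (F →L[ℝ] ℝ)).1 = 0 := (dualProj_apply x _).symm.trans h
  refine ⟨dualOfCoord 𝒦 x.proj (C.vproj x w : E × (F →L[ℝ] ℝ)).2, (fibreLift_eq x _).trans ?_⟩
  refine Prod.ext h1.symm ?_
  exact (fibreCoord_dual _ _ _).symm.trans (fibreCoord_dualOfCoord x.proj _)

/-- At the zero section, the vertical projector is the canonical one. -/
lemma vproj_dualZero (C : DualConnection I F 𝒦) (q : Q) (w : E × (F →L[ℝ] ℝ)) :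
    (C.vproj (dualZero F 𝒦 q) w : E × (F →L[ℝ] ℝ)) = (0, w.2) := by
  let l : E × (F →L[ℝ] ℝ) →L[ℝ] E × (F →L[ℝ] ℝ) := C.vproj (dualZero F 𝒦 q)
  -- Vectors (a, 0) are tangent to the zero section, hence horizontal there; vectors (0, η) are
  -- vertical, hence fixed by the idempotent projector.
  have h1 : l (w.1, 0) = 0 := by
    have : (w.1, (0 : F →L[ℝ] ℝ)) ∈ LinearMap.ker l.toLinearMap := by
      have h2 := C.zero_section q
      have h3 : (w.1, (0 : F →L[ℝ] ℝ)) ∈ LinearMap.range (mfderiv I (I.prod 𝓘(ℝ, F →L[ℝ] ℝ))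
        (zeroSection (F →L[ℝ] ℝ) (fun q => 𝒦 q →L[ℝ] ℝ)) q).toLinearMap :=
        ⟨w.1, mfderiv_dualZero q w.1⟩
      rw [← h2] at h3
      exact h3
    exact this
  have h2 : l (0, w.2) = (0, w.2) := by
    have h3 : ((0 : E), w.2) ∈ LinearMap.ker (dualProj I (dualZero F 𝒦 q)).toLinearMap :=
      dualProj_apply (dualZero F 𝒦 q) (0, w.2)
    rw [← C.range_eq] at h3
    obtain ⟨w', hw'⟩ := h3
    have h4 := C.idem (dualZero F 𝒦 q) w'
    have h5 : l w' = (0, w.2) := hw'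
    have h6 : l (l w') = l w' := h4
    rw [h5] at h6
    exact h6
  have h3 : w = (w.1, 0) + (0, w.2) := by simp
  change l w = _
  rw [h3, map_add, h1, h2]
  simp

variable {K : VerticalDistribution ρ F 𝒦}

/-- The coordinates of the projection onto `K` at `q`. -/
noncomputable def projCoord (P : AlmostProduct K) (q : Q) (u : E) : F :=
  fibreCoord F q (⟨q, Function.invFun (K.incl q) (P.proj q u)⟩ : TotalSpace F 𝒦)

lemma incl_invFun_proj (P : AlmostProduct K) (q : Q) (u : TangentSpace I q) :
    K.incl q (Function.invFun (K.incl q) (P.proj q u)) = P.proj q u := by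
  refine Function.invFun_eq ?_
  have h : P.proj q u ∈ LinearMap.range (K.incl q).toLinearMap := by
    rw [← P.range_eq]; exact ⟨u, rfl⟩
  exact h

lemma inclCoord_projCoord (P : AlmostProduct K) (q : Q) (u : E) :
    K.inclCoord q q (projCoord P q u) = (P.proj q u : E) :=
  (K.inclCoord_fibreCoord q _).trans (incl_invFun_proj P q u)

/-- The coordinates of the projection onto `K` at `q`, as a linear map. -/
noncomputable def projCoordL (P : AlmostProduct K) (q : Q) : E →L[ℝ] F :=
  LinearMap.toContinuousLinearMap
    { toFun := projCoord P q
      map_add' := fun u u' => by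
        refine K.inclCoord_self_injective q ?_
        rw [map_add, inclCoord_projCoord, inclCoord_projCoord, inclCoord_projCoord]
        exact map_add (P.proj q) _ _
      map_smul' := fun c u => by
        refine K.inclCoord_self_injective q ?_
        rw [RingHom.id_apply, map_smul, inclCoord_projCoord, inclCoord_projCoord]
        exact map_smul (P.proj q) _ _ }

/-- An idempotent fixes its image, which is K. This identity turns the values of covectors on P into
their values on arbitrary elements of the frame of K. -/
lemma projCoordL_eq_self (P : AlmostProduct K) (q : Q) (c : F) :
    projCoordL P q (K.inclCoord q q c) = c := by
  refine K.inclCoord_self_injective q ?_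
  refine (inclCoord_projCoord P q _).trans ?_
  rw [inclCoord_self]
  have h : (K.incl q (frame F q q c)) ∈ LinearMap.range (P.proj q).toLinearMap := by
    rw [P.range_eq]; exact ⟨_, rfl⟩
  obtain ⟨u, hu⟩ := h
  have hu' : P.proj q u = K.incl q (frame F q q c) := hu
  rw [← hu']
  exact P.idem q u

/-- The frame at the base point of ξ occurs once in the coordinates of the covector and once,
inverted, in those of the vector, so it cancels from the pairing. -/
lemma correction_eq (P : AlmostProduct K) (C : DualConnection I F 𝒦) (ξ : K.ext.Jet) :
    correction P C ξ = (C.vproj ξ.base ξ.vec : E × (F →L[ℝ] ℝ)).2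
      (projCoordL P ξ.base.proj (ξ.vec : E × (F →L[ℝ] ℝ)).1) := by
  have h1 := (fibreLift_eq ξ.base _).symm.trans (fibreLift_invFun_vproj C ξ.base ξ.vec)
  have h2 := congrArg Prod.snd h1
  rw [← h2, ← jetProj_vec]
  have h3 : frame F ξ.base.proj ξ.base.proj (projCoord P ξ.base.proj (K.jetProj ξ).vec) =
      Function.invFun (K.incl ξ.base.proj) (P.proj ξ.base.proj (K.jetProj ξ).vec) :=
    frame_fibreCoord (x := (⟨ξ.base.proj, Function.invFun (K.incl ξ.base.proj)
      (P.proj ξ.base.proj (K.jetProj ξ).vec)⟩ : TotalSpace F 𝒦))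
      (FiberBundle.mem_baseSet_trivializationAt' ξ.base.proj)
  exact (congrArg (fun k : 𝒦 ξ.base.proj =>
    (Function.invFun (fibreLift I ξ.base) (C.vproj ξ.base ξ.vec) : 𝒦 ξ.base.proj →L[ℝ] ℝ) k) h3).symm

end Correction

end VerticalDistribution

/-! ### The zero section embedding and the Hessian of the extended Lagrangian along it. -/

namespace VerticalDistribution

section ZeroSection

variable {E : Type*} [NormedAddCommGroup E] [NormedSpace ℝ E] [FiniteDimensional ℝ E]
  {H : Type*} [TopologicalSpace H] {I : ModelWithCorners ℝ E H} [I.Boundaryless]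
  {Q : Type*} [TopologicalSpace Q] [ChartedSpace H Q]
  {F : Type*} [NormedAddCommGroup F] [NormedSpace ℝ F] [FiniteDimensional ℝ F]
  {𝒦 : Q → Type*} [∀ q, TopologicalSpace (𝒦 q)] [∀ q, AddCommGroup (𝒦 q)] [∀ q, Module ℝ (𝒦 q)]
  [TopologicalSpace (TotalSpace F 𝒦)] [FiberBundle F 𝒦]
  [IsManifold I ∞ Q] [VectorBundle ℝ F 𝒦] [ContMDiffVectorBundle ∞ F 𝒦 I]
  [∀ q, IsTopologicalAddGroup (𝒦 q)] [∀ q, ContinuousSMul ℝ (𝒦 q)] {ρ : TimeFibration I Q}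

variable (K : VerticalDistribution ρ F 𝒦)

/-- The embedding of `J¹ρ` into `J¹ρ_K` induced by the zero section. -/
noncomputable def zeroJet : ρ.Jet → K.ext.Jet :=
  TimeFibration.prolong (ρ' := K.ext) (contMDiff_dualZero (I := I)) fun _ => rfl

lemma contMDiff_zeroJet : ContMDiff 𝓘(ℝ, JetModel E) 𝓘(ℝ, JetModel (E × (F →L[ℝ] ℝ))) ∞ K.zeroJet :=
  TimeFibration.contMDiff_prolong _ _

lemma contMDiff_jetProj :
    ContMDiff 𝓘(ℝ, JetModel (E × (F →L[ℝ] ℝ))) 𝓘(ℝ, JetModel E) ∞ K.jetProj :=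
  TimeFibration.contMDiff_prolong (ρ := K.ext) (ρ' := ρ) (contMDiff_proj _) fun _ => rfl

lemma zeroJet_vec (v : ρ.Jet) : ((K.zeroJet v).vec : E × (F →L[ℝ] ℝ)) = (v.vec, 0) :=
  mfderiv_dualZero v.base v.vec

lemma jetProj_zeroJet (v : ρ.Jet) : K.jetProj (K.zeroJet v) = v := by
  apply Subtype.ext
  have h := (dualProj_apply (I := I) (K.zeroJet v).base (K.zeroJet v).vec).trans
    (congrArg Prod.fst (K.zeroJet_vec v))
  exact congrArg (fun c : E => (⟨v.base, c⟩ : TangentBundle I Q)) h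

/-- The prolonged zero section has velocity and value zero in 𝒦*. This identifies the embedding of
the theorem with a jet prolongation, to which naturality of θ_L applies. -/
lemma tulczyjew_zeroJet (v : ρ.Jet) : K.tulczyjew (K.zeroJet v) = K.zeroDual v := by
  have h1 : K.jetEquiv (K.zeroJet v) = (v, (0, 0)) := by
    refine Prod.ext (K.jetProj_zeroJet v) (Prod.ext ?_ ?_)
    · exact congrArg Prod.snd (K.zeroJet_vec v)
    · refine (fibreCoord_dual v.base v.base 0).trans ?_
      exact ContinuousLinearMap.zero_comp _
  have h2 : K.dualEquiv v (0, 0) = 0 := by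
    apply LinearMap.ext
    intro w
    rw [dualEquiv_apply]
    simp
  change (⟨(K.jetEquiv (K.zeroJet v)).1, K.dualEquiv _ (K.jetEquiv (K.zeroJet v)).2⟩ :
    K.DualCompleteLift) = ⟨v, 0⟩
  rw [h1, h2]

/-- The vertical part over `Q` of a vertical vector of `𝒦*`. -/
noncomputable def vertProj (v : ρ.Jet) : K.ext.vert (K.zeroJet v).base →L[ℝ] ρ.vert v.base :=
  ((ContinuousLinearMap.fst ℝ E (F →L[ℝ] ℝ)).comp
    (K.ext.vert (K.zeroJet v).base).subtypeL).codRestrict _ fun z =>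
      (K.ext_dAt_apply _ _).symm.trans z.2

lemma jetProj_translate (v : ρ.Jet) (z : K.ext.vert (K.zeroJet v).base) :
    K.jetProj ((K.zeroJet v).translate z) = v.translate (K.vertProj v z) := by
  apply Subtype.ext
  have h : (dualProj I (K.zeroJet v).base ((K.zeroJet v).vec + z.1 : E × (F →L[ℝ] ℝ)) : E) =
      v.vec + z.1.1 := by
    refine (dualProj_apply (I := I) (K.zeroJet v).base _).trans ?_
    exact congrArg (· + z.1.1) (congrArg Prod.fst (K.zeroJet_vec v))
  exact congrArg (fun c : E => (⟨v.base, c⟩ : TangentBundle I Q)) h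

variable {K} (P : AlmostProduct K) (C : DualConnection I F 𝒦)

/-- Translating a jet leaves its base point on the zero section, where the vertical projector is
canonical. The formula is therefore exact on the whole fibre, and the connection drops out of it. -/
lemma correction_translate (v : ρ.Jet) (z : K.ext.vert (K.zeroJet v).base) :
    correction P C ((K.zeroJet v).translate z) =
      z.1.2 (projCoordL P v.base v.vec + projCoordL P v.base z.1.1) := by
  refine (correction_eq P C _).trans ?_
  have h1 : (((K.zeroJet v).translate z).vec : E × (F →L[ℝ] ℝ)) = (v.vec + z.1.1, z.1.2) := by
    have h : ((K.zeroJet v).translate z).vec = ((K.zeroJet v).vec + z.1 : E × (F →L[ℝ] ℝ)) := rfl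
    rw [h, zeroJet_vec]
    exact Prod.ext rfl (zero_add _)
  have h2 := vproj_dualZero C v.base (((K.zeroJet v).translate z).vec)
  have h3 : (C.vproj ((K.zeroJet v).translate z).base ((K.zeroJet v).translate z).vec :
      E × (F →L[ℝ] ℝ)).2 = z.1.2 := by
    have h4 := congrArg Prod.snd h1
    exact (congrArg Prod.snd h2).trans h4
  rw [h3]
  refine congrArg z.1.2 ?_
  exact (congrArg (fun c : E × (F →L[ℝ] ℝ) => projCoordL P v.base c.1) h1).trans (map_add _ _ _)

lemma extendedLagrangian_zeroJet (L : ρ.Jet → ℝ) (v : ρ.Jet) :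
    extendedLagrangian L P C (K.zeroJet v) = L v := by
  have h := correction_translate P C v 0
  rw [TimeFibration.Jet.translate_zero] at h
  rw [extendedLagrangian, h, jetProj_zeroJet]
  simp

/-- The fibre Hessian of the extended Lagrangian along the zero section. -/
lemma fibreHessian_extendedLagrangian {L : ρ.Jet → ℝ}
    (hL : ContMDiff 𝓘(ℝ, JetModel E) 𝓘(ℝ, ℝ) ∞ L) (v : ρ.Jet) (z z' : K.ext.vert (K.zeroJet v).base) :
    (K.zeroJet v).fibreHessian (extendedLagrangian L P C) z z' =
      v.fibreHessian L (K.vertProj v z) (K.vertProj v z') +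
        (z.1.2 (projCoordL P v.base z'.1.1) + z'.1.2 (projCoordL P v.base z.1.1)) := by
  let V := K.ext.vert (K.zeroJet v).base
  let B : V →L[ℝ] F →L[ℝ] ℝ := (ContinuousLinearMap.snd ℝ E (F →L[ℝ] ℝ)).comp V.subtypeL
  let κ : V →L[ℝ] F := (projCoordL P v.base).comp
    ((ContinuousLinearMap.fst ℝ E (F →L[ℝ] ℝ)).comp V.subtypeL)
  -- On this fibre L̃ is L composed with a linear projection plus a polynomial pairing, and the two
  -- Hessian formulas apply separately.
  have h1 : extendedLagrangian L P C ∘ (K.zeroJet v).translate = (L ∘ v.translate) ∘ K.vertProj v +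
      fun z : V => B z (projCoordL P v.base v.vec + κ z) := by
    funext z
    change L (K.jetProj ((K.zeroJet v).translate z)) + correction P C ((K.zeroJet v).translate z) = _
    rw [jetProj_translate, correction_translate]
    rfl
  have hG : ContDiff ℝ ∞ (L ∘ v.translate) := (hL.comp (v.contMDiff_translate)).contDiff
  have hs1 : ContDiff ℝ ∞ ((L ∘ v.translate) ∘ K.vertProj v) := hG.comp (K.vertProj v).contDiff
  have hs2 : ContDiff ℝ ∞ (fun z : V => B z (projCoordL P v.base v.vec + κ z)) :=
    B.contDiff.clm_apply (contDiff_const.add κ.contDiff)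
  have h2 : fderiv ℝ (extendedLagrangian L P C ∘ (K.zeroJet v).translate) =
      fderiv ℝ ((L ∘ v.translate) ∘ K.vertProj v) +
        fderiv ℝ (fun z : V => B z (projCoordL P v.base v.vec + κ z)) := by
    rw [h1]
    funext y
    exact fderiv_add (hs1.differentiable (by simp) y) (hs2.differentiable (by simp) y)
  have h3 : fderiv ℝ (fderiv ℝ (extendedLagrangian L P C ∘ (K.zeroJet v).translate)) 0 =
      fderiv ℝ (fderiv ℝ ((L ∘ v.translate) ∘ K.vertProj v)) 0 +
        fderiv ℝ (fderiv ℝ (fun z : V => B z (projCoordL P v.base v.vec + κ z))) 0 := by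
    rw [h2]
    exact fderiv_add ((hs1.fderiv_right (m := ∞) (by simp)).differentiable (by simp) 0)
      ((hs2.fderiv_right (m := ∞) (by simp)).differentiable (by simp) 0)
  rw [TimeFibration.Jet.fibreHessian, h3, add_apply,
    add_apply, fderiv_fderiv_comp_clm hG, fderiv_fderiv_pairing, map_zero]
  rfl

end ZeroSection

/-! ### Smoothness of the extended Lagrangian. -/

section Smoothness

variable {E : Type*} [NormedAddCommGroup E] [NormedSpace ℝ E] [FiniteDimensional ℝ E]
  {H : Type*} [TopologicalSpace H] {I : ModelWithCorners ℝ E H} [I.Boundaryless]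
  {Q : Type*} [TopologicalSpace Q] [ChartedSpace H Q]
  {F : Type*} [NormedAddCommGroup F] [NormedSpace ℝ F] [FiniteDimensional ℝ F]
  {𝒦 : Q → Type*} [∀ q, TopologicalSpace (𝒦 q)] [∀ q, AddCommGroup (𝒦 q)] [∀ q, Module ℝ (𝒦 q)]
  [TopologicalSpace (TotalSpace F 𝒦)] [FiberBundle F 𝒦]
  [IsManifold I ∞ Q] [VectorBundle ℝ F 𝒦] [ContMDiffVectorBundle ∞ F 𝒦 I]
  [∀ q, IsTopologicalAddGroup (𝒦 q)] [∀ q, ContinuousSMul ℝ (𝒦 q)] {ρ : TimeFibration I Q}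
  {K : VerticalDistribution ρ F 𝒦}

/-- Fix a left inverse ℓ of A(p). Near p the endomorphism ℓ ∘ A(q) stays invertible, and (ℓ ∘
A(q))⁻¹ ∘ ℓ is a left inverse of A(q) depending smoothly on q. -/
lemma exists_smooth_leftInverse {M : Type*} [TopologicalSpace M] [ChartedSpace H M]
    {A : M → F →L[ℝ] E} {p : M} (hA : ContMDiffAt I 𝓘(ℝ, F →L[ℝ] E) ∞ A p)
    (hi : Function.Injective (A p)) :
    ∃ B : M → E →L[ℝ] F, ContMDiffAt I 𝓘(ℝ, E →L[ℝ] F) ∞ B p ∧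
      ∀ᶠ q in 𝓝 p, ∀ c, B q (A q c) = c := by
  obtain ⟨g, hg⟩ := (A p).toLinearMap.exists_leftInverse_of_injective (LinearMap.ker_eq_bot.2 hi)
  let ℓ : E →L[ℝ] F := LinearMap.toContinuousLinearMap g
  have hℓ : ℓ.comp (A p) = ((ContinuousLinearEquiv.refl ℝ F : F ≃L[ℝ] F) : F →L[ℝ] F) := by
    ext c
    exact congrArg (fun l : F →ₗ[ℝ] F => l c) hg
  have h1 : ContMDiffAt I 𝓘(ℝ, F →L[ℝ] F) ∞ (fun q => ℓ.comp (A q)) p :=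
    (ContinuousLinearMap.compL ℝ F E F ℓ).contDiff.contMDiff.contMDiffAt.comp p hA
  have h2 : ContDiffAt ℝ ∞ (ContinuousLinearMap.inverse : (F →L[ℝ] F) → F →L[ℝ] F)
      (ℓ.comp (A p)) := by
    rw [hℓ]
    exact contDiffAt_map_inverse _
  have h3 : ContMDiffAt I 𝓘(ℝ, F →L[ℝ] F) ∞
      (fun q => ContinuousLinearMap.inverse (ℓ.comp (A q))) p :=
    ContMDiffAt.comp p h2.contMDiffAt h1
  refine ⟨fun q => (ContinuousLinearMap.inverse (ℓ.comp (A q))).comp ℓ,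
    ((ContinuousLinearMap.compL ℝ E F F).flip ℓ).contDiff.contMDiff.contMDiffAt.comp p h3, ?_⟩
  have h4 : ∀ᶠ q in 𝓝 p, ℓ.comp (A q) ∈ Set.range ((↑) : (F ≃L[ℝ] F) → F →L[ℝ] F) :=
    h1.continuousAt.eventually (ContinuousLinearEquiv.isOpen.mem_nhds ⟨_, hℓ.symm⟩)
  filter_upwards [h4] with q hq c
  obtain ⟨e, he⟩ := hq
  change ContinuousLinearMap.inverse (ℓ.comp (A q)) (ℓ.comp (A q) c) = c
  rw [← he, ContinuousLinearMap.inverse_equiv]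
  exact e.symm_apply_apply c

variable (P : AlmostProduct K) (C : DualConnection I F 𝒦)

/-- The fibrewise inverses in the correction carry no smoothness of their own. In the
trivialisations at ξ₀, the covector is read off directly from the smooth field `C.vproj`, and the
element of K is recovered from P by a smooth left inverse of the inclusion. -/
lemma contMDiff_correction :
    ContMDiff 𝓘(ℝ, JetModel (E × (F →L[ℝ] ℝ))) 𝓘(ℝ, ℝ) ∞ (correction P C) := by
  intro ξ₀
  have hb := FiberBundle.mem_baseSet_trivializationAt' (F := F) (E := 𝒦) ξ₀.base.proj
  obtain ⟨B, hB, hBA⟩ := exists_smooth_leftInverse (K.contMDiffAt_inclCoord ξ₀.base.proj)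
    (K.inclCoord_self_injective ξ₀.base.proj)
  let pr : K.ext.Jet → Q := fun ξ => ξ.base.proj
  have hpr : ContMDiff 𝓘(ℝ, JetModel (E × (F →L[ℝ] ℝ))) I ∞ pr :=
    (contMDiff_proj _).comp TimeFibration.Jet.contMDiff_base
  let β : K.ext.Jet → F →L[ℝ] ℝ := fun ξ => (fibreCoord (E × (F →L[ℝ] ℝ)) ξ₀.base
    (⟨ξ.base, C.vproj ξ.base ξ.vec⟩ :
      TangentBundle (I.prod 𝓘(ℝ, F →L[ℝ] ℝ)) (DualTotal F 𝒦))).2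
  let u : K.ext.Jet → E := fun ξ => fibreCoord E ξ₀.base.proj
    (⟨ξ.base.proj, P.proj ξ.base.proj (K.jetProj ξ).vec⟩ : TangentBundle I Q)
  have hβ : ContMDiffAt 𝓘(ℝ, JetModel (E × (F →L[ℝ] ℝ))) 𝓘(ℝ, F →L[ℝ] ℝ) ∞ β ξ₀ := by
    have h1 := (contMDiffAt_fibreCoord (I := I.prod 𝓘(ℝ, F →L[ℝ] ℝ)) (F := E × (F →L[ℝ] ℝ))
      (q := ξ₀.base) (x := (⟨ξ₀.base, C.vproj ξ₀.base ξ₀.vec⟩ :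
      TangentBundle (I.prod 𝓘(ℝ, F →L[ℝ] ℝ)) (DualTotal F 𝒦)))
      (FiberBundle.mem_baseSet_trivializationAt' _)).comp
      (f := fun ξ : K.ext.Jet => (⟨ξ.base, C.vproj ξ.base ξ.vec⟩ :
        TangentBundle (I.prod 𝓘(ℝ, F →L[ℝ] ℝ)) (DualTotal F 𝒦))) ξ₀
      ((C.smooth.comp TimeFibration.Jet.contMDiff_toTangent).contMDiffAt)
    exact (contDiff_snd.contMDiff).contMDiffAt.comp ξ₀ h1
  have hu : ContMDiffAt 𝓘(ℝ, JetModel (E × (F →L[ℝ] ℝ))) 𝓘(ℝ, E) ∞ u ξ₀ :=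
    (contMDiffAt_fibreCoord (I := I) (F := E)
      (q := ξ₀.base.proj) (x := (⟨ξ₀.base.proj, P.proj ξ₀.base.proj (K.jetProj ξ₀).vec⟩ :
        TangentBundle I Q)) (FiberBundle.mem_baseSet_trivializationAt' _)).comp
      (f := fun ξ : K.ext.Jet => (⟨ξ.base.proj, P.proj ξ.base.proj (K.jetProj ξ).vec⟩ :
        TangentBundle I Q)) ξ₀
      ((P.smooth.comp (TimeFibration.Jet.contMDiff_toTangent.comp K.contMDiff_jetProj)).contMDiffAt)
  have hBpr := ContMDiffAt.comp ξ₀ (I' := I) (g := B) (f := pr) hB hpr.contMDiffAt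
  have hs := hβ.clm_apply (hBpr.clm_apply hu)
  refine hs.congr_of_eventuallyEq ?_
  filter_upwards [hpr.continuous.continuousAt.eventually hBA,
    hpr.continuous.continuousAt.eventually ((trivializationAt F 𝒦 ξ₀.base.proj).open_baseSet.mem_nhds hb),
    hpr.continuous.continuousAt.eventually
      ((chartAt H ξ₀.base.proj).open_source.mem_nhds (mem_chart_source H _))] with ξ h1 h2 h3
  have h4 := frame_fibreCoord (x := (⟨ξ.base.proj, Function.invFun (K.incl ξ.base.proj)
    (P.proj ξ.base.proj (K.jetProj ξ).vec)⟩ : TotalSpace F 𝒦)) h2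
  have h5 : β ξ = (Function.invFun (fibreLift I ξ.base) (C.vproj ξ.base ξ.vec)).comp
      (frame F ξ₀.base.proj ξ.base.proj) := by
    have := fibreCoord_fibreLift (I := I) (x₀ := ξ₀.base) (x := ξ.base) h2 h3
      (Function.invFun (fibreLift I ξ.base) (C.vproj ξ.base ξ.vec))
    have h7 := congrArg (fun w : E × (F →L[ℝ] ℝ) => fibreCoord (E × (F →L[ℝ] ℝ)) ξ₀.base
      (⟨ξ.base, w⟩ : TangentBundle (I.prod 𝓘(ℝ, F →L[ℝ] ℝ)) (DualTotal F 𝒦)))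
      (fibreLift_invFun_vproj C ξ.base ξ.vec)
    exact congrArg Prod.snd (h7.symm.trans this)
  have h6 : u ξ = K.inclCoord ξ₀.base.proj ξ.base.proj (fibreCoord F ξ₀.base.proj
      (⟨ξ.base.proj, Function.invFun (K.incl ξ.base.proj)
        (P.proj ξ.base.proj (K.jetProj ξ).vec)⟩ : TotalSpace F 𝒦)) := by
    rw [K.inclCoord_apply h3]
    have h7 := (congrArg (K.incl ξ.base.proj) h4).trans
      (incl_invFun_proj P ξ.base.proj (K.jetProj ξ).vec)
    exact (congrArg (fun c => fibreCoord E ξ₀.base.proj (⟨ξ.base.proj, c⟩ : TangentBundle I Q))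
      h7).symm
  -- β is the covector composed with the frame and B(u) gives the frame coordinates of the vector,
  -- so the frame cancels.
  change correction P C ξ = β ξ (B (pr ξ) (u ξ))
  rw [h5, h6, h1]
  exact (congrArg (fun k : 𝒦 ξ.base.proj =>
    (Function.invFun (fibreLift I ξ.base) (C.vproj ξ.base ξ.vec) : 𝒦 ξ.base.proj →L[ℝ] ℝ) k) h4).symm

lemma contMDiff_extendedLagrangian {L : ρ.Jet → ℝ}
    (hL : ContMDiff 𝓘(ℝ, JetModel E) 𝓘(ℝ, ℝ) ∞ L) :
    ContMDiff 𝓘(ℝ, JetModel (E × (F →L[ℝ] ℝ))) 𝓘(ℝ, ℝ) ∞ (extendedLagrangian L P C) :=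
  (hL.comp K.contMDiff_jetProj).add (contMDiff_correction P C)

end Smoothness

end VerticalDistribution

/-! ### Hausdorffness of total spaces. -/

section Separation

variable {B : Type*} [TopologicalSpace B] {F : Type*} [TopologicalSpace F]
  {Z : B → Type*} [∀ q, TopologicalSpace (Z q)] [TopologicalSpace (TotalSpace F Z)]
  [FiberBundle F Z]

/-- The total space of a fibre bundle with Hausdorff base and fibre is Hausdorff. -/
lemma FiberBundle.t2Space_totalSpace [T2Space B] [T2Space F] : T2Space (TotalSpace F Z) := by
  refine ⟨fun x y hxy => ?_⟩
  have hc : Continuous (TotalSpace.proj : TotalSpace F Z → B) := FiberBundle.continuous_proj F Z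
  by_cases h : x.proj = y.proj
  · let e := trivializationAt F Z y.proj
    have hx : x ∈ e.source :=
      e.mem_source.2 (h ▸ FiberBundle.mem_baseSet_trivializationAt' y.proj)
    have hy : y ∈ e.source := e.mem_source.2 (FiberBundle.mem_baseSet_trivializationAt' y.proj)
    have hne : e x ≠ e y := fun he => hxy (e.injOn hx hy he)
    obtain ⟨u, v, hu, hv, hxu, hyv, huv⟩ := t2_separation hne
    exact ⟨_, _, e.toOpenPartialHomeomorph.isOpen_inter_preimage hu,
      e.toOpenPartialHomeomorph.isOpen_inter_preimage hv, ⟨hx, hxu⟩, ⟨hy, hyv⟩,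
      Set.disjoint_left.2 fun z hz hz' => Set.disjoint_left.1 huv hz.2 hz'.2⟩
  · obtain ⟨u, v, hu, hv, hxu, hyv, huv⟩ := t2_separation h
    exact ⟨_, _, hu.preimage hc, hv.preimage hc, hxu, hyv, huv.preimage _⟩

end Separation

/-! ### Nondegeneracy of a pair of forms is an open condition. -/

section Nondegeneracy

variable {E : Type*} [NormedAddCommGroup E] [NormedSpace ℝ E]
  {H : Type*} [TopologicalSpace H] {I : ModelWithCorners ℝ E H}
  {M : Type*} [TopologicalSpace M] [ChartedSpace H M]

namespace DForm

/-- The map `v ↦ Ω(v, ·) + τ(v) τ` is injective at `p`. -/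
def NondegenerateAt (Ω : DForm I M 2) (τ : DForm I M 1) (p : M) : Prop :=
  ∀ v : TangentSpace I p,
    (∀ w : TangentSpace I p, Ω p ![v, w] + τ p ![v] * τ p ![w] = 0) → v = 0

lemma map_swap_two {V : Type*} [AddCommGroup V] [Module ℝ V] [TopologicalSpace V]
    (f : V [⋀^Fin 2]→L[ℝ] ℝ) (a b : V) : f ![a, b] = -f ![b, a] := by
  have h := f.toAlternatingMap.map_swap ![b, a] (i := 0) (j := 1) (by simp)
  rw [show ![b, a] ∘ Equiv.swap (0 : Fin 2) 1 = ![a, b] from by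
    funext i; fin_cases i <;> simp] at h
  exact h

lemma map_add_right {V : Type*} [AddCommGroup V] [Module ℝ V] [TopologicalSpace V]
    (f : V [⋀^Fin 2]→L[ℝ] ℝ)
    (a b c : V) : f ![a, b + c] = f ![a, b] + f ![a, c] := by
  rw [map_swap_two f, f.vecCons_add, map_swap_two f a b, map_swap_two f a c]
  ring

/-- The bilinear form `(v, w) ↦ Ω(v, w) + τ(v) τ(w)`. -/
noncomputable def fundamentalForm {V : Type*} [AddCommGroup V] [Module ℝ V] [TopologicalSpace V]
    (f : V [⋀^Fin 2]→L[ℝ] ℝ) (t : V [⋀^Fin 1]→L[ℝ] ℝ) : V →ₗ[ℝ] V →ₗ[ℝ] ℝ :=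
  LinearMap.mk₂ ℝ (fun v w => f ![v, w] + t ![v] * t ![w])
    (fun a b c => by
      rw [f.vecCons_add, t.vecCons_add]; ring)
    (fun r a b => by
      rw [f.vecCons_smul, t.vecCons_smul, smul_eq_mul, smul_eq_mul]
      simp only [smul_eq_mul]; ring)
    (fun a b c => by
      rw [map_add_right, t.vecCons_add]; ring)
    (fun r a b => by
      rw [map_swap_two f, f.vecCons_smul, map_swap_two f a b, t.vecCons_smul]
      simp only [smul_eq_mul]; ring)

lemma fundamentalForm_apply {V : Type*} [AddCommGroup V] [Module ℝ V] [TopologicalSpace V]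
    (f : V [⋀^Fin 2]→L[ℝ] ℝ) (t : V [⋀^Fin 1]→L[ℝ] ℝ) (v w : V) :
    fundamentalForm f t v w = f ![v, w] + t ![v] * t ![w] := rfl

lemma separatingLeft_iff_det_ne_zero {V ι : Type*} [AddCommGroup V] [Module ℝ V]
    [Fintype ι] [DecidableEq ι] (b : Module.Basis ι ℝ V) (β : V →ₗ[ℝ] V →ₗ[ℝ] ℝ) :
    (∀ v, (∀ w, β v w = 0) → v = 0) ↔ (Matrix.of fun i j => β (b i) (b j)).det ≠ 0 := by
  have h := LinearMap.separatingLeft_iff_det_ne_zero (B := β) b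
  rwa [show LinearMap.toMatrix₂ b b β = Matrix.of fun i j => β (b i) (b j) from
    Matrix.ext fun i j => LinearMap.toMatrix₂_apply b b β i j] at h

/-- The derivative of the inverse chart is invertible, so nondegeneracy can be tested on coordinate
forms, which live on the fixed space E. -/
lemma nondegenerateAt_iff [FiniteDimensional ℝ E] [I.Boundaryless] [IsManifold I ∞ M]
    (Ω : DForm I M 2) (τ : DForm I M 1) (p : M) {y : E} (hy : y ∈ (extChartAt I p).target) :
    NondegenerateAt Ω τ ((extChartAt I p).symm y) ↔
      ∀ v, (∀ w, fundamentalForm (Ω.inChart p y) (τ.inChart p y) v w = 0) → v = 0 := by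
  obtain ⟨e, he⟩ := isInvertible_mfderivWithin_extChartAt_symm (I := I) hy
  rw [I.range_eq_univ, mfderivWithin_univ] at he
  have h1 : ∀ v w : E, fundamentalForm (Ω.inChart p y) (τ.inChart p y) v w =
      Ω _ ![e v, e w] + τ _ ![e v] * τ _ ![e w] := by
    intro v w
    have he' : ∀ a : E, mfderiv 𝓘(ℝ, E) I (extChartAt I p).symm y a = e a := fun a =>
      congrArg (fun l : E →L[ℝ] E => l a) he.symm
    rw [fundamentalForm_apply]
    refine congrArg₂ (· + ·) ?_ (congrArg₂ (· * ·) ?_ ?_)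
    · refine congrArg (Ω _) ?_
      funext i
      fin_cases i
      · exact he' v
      · exact he' w
    · refine congrArg (τ _) ?_
      funext i
      fin_cases i
      exact he' v
    · refine congrArg (τ _) ?_
      funext i
      fin_cases i
      exact he' w
  constructor
  · intro h v hv
    have h2 := h (e v) fun w => by
      have h3 := (h1 v (e.symm w)).symm.trans (hv _)
      rw [e.apply_symm_apply] at h3
      exact h3
    exact e.injective (h2.trans (map_zero e).symm)
  · intro h v hv
    have h2 := h (e.symm v) fun w => by
      exact (h1 _ w).trans ((congrArg (fun z => Ω _ ![z, e w] + τ _ ![z] * τ _ ![e w])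
        (e.apply_symm_apply v)).trans (hv (e w)))
    exact e.symm.injective (h2.trans (map_zero e.symm).symm)

/-- In a chart, nondegeneracy is the nonvanishing of the Gram determinant of Ω + τ ⊗ τ in a fixed
basis, a continuous function of the point. -/
lemma eventually_nondegenerateAt [FiniteDimensional ℝ E] [I.Boundaryless] [IsManifold I ∞ M]
    {Ω : DForm I M 2} {τ : DForm I M 1} {p : M} (hΩ : Ω.SmoothAt p) (hτ : τ.SmoothAt p)
    (h : NondegenerateAt Ω τ p) : ∀ᶠ q in 𝓝 p, NondegenerateAt Ω τ q := by
  let b := Module.finBasis ℝ E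
  let G : E → ℝ := fun y =>
    (Matrix.of fun i j => fundamentalForm (Ω.inChart p y) (τ.inChart p y) (b i) (b j)).det
  have hG : ContinuousAt G (extChartAt I p p) := by
    have hev : ∀ {k : ℕ} (z : Fin k → E), Continuous fun f : E [⋀^Fin k]→L[ℝ] ℝ => f z :=
      fun z => (ContinuousAlternatingMap.apply ℝ E ℝ z).continuous
    refine ContinuousAt.comp (g := Matrix.det) (continuous_id.matrix_det).continuousAt ?_
    refine continuousAt_pi.2 fun i => continuousAt_pi.2 fun j => ?_
    exact ((hev _).continuousAt.comp hΩ.continuousAt).add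
      (((hev _).continuousAt.comp hτ.continuousAt).mul ((hev _).continuousAt.comp hτ.continuousAt))
  have h0 : G (extChartAt I p p) ≠ 0 := by
    refine (separatingLeft_iff_det_ne_zero b _).1 ((nondegenerateAt_iff Ω τ p
      (mem_extChartAt_target p)).1 ?_)
    rwa [extChartAt_to_inv]
  filter_upwards [(continuousAt_extChartAt (I := I) p).eventually (hG.eventually_ne h0),
    (isOpen_extChartAt_source (I := I) p).mem_nhds (mem_extChartAt_source p)] with q hq hs
  have h1 := (nondegenerateAt_iff Ω τ p ((extChartAt I p).map_source hs)).2
    ((separatingLeft_iff_det_ne_zero b _).2 hq)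
  rwa [(extChartAt I p).left_inv hs] at h1

end DForm

end Nondegeneracy

/-! ### Separation and parity of the dimension of the jet bundle. -/

namespace TimeFibration

variable {E : Type*} [NormedAddCommGroup E] [NormedSpace ℝ E] [FiniteDimensional ℝ E]
  {H : Type*} [TopologicalSpace H] {I : ModelWithCorners ℝ E H} [I.Boundaryless]
  {N : Type*} [TopologicalSpace N] [ChartedSpace H N] [IsManifold I ∞ N]

lemma t2Space_jet [T2Space N] (ρ : TimeFibration I N) : T2Space ρ.Jet := by
  have : T2Space (TangentBundle I N) := FiberBundle.t2Space_totalSpace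
  exact inferInstanceAs (T2Space {v : TangentBundle I N // ρ.tdot v = 1})

/-- The dimension is 2n - 1 with n = dim E. A jet has nonzero velocity, so n ≥ 1 and the truncated
subtraction is a genuine one. -/
lemma odd_finrank_jetTan {ρ : TimeFibration I N} (v : ρ.Jet) : Odd (Module.finrank ℝ v.Tan) := by
  have h : Module.finrank ℝ v.Tan = Module.finrank ℝ (E × E) - 1 := finrank_euclideanSpace_fin
  have hE : Nontrivial E := by
    refine ⟨v.vec, 0, fun h0 => ?_⟩
    have h1 := v.dAt_vec
    rw [h0, map_zero] at h1
    exact zero_ne_one h1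
  have hpos : 0 < Module.finrank ℝ E := Module.finrank_pos
  rw [h, Module.finrank_prod]
  exact ⟨Module.finrank ℝ E - 1, by omega⟩

end TimeFibration

/-! ### Coisotropy and nondegeneracy along the zero section. -/

namespace VerticalDistribution

section Coisotropic

variable {E : Type*} [NormedAddCommGroup E] [NormedSpace ℝ E] [FiniteDimensional ℝ E]
  {H : Type*} [TopologicalSpace H] {I : ModelWithCorners ℝ E H} [I.Boundaryless]
  {Q : Type*} [TopologicalSpace Q] [ChartedSpace H Q]
  {F : Type*} [NormedAddCommGroup F] [NormedSpace ℝ F] [FiniteDimensional ℝ F]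
  {𝒦 : Q → Type*} [∀ q, TopologicalSpace (𝒦 q)] [∀ q, AddCommGroup (𝒦 q)] [∀ q, Module ℝ (𝒦 q)]
  [TopologicalSpace (TotalSpace F 𝒦)] [FiberBundle F 𝒦]
  [IsManifold I ∞ Q] [VectorBundle ℝ F 𝒦] [ContMDiffVectorBundle ∞ F 𝒦 I]
  [∀ q, IsTopologicalAddGroup (𝒦 q)] [∀ q, ContinuousSMul ℝ (𝒦 q)] {ρ : TimeFibration I Q}
  (K : VerticalDistribution ρ F 𝒦)

/-- The differential of the embedding of `J¹ρ` into `J¹ρ_K`. -/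
noncomputable def dZeroJet (v : ρ.Jet) : v.Tan →L[ℝ] (K.zeroJet v).Tan :=
  mfderiv 𝓘(ℝ, JetModel E) 𝓘(ℝ, JetModel (E × (F →L[ℝ] ℝ))) K.zeroJet v

/-- Vertical tangent vectors of `𝒦*` along the zero section. -/
noncomputable def vertPair (v : ρ.Jet) (u : ρ.vert v.base) (η : F →L[ℝ] ℝ) :
    K.ext.vert (K.zeroJet v).base :=
  ⟨(u.1, η), (K.ext_dAt_apply (K.zeroJet v).base (u.1, η)).trans u.2⟩

lemma dBase_dZeroJet (v : ρ.Jet) (w : v.Tan) :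
    ((K.zeroJet v).dBase (K.dZeroJet v w) : E × (F →L[ℝ] ℝ)) = (v.dBase w, 0) :=
  (TimeFibration.dBase_dProlong (ρ' := K.ext) _ _ v w).trans (mfderiv_dualZero v.base _)

lemma dZeroJet_add (v : ρ.Jet) (w w' : v.Tan) :
    K.dZeroJet v (w + w') = K.dZeroJet v w + K.dZeroJet v w' :=
  ContinuousLinearMap.map_add _ _ _

lemma dZeroJet_zero (v : ρ.Jet) : K.dZeroJet v 0 = 0 :=
  ContinuousLinearMap.map_zero _

lemma dt_dZeroJet (v : ρ.Jet) (w : v.Tan) : (K.zeroJet v).dt (K.dZeroJet v w) = v.dt w :=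
  TimeFibration.dt_dProlong (ρ' := K.ext) _ _ v w

lemma dZeroJet_verticalLift (v : ρ.Jet) (u : ρ.vert v.base) :
    K.dZeroJet v (v.verticalLift u) = (K.zeroJet v).verticalLift (K.vertPair v u 0) := by
  refine (TimeFibration.dProlong_verticalLift (ρ' := K.ext) _ _ v u).trans ?_
  refine congrArg (K.zeroJet v).verticalLift (Subtype.ext ?_)
  exact mfderiv_dualZero v.base u.1

lemma dZeroJet_injective (v : ρ.Jet) : Function.Injective (K.dZeroJet v) := by
  have h1 := mfderiv_comp v (K.contMDiff_jetProj.mdifferentiableAt (x := K.zeroJet v) (by simp))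
    (K.contMDiff_zeroJet.mdifferentiableAt (by simp))
  rw [show K.jetProj ∘ K.zeroJet = id from funext K.jetProj_zeroJet, mfderiv_id] at h1
  exact Function.LeftInverse.injective (g := mfderiv 𝓘(ℝ, JetModel (E × (F →L[ℝ] ℝ)))
    𝓘(ℝ, JetModel E) K.jetProj (K.zeroJet v)) fun w =>
      (congrArg (fun l : JetModel E →L[ℝ] JetModel E => l w) h1).symm

variable {K} (P : AlmostProduct K) (C : DualConnection I F 𝒦) {L : ρ.Jet → ℝ}

/-- L̃ restricts to L along the prolonged zero section, and ω is natural under prolongation. -/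
lemma pullback_zeroJet (hL : ContMDiff 𝓘(ℝ, JetModel E) 𝓘(ℝ, ℝ) ∞ L) (v : ρ.Jet) :
    (lagrangianForm (extendedLagrangian L P C) (K.zeroJet v)).compContinuousLinearMap
      (K.dZeroJet v) = lagrangianForm L v := by
  have h := TimeFibration.lagrangianForm_comp_prolong (ρ' := K.ext) (contMDiff_dualZero (I := I))
    (fun _ => rfl) (contMDiff_extendedLagrangian P C hL) v
  have h2 : extendedLagrangian L P C ∘ TimeFibration.prolong (ρ' := K.ext)
      (contMDiff_dualZero (I := I)) (fun _ => rfl) = L :=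
    funext (extendedLagrangian_zeroJet P C L)
  rw [h2] at h
  exact h.symm

lemma lagrangianForm_dZeroJet (hL : ContMDiff 𝓘(ℝ, JetModel E) 𝓘(ℝ, ℝ) ∞ L) (v : ρ.Jet)
    (w w' : v.Tan) : lagrangianForm (extendedLagrangian L P C) (K.zeroJet v)
      ![K.dZeroJet v w, K.dZeroJet v w'] = lagrangianForm L v ![w, w'] := by
  rw [← pullback_zeroJet P C hL v]
  refine congrArg _ ?_
  funext i
  fin_cases i <;> rfl

/-- Only the cross terms η(Pu') + η'(Pu) involve the new directions; they are the source of
nondegeneracy. -/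
lemma lagrangianForm_vertPair (hL : ContMDiff 𝓘(ℝ, JetModel E) 𝓘(ℝ, ℝ) ∞ L) (v : ρ.Jet)
    (u u' : ρ.vert v.base) (η η' : F →L[ℝ] ℝ) {m : (K.zeroJet v).Tan}
    (hm : (K.zeroJet v).dBase m = (u'.1, η')) :
    lagrangianForm (extendedLagrangian L P C) (K.zeroJet v)
      ![(K.zeroJet v).verticalLift (K.vertPair v u η), m] =
        -(v.fibreHessian L u u' +
          (η (projCoordL P v.base u'.1) + η' (projCoordL P v.base u.1))) := by
  rw [TimeFibration.Jet.lagrangianForm_verticalLift (contMDiff_extendedLagrangian P C hL)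
    (K.zeroJet v) (K.vertPair v u η) (K.vertPair v u' η') hm, fibreHessian_extendedLagrangian P C hL]
  rfl

/-- The vertical vector at `q` with given coordinates in `K`. -/
noncomputable def frameVert (K : VerticalDistribution ρ F 𝒦) (q : Q) (c : F) : ρ.vert q :=
  K.toVert q (frame F q q c)

lemma frameVert_coe (q : Q) (c : F) : (K.frameVert q c).1 = K.inclCoord q q c :=
  (K.inclCoord_self q c).symm

lemma verticalLift_frameVert_mem (v : ρ.Jet) (c : F) :
    v.verticalLift (K.frameVert v.base c) ∈ K.completeLift v :=
  (K.mem_completeLift_iff v _).2 ⟨_, K.dTan_verticalLift_toVert v _⟩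

/-- Vertical lifts of K are characteristic, and every vertical u is the base projection of some
tangent vector, against which ω_L computes the Hessian. -/
lemma fibreHessian_frameVert (hL : ContMDiff 𝓘(ℝ, JetModel E) 𝓘(ℝ, ℝ) ∞ L)
    (hK : ∀ (v : ρ.Jet) (w : v.Tan), IsCharacteristic L v w ↔ w ∈ K.completeLift v)
    (v : ρ.Jet) (c : F) (u : ρ.vert v.base) : v.fibreHessian L (K.frameVert v.base c) u = 0 := by
  obtain ⟨w, hw⟩ := v.exists_dBase_eq u.1
  have h := TimeFibration.Jet.lagrangianForm_verticalLift hL v (K.frameVert v.base c) u hw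
  rw [((hK v _).2 (K.verticalLift_frameVert_mem v c)).1 w] at h
  exact neg_eq_zero.1 h.symm

lemma exists_vert_of_dt_eq_zero {v : ρ.Jet} {y : (K.zeroJet v).Tan} (hy : (K.zeroJet v).dt y = 0) :
    ∃ (u : ρ.vert v.base) (η : F →L[ℝ] ℝ), (K.zeroJet v).dBase y = (u.1, η) := by
  refine ⟨⟨((K.zeroJet v).dBase y).1, ?_⟩, ((K.zeroJet v).dBase y).2, rfl⟩
  rw [TimeFibration.Jet.dt_apply] at hy
  exact (K.ext_dAt_apply _ _).symm.trans hy

/-- The orthogonal of `TJ¹ρ` along the zero section is contained in `TJ¹ρ`. -/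
lemma mem_range_dZeroJet (hL : ContMDiff 𝓘(ℝ, JetModel E) 𝓘(ℝ, ℝ) ∞ L)
    (hK : ∀ (v : ρ.Jet) (w : v.Tan), IsCharacteristic L v w ↔ w ∈ K.completeLift v)
    (v : ρ.Jet) {y : (K.zeroJet v).Tan} (hy : (K.zeroJet v).dt y = 0)
    (h : ∀ w : v.Tan, v.dt w = 0 → lagrangianForm (extendedLagrangian L P C) (K.zeroJet v)
      ![y, K.dZeroJet v w] = 0) : ∃ a : v.Tan, K.dZeroJet v a = y := by
  let p := K.zeroJet v
  obtain ⟨u, η, hu⟩ := exists_vert_of_dt_eq_zero hy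
  have hη : η = 0 := by
    ext c
    -- Pairing y with the vertical lift of c in K leaves only η(c): Hess L vanishes on K, and P
    -- fixes K.
    have h1 := h _ (v.dt_verticalLift (K.frameVert v.base c))
    rw [DForm.map_swap_two, dZeroJet_verticalLift, lagrangianForm_vertPair P C hL v _ u 0 η hu,
      fibreHessian_frameVert hL hK, frameVert_coe, projCoordL_eq_self] at h1
    simpa using h1
  obtain ⟨a, ha⟩ := v.exists_dBase_eq u.1
  have h2 : p.dBase (y - K.dZeroJet v a) = 0 := by
    refine (ContinuousLinearMap.map_sub _ _ _).trans ?_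
    rw [hu, dBase_dZeroJet, ha, hη, sub_self]
  obtain ⟨z, hz⟩ := p.exists_verticalLift_eq h2
  let z₁ : ρ.vert v.base := K.vertProj v z
  have hz1 : z = K.vertPair v z₁ 0 + K.vertPair v 0 z.1.2 := by
    apply Subtype.ext
    change z.1 = (z.1.1, (0 : F →L[ℝ] ℝ)) + ((0 : E), z.1.2)
    simp
  -- After matching base projections, y differs from the image of a by the vertical lift of some
  -- (z₁, μ). The part z₁ comes from a vertical lift on J¹ρ and is absorbed into a'.
  let a' := a + v.verticalLift z₁
  have hya : y = K.dZeroJet v a' + p.verticalLift (K.vertPair v 0 z.1.2) := by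
    have h3 : p.verticalLift z = p.verticalLift (K.vertPair v z₁ 0) +
        p.verticalLift (K.vertPair v 0 z.1.2) :=
      (congrArg p.verticalLift hz1).trans (ContinuousLinearMap.map_add _ _ _)
    rw [dZeroJet_add, dZeroJet_verticalLift, add_assoc, ← h3, hz]
    exact (add_sub_cancel _ _).symm
  have hμ : z.1.2 = 0 := by
    ext c
    -- The test vector w lies in K^C and projects to c. Being characteristic, it is ω_L-orthogonal
    -- to a', so only μ(Pc) = μ(c) remains.
    obtain ⟨w, hw⟩ := K.exists_dTan_eq_liftCoord v (c, 0)
    have hwK := (hK v w).2 ((K.mem_completeLift_iff v w).2 ⟨_, hw⟩)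
    have hwb : v.dBase w = (K.frameVert v.base c).1 := by
      rw [← TimeFibration.Jet.dTan_fst, hw, frameVert_coe]
      rfl
    have hwp : p.dBase (K.dZeroJet v w) = ((K.frameVert v.base c).1, 0) := by
      rw [dBase_dZeroJet, hwb]
    have h3 := h w hwK.2
    have h4 : lagrangianForm L v ![a', w] = 0 := by
      rw [DForm.map_swap_two, hwK.1, neg_zero]
    have h5 : v.fibreHessian L 0 (K.frameVert v.base c) = 0 := by
      rw [TimeFibration.Jet.fibreHessian, map_zero]
      rfl
    rw [hya, ContinuousAlternatingMap.vecCons_add, lagrangianForm_dZeroJet P C hL, h4,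
      lagrangianForm_vertPair P C hL v 0 _ _ 0 hwp, h5, frameVert_coe, projCoordL_eq_self] at h3
    simpa using h3
  refine ⟨a', ?_⟩
  rw [hya, hμ]
  have h0 : p.verticalLift (K.vertPair v 0 0) = 0 := ContinuousLinearMap.map_zero _
  rw [h0, add_zero]

/-- A null vector is orthogonal to the image, hence tangent to it by coisotropy, and then comes from
K^C since ω_L is the pull-back. The duality of K with K* in the Hessian kills both of its
coordinates (c, b). -/
lemma nondegenerateAt_zeroJet (hL : ContMDiff 𝓘(ℝ, JetModel E) 𝓘(ℝ, ℝ) ∞ L)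
    (hK : ∀ (v : ρ.Jet) (w : v.Tan), IsCharacteristic L v w ↔ w ∈ K.completeLift v) (v : ρ.Jet) :
    DForm.NondegenerateAt (lagrangianForm (extendedLagrangian L P C)) (timeForm K.ext)
      (K.zeroJet v) := by
  intro y hy
  let p := K.zeroJet v
  have hyt : p.dt y = 0 := by
    -- On y itself the 2-form vanishes by antisymmetry, leaving dt(y)² = 0.
    have h1 := hy y
    have h2 : lagrangianForm (extendedLagrangian L P C) p ![y, y] = 0 :=
      self_eq_neg.1 (DForm.map_swap_two _ y y)
    rw [h2, zero_add] at h1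
    exact mul_self_eq_zero.1 h1
  have hΩ : ∀ w, lagrangianForm (extendedLagrangian L P C) p ![y, w] = 0 := fun w => by
    have h1 := hy w
    have h2 : timeForm K.ext p ![y] = 0 := hyt
    rwa [h2, zero_mul, add_zero] at h1
  obtain ⟨a, rfl⟩ := mem_range_dZeroJet P C hL hK v hyt fun w _ => hΩ _
  have ha : a ∈ K.completeLift v := (hK v a).1
    ⟨fun w => by rw [← lagrangianForm_dZeroJet P C hL]; exact hΩ _, (K.dt_dZeroJet v a).symm.trans hyt⟩
  obtain ⟨⟨c, b⟩, hz⟩ := (K.mem_completeLift_iff v a).1 ha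
  have hab : v.dBase a = (K.frameVert v.base c).1 := by
    rw [← TimeFibration.Jet.dTan_fst, hz, frameVert_coe]
    rfl
  have hc : c = 0 := by
    refine SeparatingDual.eq_zero_of_forall_dual_eq_zero (R := ℝ) fun μ => ?_
    have hm : p.dBase (K.dZeroJet v a) = ((K.frameVert v.base c).1, 0) := by
      rw [dBase_dZeroJet, hab]
    -- Pairing with the vertical lift of μ in K* returns μ(c) up to sign.
    have h1 := hΩ (p.verticalLift (K.vertPair v 0 μ))
    have h5 : v.fibreHessian L 0 (K.frameVert v.base c) = 0 := by
      rw [TimeFibration.Jet.fibreHessian, map_zero]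
      rfl
    rw [DForm.map_swap_two, lagrangianForm_vertPair P C hL v 0 _ μ 0 hm, h5, frameVert_coe,
      projCoordL_eq_self] at h1
    simpa using h1
  have hav : a = v.verticalLift (K.frameVert v.base b) := by
    refine v.dTan_injective ?_
    rw [hz, hc, TimeFibration.Jet.dTan_verticalLift, liftCoord_apply, frameVert_coe]
    simp
  have hb : b = 0 := by
    refine SeparatingDual.eq_zero_of_forall_dual_eq_zero (R := ℝ) fun μ => ?_
    -- Once c = 0 the vector is the vertical lift of b; pairing it with a vector whose base
    -- projection is μ returns μ(b) up to sign.
    obtain ⟨m, hm⟩ := p.exists_dBase_eq ((0 : ρ.vert v.base).1, μ)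
    have h1 := hΩ m
    rw [hav, dZeroJet_verticalLift, lagrangianForm_vertPair P C hL v _ 0 0 μ hm,
      fibreHessian_frameVert hL hK, frameVert_coe, projCoordL_eq_self] at h1
    simpa using h1
  have ha0 : a = 0 := by
    refine v.dTan_injective ?_
    rw [hz, hc, hb, map_zero]
    exact map_zero (K.liftCoord v)
  rw [ha0, dZeroJet_zero]

end Coisotropic

end VerticalDistribution

/-! ### Assembly of the theorem. -/

theorem mainTheorem3
    {E : Type*} [NormedAddCommGroup E] [NormedSpace ℝ E] [FiniteDimensional ℝ E]
    {Q : Type*} [TopologicalSpace Q] [ChartedSpace E Q] [IsManifold 𝓘(ℝ, E) ∞ Q]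
    [T2Space Q] [SecondCountableTopology Q]
    {F : Type*} [NormedAddCommGroup F] [NormedSpace ℝ F] [FiniteDimensional ℝ F]
    {𝒦 : Q → Type*} [∀ q, TopologicalSpace (𝒦 q)] [∀ q, AddCommGroup (𝒦 q)]
    [∀ q, Module ℝ (𝒦 q)] [∀ q, IsTopologicalAddGroup (𝒦 q)] [∀ q, ContinuousSMul ℝ (𝒦 q)]
    [TopologicalSpace (TotalSpace F 𝒦)] [FiberBundle F 𝒦] [VectorBundle ℝ F 𝒦]
    [ContMDiffVectorBundle ∞ F 𝒦 𝓘(ℝ, E)]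
    (ρ : TimeFibration 𝓘(ℝ, E) Q)
    (L : ρ.Jet → ℝ) (hL : ContMDiff 𝓘(ℝ, JetModel E) 𝓘(ℝ, ℝ) ∞ L)
    (hsing : ¬ IsRegularLagrangian L) (hcons : IsConsistentLagrangian L)
    (K : VerticalDistribution ρ F 𝒦)
    (hK : ∀ (v : ρ.Jet) (w : v.Tan), IsCharacteristic L v w ↔ w ∈ K.completeLift v)
    (C : DualConnection 𝓘(ℝ, E) F 𝒦) (P : AlmostProduct K) :
    ∃ α : K.ext.Jet ≃ K.DualCompleteLift, K.IsTulczyjew α ∧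
      ContMDiff 𝓘(ℝ, JetModel (E × (F →L[ℝ] ℝ))) 𝓘(ℝ, ℝ) ∞
        (VerticalDistribution.extendedLagrangian L P C) ∧
      ∃ U : Set K.ext.Jet, IsOpen U ∧
        IsCosymplecticOn U
          (lagrangianForm (VerticalDistribution.extendedLagrangian L P C)) (timeForm K.ext) ∧
        IsCoisotropicEmbedding (fun v : ρ.Jet => α.symm (K.zeroDual v)) U
          (lagrangianForm L) (timeForm ρ)
          (lagrangianForm (VerticalDistribution.extendedLagrangian L P C)) (timeForm K.ext) := by
  have hz : (fun v : ρ.Jet => K.tulczyjew.symm (K.zeroDual v)) = K.zeroJet := funext fun v =>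
    (Equiv.symm_apply_eq _).2 (K.tulczyjew_zeroJet v).symm
  have hL' := VerticalDistribution.contMDiff_extendedLagrangian P C hL
  let Ω := lagrangianForm (VerticalDistribution.extendedLagrangian L P C)
  have hΩ : ∀ ξ, Ω.SmoothAt ξ := fun ξ => TimeFibration.Jet.smoothAt_lagrangianForm hL' ξ
  have hτ : ∀ ξ, (timeForm K.ext).SmoothAt ξ := fun ξ => K.ext.smoothAt_timeForm ξ
  refine ⟨K.tulczyjew, K.isTulczyjew_tulczyjew, hL',
    -- Smoothness, closedness and odd dimension hold on the whole jet bundle, so U can be taken as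
    -- the full nondegeneracy locus.
    {ξ | DForm.NondegenerateAt Ω (timeForm K.ext) ξ},
    isOpen_iff_mem_nhds.2 fun ξ hξ => DForm.eventually_nondegenerateAt (hΩ ξ) (hτ ξ) hξ, ?_, ?_⟩
  · exact
      { odd_dim := fun ξ _ => TimeFibration.odd_finrank_jetTan ξ
        smooth_two := fun ξ _ => hΩ ξ
        smooth_one := fun ξ _ => hτ ξ
        closed_two := fun ξ _ => TimeFibration.Jet.d_lagrangianForm hL' ξ
        closed_one := fun ξ _ => K.ext.d_timeForm ξ
        nondegenerate := fun ξ hξ => hξ }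
  · rw [hz]
    have : T2Space (DualTotal F 𝒦) := FiberBundle.t2Space_totalSpace
    have : T2Space K.ext.Jet := K.ext.t2Space_jet
    exact
      { smooth := K.contMDiff_zeroJet
        immersive := K.dZeroJet_injective
        -- A continuous section of a continuous map has closed image when the ambient space is
        -- Hausdorff; here the ambient space is the jet bundle of 𝒦*.
        closedEmbedding := Function.LeftInverse.isClosedEmbedding K.jetProj_zeroJet
          K.contMDiff_jetProj.continuous K.contMDiff_zeroJet.continuous
        range_subset := by
          rintro _ ⟨v, rfl⟩
          exact VerticalDistribution.nondegenerateAt_zeroJet P C hL hK v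
        pullback_two := VerticalDistribution.pullback_zeroJet P C hL
        pullback_one := fun v => by
          ext w
          exact K.dt_dZeroJet v (w 0)
        coisotropic := fun v y hy h =>
          VerticalDistribution.mem_range_dZeroJet P C hL hK v hy fun w hw =>
            h w ((K.dt_dZeroJet v w).trans hw) }
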